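/- Let $n\ge 1$, $d\ge 2$, let $\mathcal U\subset\mathbb R^n$ be open, and consider the system of viscous conservation laws $$u_t+\sum_{j=1}^d f^j(u)_{x_j}=\sum_{j,k=1}^d\bigl(B^{jk}(u)u_{x_k}\bigr)_{x_j},\qquad u\in\mathcal U,\ x\in\mathbb R^d .$$ For $(a,s,\nu,q)\in\mathcal U\times\mathbb R\times S^{d-1}\times\mathbb R^n$ let $u(y;a,s,\nu,q)$ be the local solution of the profile equation $$\sum_{j,k}\nu_j\nu_kB^{jk}(u)u'=\sum_j\nu_jf^j(u)-su-q,\qquad u(0)=a,$$ with values in $\mathcal U$. Let $\bar u=\bar u(x_1)$ be a nonconstant stationary solution with values in $\mathcal U$, periodic of period $\bar X>0$, with $B^{11}(\bar u)\bar u'=f^1(\bar u)-\bar q$ (so $s=0$, $\nu=e_1$). Assume: (H0) $f^j,B^{jk}\in C^2(\mathcal U)$; (H1) there is $\theta>0$ such that $\operatorname{Re}\sigma\bigl(\sum_{j,k}\nu_j\nu_kB^{jk}(u)\bigr)\ge\theta$ for all $u\in\mathcal U$, $\nu\in S^{d-1}$; (H2) the map $H:(X;a,s,\nu,q)\mapsto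 u(X;a,s,\nu,q)-a\in\mathbb R^n$ is a submersion at $(\bar X;\bar u(0),0,e_1,\bar q)$. By (H0)--(H2), the zeros of $H$ near this point, modulo translation $u\mapsto u(\cdot-h)$ of the profile, form an $(n+d)$-dimensional manifold $\mathcal P$ of classes $\dot u$ of periodic profiles. On $\mathcal P$ let $X$ be the period, $\Omega=1/X$, $S=s$, $N=\nu$, and $$M=\frac1X\int_0^Xu\,dy,\qquad F^j=\frac1X\int_0^X\Bigl(f^j(u)-\sum_{k=1}^dB^{jk}(u)\,\nu_k\,\partial_yu\Bigr)dy .$$ The averaged system is $$\partial_tM+\sum_j\partial_{x_j}F^j=0,\qquad \partial_t(\Omega N)+\nabla_x(\Omega S)=0 .$$ Assume the nondegeneracy condition $\det\bigl(\partial(M,\Omega N)/\partial\dot u\bigr)(\dot{\bar u})\neq0$. Let $B^{jk}=B^{jk}(\bar u(x_1))$ and $A^jv=Df^j(\bar u)v-(DB^{j1}(\bar u)v)\bar u'$. For $\xi=(\xi_1,\tilde\xi)\in\mathbb R^d$ and $\lambda\in\mathbb C$, let $w^1,\dots,w^{2n}$ be the basis of the solution space of $$(B^{11}w')'-(A^1w)'+i\sum_{j\ne1}\xi_jB^{j1}w'+i\Bigl(\sum_{k\ne1}\xi_kB^{1k}w\Bigr)'-i\sum_{j\ne1}\xi_jA^jw-\sum_{j,k\ne1}\xi_j\xi_kB^{jk}w-\lambda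 w=0$$ normalized, for $j=1,\dots,n$, by $w^j(0)=e_j$, $(w^j)'(0)=(B^{11})^{-1}A^1e_j$, $w^{n+j}(0)=0$, $(w^{n+j})'(0)=-(B^{11})^{-1}e_j$ (coefficients at $x_1=0$), and define the Evans function $$D(\xi,\lambda)=\det\begin{pmatrix}w^l(\bar X)-e^{i\bar X\xi_1}w^l(0)\\ (w^l)'(\bar X)-e^{i\bar X\xi_1}(w^l)'(0)\end{pmatrix}_{1\le l\le 2n}.$$ Then a necessary condition for low-frequency spectral stability of $\bar u$, i.e. for the existence of $r>0$ such that $\operatorname{Re}\lambda\le0$ whenever $D(\xi,\lambda)=0$, $\xi\in\mathbb R^d$, $\lambda\in\mathbb C$, $|\xi|<r$, $|\lambda|<r$, is that the averaged system be weakly hyperbolic at $\dot{\bar u}$: for every $\xi\in\mathbb R^d$, all eigenvalues of $$\mathcal A=\sum_j\xi_j\,\frac{\partial(F^j,S\Omega e_j)}{\partial(M,\Omega N)}(\dot{\bar u})$$ are real. -/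

import Mathlib

open scoped Matrix

noncomputable section

/-- Data of a system of viscous conservation laws
`u_t + ∑ⱼ fʲ(u)_{xⱼ} = ∑ⱼₖ (Bʲᵏ(u) u_{xₖ})_{xⱼ}`, with `u` in `U ⊆ ℝⁿ` and `x ∈ ℝᵈ`, `d = m + 1`.
Space directions are indexed by `Fin (m + 1)`; the direction `x₁` has index `0` and the transverse
directions `x₂, …, x_d` have the indices `j.succ`, `j : Fin m`. -/
structure ConsLaw (n m : ℕ) where
  U : Set (Fin n → ℝ)
  f : Fin (m + 1) → (Fin n → ℝ) → (Fin n → ℝ)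
  B : Fin (m + 1) → Fin (m + 1) → (Fin n → ℝ) → Matrix (Fin n) (Fin n) ℝ

/-- The chart `δ ↦ (1, δ) / √(1 + |δ|²)` of the unit sphere of `ℝᵈ` near `e₁`, with `δ = 0` at
`e₁`. -/
def nuChart {m : ℕ} (δ : Fin m → ℝ) : Fin (m + 1) → ℝ :=
  (Real.sqrt (1 + ∑ j, δ j ^ 2))⁻¹ • (Fin.cons 1 δ : Fin (m + 1) → ℝ)

/-- Tuples `(X, a, s, δ, q)`: period, initial value, speed, direction (through the chart
`nuChart`), constant of integration. -/
abbrev WaveParam (n m : ℕ) : Type :=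
  ℝ × (Fin n → ℝ) × ℝ × (Fin m → ℝ) × (Fin n → ℝ)

namespace WaveParam

variable {n m : ℕ}

def period (p : WaveParam n m) : ℝ := p.1
def init (p : WaveParam n m) : Fin n → ℝ := p.2.1
def speed (p : WaveParam n m) : ℝ := p.2.2.1
def dir (p : WaveParam n m) : Fin (m + 1) → ℝ := nuChart p.2.2.2.1
def const (p : WaveParam n m) : Fin n → ℝ := p.2.2.2.2

end WaveParam

namespace ConsLaw

variable {n m : ℕ} (L : ConsLaw n m)

/-- (H0): `U` is open and `fʲ`, `Bʲᵏ` are of class `C²` on it. -/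
def H0 : Prop :=
  IsOpen L.U ∧ (∀ j, ContDiffOn ℝ 2 (L.f j) L.U) ∧
    ∀ j k a b, ContDiffOn ℝ 2 (fun u => L.B j k u a b) L.U

/-- `∑ⱼₖ νⱼ νₖ Bʲᵏ(u)`. -/
def Bdir (ν : Fin (m + 1) → ℝ) (u : Fin n → ℝ) : Matrix (Fin n) (Fin n) ℝ :=
  ∑ j, ∑ k, (ν j * ν k) • L.B j k u

/-- `∑ⱼ νⱼ fʲ(u)`. -/
def fdir (ν : Fin (m + 1) → ℝ) (u : Fin n → ℝ) : Fin n → ℝ :=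
  ∑ j, ν j • L.f j u

/-- (H1): `Re σ(∑ⱼₖ νⱼ νₖ Bʲᵏ(u)) ≥ θ > 0` for `u ∈ U` and unit vectors `ν`. -/
def H1 : Prop :=
  ∃ θ : ℝ, 0 < θ ∧ ∀ u ∈ L.U, ∀ ν : Fin (m + 1) → ℝ, ∑ j, ν j ^ 2 = 1 →
    ∀ μ ∈ spectrum ℂ ((L.Bdir ν u).map (fun x : ℝ => (x : ℂ))), θ ≤ μ.re

/-- On the set `I`, the function `v` takes its values in `U` and solves the profile equation
`∑ⱼₖ νⱼ νₖ Bʲᵏ(v) v' = ∑ⱼ νⱼ fʲ(v) - s v - q`. -/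
def IsProfileOn (s : ℝ) (ν : Fin (m + 1) → ℝ) (q : Fin n → ℝ) (v : ℝ → Fin n → ℝ)
    (I : Set ℝ) : Prop :=
  ∀ y ∈ I, v y ∈ L.U ∧ DifferentiableAt ℝ v y ∧
    L.Bdir ν (v y) *ᵥ deriv v y = L.fdir ν (v y) - s • v y - q

open Classical in
/-- The solution `u(y; a, s, ν, q)` of the profile equation with `u(0) = a`, at every `y` up to
which it exists (and the dummy value `a` elsewhere). -/
def flow (p : WaveParam n m) (y : ℝ) : Fin n → ℝ :=
  if h : ∃ v : ℝ → Fin n → ℝ, v 0 = p.init ∧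
      L.IsProfileOn p.speed p.dir p.const v (Set.uIcc 0 y)
  then h.choose y else p.init

/-- The map `H : (X; a, s, ν, q) ↦ u(X; a, s, ν, q) - a`. -/
def H (p : WaveParam n m) : Fin n → ℝ := L.flow p p.period - p.init

/-- `M = X⁻¹ ∫₀ˣ u dy`. -/
def M (p : WaveParam n m) : Fin n → ℝ :=
  p.period⁻¹ • ∫ y in (0 : ℝ)..p.period, L.flow p y

/-- `Fʲ = X⁻¹ ∫₀ˣ (fʲ(u) - ∑ₖ νₖ Bʲᵏ(u) ∂_y u) dy`. -/
def F (j : Fin (m + 1)) (p : WaveParam n m) : Fin n → ℝ :=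
  p.period⁻¹ • ∫ y in (0 : ℝ)..p.period,
    (L.f j (L.flow p y) - ∑ k, p.dir k • (L.B j k (L.flow p y) *ᵥ deriv (L.flow p) y))

/-- `(M, Ω N)`, where `Ω = 1 / X` is the frequency and `N = ν` the direction. -/
def density (p : WaveParam n m) : Fin n ⊕ Fin (m + 1) → ℝ :=
  Sum.elim (L.M p) (p.period⁻¹ • p.dir)

/-- `(Fʲ, S Ω eⱼ)`. -/
def avgFlux (j : Fin (m + 1)) (p : WaveParam n m) : Fin n ⊕ Fin (m + 1) → ℝ :=
  Sum.elim (L.F j p) (Pi.single j (p.speed * p.period⁻¹))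

end ConsLaw

/-- A nonconstant periodic stationary wave `ū(x₁)` (speed `0`, direction `e₁`), of period `X`:
`B¹¹(ū) ū' = f¹(ū) - q`. -/
structure PeriodicWave {n m : ℕ} (L : ConsLaw n m) where
  u : ℝ → Fin n → ℝ
  X : ℝ
  q : Fin n → ℝ
  X_pos : 0 < X
  periodic : Function.Periodic u X
  nonconstant : ∃ x y, u x ≠ u y
  mem : ∀ x, u x ∈ L.U
  differentiable : Differentiable ℝ u
  profile : ∀ x, L.B 0 0 (u x) *ᵥ deriv u x = L.f 0 (u x) - q

namespace PeriodicWave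

variable {n m : ℕ} {L : ConsLaw n m} (W : PeriodicWave L)

/-! ### The manifold of periodic waves and the averaged system -/

/-- The point `(X̄; ū(0), 0, e₁, q̄)`. -/
def base : WaveParam n m := (W.X, W.u 0, 0, 0, W.q)

/-- (H2): the map `H` is a submersion at `(X̄; ū(0), 0, e₁, q̄)`. -/
def H2 : Prop := Function.Surjective (fderiv ℝ L.H W.base)

/-- The tangent space at `ū` of the manifold of periodic waves modulo translation. Near `ū`, the
periodic waves are the zeros of `H`, the translates of `ū` are the points with `a = ū(h)`, and the
section `(a - ū(0)) ⬝ ū'(0) = 0`, which is transverse to the latter, selects one representative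
of each class. -/
def tangent : Submodule ℝ (WaveParam n m) where
  carrier := {v | fderiv ℝ L.H W.base v = 0 ∧ v.init ⬝ᵥ deriv W.u 0 = 0}
  zero_mem' := by simp [WaveParam.init]
  add_mem' := by
    rintro v w ⟨h1, h2⟩ ⟨h3, h4⟩
    simp only [WaveParam.init] at h2 h4
    refine ⟨by rw [map_add, h1, h3, add_zero], ?_⟩
    simp [WaveParam.init, add_dotProduct, h2, h4]
  smul_mem' := by
    rintro c v ⟨h1, h2⟩
    simp only [WaveParam.init] at h2
    refine ⟨by rw [map_smul, h1, smul_zero], ?_⟩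
    simp [WaveParam.init, smul_dotProduct, h2]

/-- `∂(M, Ω N)/∂u̇` at `ū`. -/
def dDensity : W.tangent →ₗ[ℝ] (Fin n ⊕ Fin (m + 1) → ℝ) :=
  (fderiv ℝ L.density W.base).toLinearMap ∘ₗ W.tangent.subtype

/-- `∂(Fʲ, S Ω eⱼ)/∂u̇` at `ū`. -/
def dFlux (j : Fin (m + 1)) : W.tangent →ₗ[ℝ] (Fin n ⊕ Fin (m + 1) → ℝ) :=
  (fderiv ℝ (L.avgFlux j) W.base).toLinearMap ∘ₗ W.tangent.subtype

/-- The nondegeneracy condition `det ∂(M, Ω N)/∂u̇ ≠ 0`: the differential is invertible. -/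
def Nondegenerate : Prop := Function.Bijective W.dDensity

/-- `𝒜(ξ) = ∑ⱼ ξⱼ ∂(Fʲ, S Ω eⱼ)/∂(M, Ω N)`, as a real square matrix of size `n + d`. -/
def calA (h : W.Nondegenerate) (ξ : Fin (m + 1) → ℝ) :
    Matrix (Fin n ⊕ Fin (m + 1)) (Fin n ⊕ Fin (m + 1)) ℝ :=
  LinearMap.toMatrix' ((∑ j, ξ j • W.dFlux j) ∘ₗ
    (LinearEquiv.ofBijective W.dDensity h).symm.toLinearMap)

/-- Weak hyperbolicity of the averaged system at `ū`: for each real `ξ`, all complex eigenvalues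
of `𝒜(ξ)` are real. -/
def WeaklyHyperbolic (h : W.Nondegenerate) : Prop :=
  ∀ ξ : Fin (m + 1) → ℝ,
    ∀ μ ∈ spectrum ℂ ((W.calA h ξ).map (fun x : ℝ => (x : ℂ))), μ.im = 0

/-! ### The linearized operator and the Evans function -/

/-- `Bʲᵏ(ū(x))`, as a complex matrix. -/
def Bc (j k : Fin (m + 1)) (x : ℝ) : Matrix (Fin n) (Fin n) ℂ :=
  (L.B j k (W.u x)).map (fun r : ℝ => (r : ℂ))

/-- `Aʲ v = Dfʲ(ū) v - (DBʲ¹(ū) v) ū'`, as a real matrix. -/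
def A (j : Fin (m + 1)) (x : ℝ) : Matrix (Fin n) (Fin n) ℝ :=
  Matrix.of fun a b =>
    fderiv ℝ (L.f j) (W.u x) (Pi.single b 1) a -
      ∑ c, fderiv ℝ (fun u => L.B j 0 u a c) (W.u x) (Pi.single b 1) * deriv W.u x c

/-- `Aʲ` as a complex matrix. -/
def Ac (j : Fin (m + 1)) (x : ℝ) : Matrix (Fin n) (Fin n) ℂ :=
  (W.A j x).map (fun r : ℝ => (r : ℂ))

/-- `w` is a solution on `ℝ` of the eigenvalue equation `(L_{ξ̃} - λ) w = 0`, that is, of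
`(B¹¹w')' - (A¹w)' + i ∑ⱼ ξⱼ Bʲ¹ w' + i (∑ₖ ξₖ B¹ᵏ w)' - i ∑ⱼ ξⱼ Aʲ w - ∑ⱼₖ ξⱼ ξₖ Bʲᵏ w - λ w = 0`
with the sums over the transverse indices (`ξ₁` does not occur). -/
def IsKernelSol (ξ : Fin (m + 1) → ℝ) (lam : ℂ) (w : ℝ → Fin n → ℂ) : Prop :=
  Differentiable ℝ w ∧ Differentiable ℝ (deriv w) ∧ ∀ x : ℝ,
    deriv (fun t => W.Bc 0 0 t *ᵥ deriv w t) x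
      - deriv (fun t => W.Ac 0 t *ᵥ w t) x
      + Complex.I • ∑ j : Fin m, (ξ j.succ : ℂ) • (W.Bc j.succ 0 x *ᵥ deriv w x)
      + Complex.I • deriv (fun t => ∑ k : Fin m, (ξ k.succ : ℂ) • (W.Bc 0 k.succ t *ᵥ w t)) x
      - Complex.I • ∑ j : Fin m, (ξ j.succ : ℂ) • (W.Ac j.succ x *ᵥ w x)
      - ∑ j : Fin m, ∑ k : Fin m,
          ((ξ k.succ : ℂ) * (ξ j.succ : ℂ)) • (W.Bc j.succ k.succ x *ᵥ w x)
      - lam • w x = 0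

open Classical in
/-- The solution `w` of `(L_{ξ̃} - λ) w = 0` with `w(0) = α` and `w'(0) = β`. -/
def kernelSol (ξ : Fin (m + 1) → ℝ) (lam : ℂ) (α β : Fin n → ℂ) : ℝ → Fin n → ℂ :=
  if h : ∃ w, W.IsKernelSol ξ lam w ∧ w 0 = α ∧ deriv w 0 = β then h.choose else 0

/-- The basis `w¹, …, w²ⁿ` of the kernel of `L_{ξ̃} - λ` with
`wʲ(0) = eⱼ`, `(wʲ)'(0) = (B¹¹)⁻¹ A¹ eⱼ` and `wⁿ⁺ʲ(0) = 0`, `(wⁿ⁺ʲ)'(0) = -(B¹¹)⁻¹ eⱼ`. -/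
def kernelBasis (ξ : Fin (m + 1) → ℝ) (lam : ℂ) : Fin n ⊕ Fin n → ℝ → Fin n → ℂ
  | Sum.inl j => W.kernelSol ξ lam (Pi.single j 1)
      ((W.Bc 0 0 0)⁻¹ *ᵥ (W.Ac 0 0 *ᵥ Pi.single j 1))
  | Sum.inr j => W.kernelSol ξ lam 0 (-((W.Bc 0 0 0)⁻¹ *ᵥ Pi.single j 1))

/-- The Evans function: the determinant of the matrix with the columns
`(wˡ(X) - e^{iXξ₁} wˡ(0), (wˡ)'(X) - e^{iXξ₁} (wˡ)'(0))`, `1 ≤ l ≤ 2n`. -/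
def evans (ξ : Fin (m + 1) → ℝ) (lam : ℂ) : ℂ :=
  Matrix.det (Matrix.of fun (r l : Fin n ⊕ Fin n) =>
    Sum.elim
      (W.kernelBasis ξ lam l W.X
        - Complex.exp (Complex.I * W.X * ξ 0) • W.kernelBasis ξ lam l 0)
      (deriv (W.kernelBasis ξ lam l) W.X
        - Complex.exp (Complex.I * W.X * ξ 0) • deriv (W.kernelBasis ξ lam l) 0) r)

/-- Low-frequency spectral stability: `Re λ ≤ 0` whenever `D(ξ, λ) = 0`, `ξ` is real, and
`(ξ, λ)` is sufficiently small. -/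
def LowFreqStable : Prop :=
  ∃ r : ℝ, 0 < r ∧ ∀ (ξ : Fin (m + 1) → ℝ) (lam : ℂ),
    ‖ξ‖ < r → ‖lam‖ < r → W.evans ξ lam = 0 → lam.re ≤ 0

end PeriodicWave

end

/-! The argument is a low-frequency limit on the Floquet problem. Fix a direction `ξ` and look for
solutions of the eigenvalue equation with frequency `ε ξ` and eigenvalue `ε λ`. Since `ū'` spans the
translation mode, the ansatz is `w = (c / ε) ū' + v`, with flux `B¹¹w' - A¹w + i ∑ₖ ε ξₖ B¹ᵏ w = c
(i ∑ⱼ ξⱼ gʲ + λ ū) - q + ε y`, where `gʲ = fʲ(ū) - Bʲ¹(ū) ū'` and the sums are transverse. The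
identities `A¹ū' = B¹¹ū''` and `(gʲ)' = Aʲū' - Bʲ¹ū''` cancel all negative powers of `ε`. What
remains is a first-order system for `(v, y)`, with constants `(c, q)`, whose coefficients are affine
in `(ε, λ)` and regular at `ε = 0` (`sysMap`, `IsEigPair.isKernelSol`). Its evolution operator is
holomorphic in `(ε, λ)`, and so is the determinant of the square map `jumpMap`, which sends data
`(c, v(0), q)` to the normalization `v(0) ⬝ ū'(0)` and the defect in the Floquet conditions. For
real `ε ≠ 0` a zero of this determinant is a zero of the Evans function at `(ε ξ, ε λ)`
(`IsEigPair.evans_eq_zero`).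

At `ε = 0` the system is the linearized profile equation, for a complex variation of the parameters
with speed `-λ c`, direction `i c ξⱼ`, constant `q` and period `-i X ξ₁ c`; `y` collects the
variations of the integrals in `M` and the transverse `Fʲ` (`IsEigPair.eq_variation`). The Floquet
conditions then say that the variation is tangent to the manifold of periodic waves and that `λ dM +
i ∑ⱼ ξⱼ dFʲ = 0`. The analogous identity for `(Ω N, S Ω)` is exactly the above choice of period and
direction. So for `λ ≠ 0` the limiting determinant vanishes if and only if `i λ` is an eigenvalue of
`𝒜(ξ)` (`mem_spectrum_of_isEigPair`, `exists_isEigPair_of_mem_spectrum`).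

An eigenvalue `μ` of `𝒜(ξ)` with `Im μ > 0` gives the zero `λ = -i μ` of the limiting determinant,
with `Re λ > 0`. It is isolated, hence persists for small `ε > 0`
(`eventually_exists_zero_of_differentiableOn`) and yields arbitrarily small unstable zeros of the
Evans function. The case `Im μ < 0` follows from `𝒜(-ξ) = -𝒜(ξ)`.

The identification at `ε = 0` needs the derivatives of `H`, `M` and `Fʲ`. They all come from
`exists_flow_hasFDerivAt`, applied to the profile equation rescaled to unit time and augmented by
its parameters and by the primitives of the integrands (`exists_isVariation`). -/

/-! ### Linear equations in a Banach algebra. -/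

section

open BoundedContinuousFunction in
/-- The operator `f ↦ e^{-L|t|} ∫₀ᵗ e^{L|s|} f(s) ds` on bounded continuous functions. -/
theorem exists_weightedPrimitive (𝕜 : Type*) [RCLike 𝕜] {M : Type*} [NormedAddCommGroup M]
    [NormedSpace ℝ M] [NormedSpace 𝕜 M] [SMulCommClass ℝ 𝕜 M] [CompleteSpace M]
    (L : ℝ) (hL : 0 < L) : ∃ W : (ℝ →ᵇ M) →L[𝕜] (ℝ →ᵇ M), ‖W‖ ≤ L⁻¹ ∧ ∀ f t, W f t =
      Real.exp (-(L * |t|)) • ∫ s in (0 : ℝ)..t, Real.exp (L * |s|) • f s :=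
  have hint : ∀ (f : ℝ →ᵇ M) (t : ℝ), IntervalIntegrable
      (fun s => Real.exp (L * |s|) • f s) MeasureTheory.volume 0 t := fun f t =>
    (Continuous.intervalIntegrable (by fun_prop) _ _)
  have hbd : ∀ (f : ℝ →ᵇ M) (t : ℝ),
      ‖Real.exp (-(L * |t|)) • ∫ s in (0 : ℝ)..t, Real.exp (L * |s|) • f s‖ ≤ L⁻¹ * ‖f‖ := by
    intro f t
    have key : ‖∫ s in (0 : ℝ)..t, Real.exp (L * |s|) • f s‖ ≤
        L⁻¹ * ‖f‖ * Real.exp (L * |t|) := by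
      have hle : ∀ s, ‖Real.exp (L * |s|) • f s‖ ≤ Real.exp (L * |s|) * ‖f‖ := by
        intro s
        rw [norm_smul, Real.norm_eq_abs, abs_of_pos (Real.exp_pos _)]
        exact mul_le_mul_of_nonneg_left (f.norm_coe_le_norm s) (Real.exp_pos _).le
      rcases le_total 0 t with ht | ht
      · calc _ ≤ ∫ s in (0 : ℝ)..t, Real.exp (L * s) * ‖f‖ := by
              refine intervalIntegral.norm_integral_le_of_norm_le ht
                (Filter.Eventually.of_forall fun s hs => ?_)
                (Continuous.intervalIntegrable (by fun_prop) _ _)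
              have h := hle s; rwa [abs_of_pos hs.1] at h ⊢
          _ = L⁻¹ * Real.exp (L * t) * ‖f‖ - L⁻¹ * ‖f‖ := by
              have := intervalIntegral.integral_eq_sub_of_hasDerivAt (a := 0) (b := t)
                (f := fun s => L⁻¹ * Real.exp (L * s) * ‖f‖)
                (f' := fun s => Real.exp (L * s) * ‖f‖) (fun s _ => by
                  have h := ((((hasDerivAt_id s).const_mul L).exp).const_mul L⁻¹).mul_const ‖f‖
                  refine h.congr_deriv ?_
                  show L⁻¹ * (Real.exp (L * s) * (L * 1)) * ‖f‖ = Real.exp (L * s) * ‖f‖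
                  field_simp) (Continuous.intervalIntegrable (by fun_prop) _ _)
              simpa using this
          _ ≤ _ := by
              rw [abs_of_nonneg ht]
              have : 0 ≤ L⁻¹ * ‖f‖ := by positivity
              linarith
      · rw [intervalIntegral.integral_symm, norm_neg]
        calc _ ≤ ∫ s in t..(0 : ℝ), Real.exp (-(L * s)) * ‖f‖ := by
              refine intervalIntegral.norm_integral_le_of_norm_le ht
                (Filter.Eventually.of_forall fun s hs => ?_)
                (Continuous.intervalIntegrable (by fun_prop) _ _)
              have h := hle s; rwa [abs_of_nonpos hs.2, mul_neg] at h ⊢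
          _ = L⁻¹ * Real.exp (-(L * t)) * ‖f‖ - L⁻¹ * ‖f‖ := by
              have := intervalIntegral.integral_eq_sub_of_hasDerivAt (a := t) (b := 0)
                (f := fun s => -(L⁻¹ * Real.exp (-(L * s)) * ‖f‖))
                (f' := fun s => Real.exp (-(L * s)) * ‖f‖) (fun s _ => by
                  have h :=
                    (((((hasDerivAt_id s).const_mul L).neg.exp).const_mul L⁻¹).mul_const ‖f‖).neg
                  refine h.congr_deriv ?_
                  show -(L⁻¹ * (Real.exp (-(L * s)) * -(L * 1)) * ‖f‖) = Real.exp (-(L * s)) * ‖f‖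
                  field_simp)
                  (Continuous.intervalIntegrable (by fun_prop) _ _)
              rw [this]; simp; ring
          _ ≤ _ := by
              rw [abs_of_nonpos ht]
              have : 0 ≤ L⁻¹ * ‖f‖ := by positivity
              rw [mul_neg]
              linarith
    rw [norm_smul, Real.norm_eq_abs, abs_of_pos (Real.exp_pos _)]
    calc _ ≤ Real.exp (-(L * |t|)) * (L⁻¹ * ‖f‖ * Real.exp (L * |t|)) :=
          mul_le_mul_of_nonneg_left key (Real.exp_pos _).le
      _ = L⁻¹ * ‖f‖ * (Real.exp (-(L * |t|)) * Real.exp (L * |t|)) := by ring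
      _ = L⁻¹ * ‖f‖ := by rw [← Real.exp_add]; simp
  let W₀ : (ℝ →ᵇ M) →ₗ[𝕜] (ℝ →ᵇ M) :=
    { toFun := fun f => ofNormedAddCommGroup
        (fun t => Real.exp (-(L * |t|)) • ∫ s in (0 : ℝ)..t, Real.exp (L * |s|) • f s)
        ((by fun_prop : Continuous fun t : ℝ => Real.exp (-(L * |t|))).smul
          (intervalIntegral.continuous_primitive (fun a b =>
            (Continuous.intervalIntegrable (by fun_prop) _ _)) 0))
        (L⁻¹ * ‖f‖) (hbd f)
      map_add' := by
        intro f g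
        ext t
        simp [← smul_add, ← intervalIntegral.integral_add (hint f t) (hint g t)]
      map_smul' := by
        intro c f
        ext t
        simp [smul_comm _ c, intervalIntegral.integral_smul] }
  ⟨W₀.mkContinuous L⁻¹ (fun f => norm_ofNormedAddCommGroup_le _ (by positivity) (hbd f)),
    LinearMap.mkContinuous_norm_le _ (by positivity) _, fun _ _ => rfl⟩

lemma differentiableAt_inverse_one_sub {𝕜 P R : Type*} [NontriviallyNormedField 𝕜]
    [NormedAddCommGroup P] [NormedSpace 𝕜 P] [NormedRing R] [NormedAlgebra 𝕜 R] [CompleteSpace R]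
    {K : P → R} {A : P} (hK : DifferentiableAt 𝕜 K A) (h : IsUnit (1 - K A)) :
    DifferentiableAt 𝕜 (fun A => Ring.inverse (1 - K A)) A := by
  obtain ⟨x, hx⟩ := h
  have h2 : DifferentiableAt 𝕜 (Ring.inverse (M₀ := R)) (1 - K A) :=
    hx ▸ (hasFDerivAt_ringInverse (𝕜 := 𝕜) x).differentiableAt
  exact DifferentiableAt.comp A (f := fun A => 1 - K A) h2 (by fun_prop)

/-- The solution of `Y = b + K(A) Y`, for `K(A)` a contraction, depends differentiably on `A`. -/
theorem exists_differentiableOn_fixedPoint {𝕜 P F : Type*} [NontriviallyNormedField 𝕜]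
    [NormedAddCommGroup P] [NormedSpace 𝕜 P] [NormedAddCommGroup F] [NormedSpace 𝕜 F]
    [CompleteSpace F] (K : P →L[𝕜] F →L[𝕜] F) (b : F) (L : ℝ) (hK : ∀ A, ‖A‖ < L → ‖K A‖ < 1) :
    ∃ Y : P → F, (∀ A, ‖A‖ < L → Y A = b + K A (Y A)) ∧
      DifferentiableOn 𝕜 Y (Metric.ball 0 L) := by
  have hunit : ∀ A, ‖A‖ < L → IsUnit (1 - K A) := fun A hA =>
    isUnit_one_sub_of_norm_lt_one (x := K A) (hK A hA)
  refine ⟨fun A => Ring.inverse (1 - K A) b, fun A hA => ?_, fun A hA => ?_⟩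
  · have h2 := congrArg (fun T : F →L[𝕜] F => T b) (Ring.mul_inverse_cancel _ (hunit A hA))
    have h3 : Ring.inverse (1 - K A) b - K A (Ring.inverse (1 - K A) b) = b := h2
    exact sub_eq_iff_eq_add.1 h3
  · have hA' : ‖A‖ < L := by simpa using hA
    have h := differentiableAt_inverse_one_sub (𝕜 := 𝕜) K.differentiableAt (hunit A hA')
    exact (h.clm_apply (differentiableAt_const b)).differentiableWithinAt

open BoundedContinuousFunction in
/-- The fundamental solution of `Y' = A(t) Y`, for bounded continuous coefficients in a Banach
algebra, exists on `ℝ` and depends differentiably on `A`. -/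
theorem exists_fundamentalSolution (𝕜 : Type*) [RCLike 𝕜] (M : Type*) [NormedRing M]
    [NormedSpace ℝ M] [NormedAlgebra 𝕜 M] [SMulCommClass ℝ 𝕜 M] [IsScalarTower ℝ M M]
    [SMulCommClass ℝ M M] [CompleteSpace M]
    (L : ℝ) (hL : 0 < L) :
    ∃ Ψ : (ℝ →ᵇ M) → ℝ → M,
      (∀ A, ‖A‖ < L → Ψ A 0 = 1 ∧ ∀ t, HasDerivAt (Ψ A) (A t * Ψ A t) t) ∧
      ∀ t, DifferentiableOn 𝕜 (fun A => Ψ A t) (Metric.ball 0 L) := by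
  obtain ⟨W, hW, hWapp⟩ := exists_weightedPrimitive 𝕜 (M := M) L hL
  -- In the unknown `Y = e^{-L|t|} Ψ` the Volterra operator has norm at most `‖A‖ / L < 1` on all of
  -- `ℝ`, so a single contraction yields the global solution, and linearity in `A` yields
  -- differentiability over `𝕜`.
  let K : (ℝ →ᵇ M) →L[𝕜] ((ℝ →ᵇ M) →L[𝕜] (ℝ →ᵇ M)) :=
    (ContinuousLinearMap.compL 𝕜 _ _ _ W).comp (ContinuousLinearMap.mul 𝕜 (ℝ →ᵇ M))
  have hKapp : ∀ A f, K A f = W (A * f) := fun A f => rfl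
  have hK : ∀ A, ‖A‖ < L → ‖K A‖ < 1 := by
    intro A hA
    refine lt_of_le_of_lt (ContinuousLinearMap.opNorm_comp_le _ _) ?_
    calc _ ≤ L⁻¹ * ‖A‖ := mul_le_mul hW
          (ContinuousLinearMap.opNorm_mul_apply_le 𝕜 _ A) (norm_nonneg _) (by positivity)
      _ < L⁻¹ * L := by gcongr
      _ = 1 := inv_mul_cancel₀ hL.ne'
  let b : ℝ →ᵇ M := ofNormedAddCommGroup (fun t => Real.exp (-(L * |t|)) • (1 : M))
    (by fun_prop) ‖(1 : M)‖ (fun t => by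
      rw [norm_smul, Real.norm_eq_abs, abs_of_pos (Real.exp_pos _)]
      refine mul_le_of_le_one_left (norm_nonneg _) (Real.exp_le_one_iff.2 ?_)
      have : 0 ≤ L * |t| := by positivity
      linarith)
  obtain ⟨Y, hY, hYd⟩ := exists_differentiableOn_fixedPoint K b L hK
  have hYt : ∀ A, ‖A‖ < L → ∀ t, Real.exp (L * |t|) • Y A t =
      1 + ∫ s in (0 : ℝ)..t, A s * (Real.exp (L * |s|) • Y A s) := by
    intro A hA t
    have h := congrArg (fun f : ℝ →ᵇ M => Real.exp (L * |t|) • f t) (hY A hA)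
    rw [h]
    have hb : b t = Real.exp (-(L * |t|)) • (1 : M) := rfl
    rw [BoundedContinuousFunction.add_apply, hKapp, hb, hWapp, smul_add, smul_smul,
      smul_smul, ← Real.exp_add]
    simp [mul_smul_comm]
  refine ⟨fun A t => Real.exp (L * |t|) • Y A t, fun A hA => ⟨?_, fun t => ?_⟩, fun t => ?_⟩
  · show Real.exp (L * |0|) • Y A 0 = 1
    rw [hYt A hA]; simp
  · have : (fun t => Real.exp (L * |t|) • Y A t) =
        fun t => 1 + ∫ s in (0 : ℝ)..t, A s * (Real.exp (L * |s|) • Y A s) :=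
      funext (hYt A hA)
    show HasDerivAt (fun t => Real.exp (L * |t|) • Y A t) (A t * (Real.exp (L * |t|) • Y A t)) t
    rw [this]
    have hc : Continuous fun s => A s * (Real.exp (L * |s|) • Y A s) := by fun_prop
    exact (hc.integral_hasStrictDerivAt 0 t).hasDerivAt.const_add 1
  · exact ((evalCLM 𝕜 t : (ℝ →ᵇ M) →L[𝕜] M).differentiable.comp_differentiableOn
      hYd).const_smul (Real.exp (L * |t|))

end

/-! ### Nonlinear flows: uniqueness and differentiability in the initial value. -/

section

open Set Filter Topology Metric

/-- A `C¹` map on a neighbourhood of a compact set agrees near this set with a globally defined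
compactly supported `C¹` map. -/
theorem exists_contDiff_hasCompactSupport_eqOn {E F : Type*} [NormedAddCommGroup E]
    [NormedSpace ℝ E] [FiniteDimensional ℝ E] [NormedAddCommGroup F] [NormedSpace ℝ F]
    {Ω K : Set E} {G : E → F} (hΩ : IsOpen Ω) (hK : IsCompact K) (hKΩ : K ⊆ Ω)
    (hG : ContDiffOn ℝ 1 G Ω) :
    ∃ G' : E → F, ContDiff ℝ 1 G' ∧ HasCompactSupport G' ∧
      ∃ δ > 0, thickening δ K ⊆ Ω ∧ EqOn G' G (thickening δ K) := by
  obtain ⟨t, ht, hKt, htΩ⟩ := exists_compact_between hK hΩ hKΩ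
  obtain ⟨χ, hχ1, hχ0, -⟩ := exists_contMDiffMap_one_nhds_of_subset_interior
    (n := 1) (modelWithCornersSelf ℝ E) hK.isClosed hKt
  have hχ : ContDiff ℝ 1 χ := χ.contMDiff.contDiff
  refine ⟨fun x => χ x • G x, ?_, ?_, ?_⟩
  · rw [contDiff_iff_contDiffAt]
    intro x
    by_cases hx : x ∈ t
    · exact hχ.contDiffAt.smul (hG.contDiffAt (hΩ.mem_nhds (htΩ hx)))
    · have : (fun x => χ x • G x) =ᶠ[𝓝 x] fun _ => 0 := by
        filter_upwards [ht.isClosed.isOpen_compl.mem_nhds hx] with y hy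
        rw [hχ0 y hy, zero_smul]
      exact contDiffAt_const.congr_of_eventuallyEq this
  · exact HasCompactSupport.intro ht (fun x hx => by rw [hχ0 x hx, zero_smul])
  · obtain ⟨V, hV, hKV, hVχ⟩ := mem_nhdsSet_iff_exists.1 hχ1
    obtain ⟨δ, hδ, h⟩ := hK.exists_thickening_subset_open (hV.inter hΩ) (subset_inter hKV hKΩ)
    refine ⟨δ, hδ, h.trans inter_subset_right, fun x hx => ?_⟩
    have : χ x = 1 := hVχ (h hx).1
    simp [this]

/-- Two solutions of an autonomous equation with the same initial value coincide. -/
theorem eqOn_Icc_of_hasDerivWithinAt_of_contDiffOn {E : Type*} [NormedAddCommGroup E]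
    [NormedSpace ℝ E] [FiniteDimensional ℝ E] {Ω : Set E} {G : E → E} (hΩ : IsOpen Ω)
    (hG : ContDiffOn ℝ 1 G Ω) {γ₁ γ₂ : ℝ → E} {a b : ℝ}
    (h₁ : ∀ t ∈ Icc a b, γ₁ t ∈ Ω ∧ HasDerivWithinAt γ₁ (G (γ₁ t)) (Icc a b) t)
    (h₂ : ∀ t ∈ Icc a b, γ₂ t ∈ Ω ∧ HasDerivWithinAt γ₂ (G (γ₂ t)) (Icc a b) t)
    (h : γ₁ a = γ₂ a) : EqOn γ₁ γ₂ (Icc a b) := by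
  have hc₁ : ContinuousOn γ₁ (Icc a b) := fun t ht => (h₁ t ht).2.continuousWithinAt
  have hc₂ : ContinuousOn γ₂ (Icc a b) := fun t ht => (h₂ t ht).2.continuousWithinAt
  have hK : IsCompact (γ₁ '' Icc a b ∪ γ₂ '' Icc a b) :=
    (isCompact_Icc.image_of_continuousOn hc₁).union (isCompact_Icc.image_of_continuousOn hc₂)
  -- Both orbits lie in a compact subset of `Ω`; near it the field may be replaced by one that is
  -- globally Lipschitz.
  obtain ⟨G', hG', hcs, δ, hδ, -, heq⟩ := exists_contDiff_hasCompactSupport_eqOn hΩ hK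
    (by rintro _ (⟨t, ht, rfl⟩ | ⟨t, ht, rfl⟩); exacts [(h₁ t ht).1, (h₂ t ht).1]) hG
  obtain ⟨C, hC⟩ := ContDiff.lipschitzWith_of_hasCompactSupport hcs hG' one_ne_zero
  have hsub := self_subset_thickening hδ (γ₁ '' Icc a b ∪ γ₂ '' Icc a b)
  refine ODE_solution_unique_of_mem_Icc_right (v := fun _ => G') (s := fun _ => univ) (K := C)
    (fun t _ => hC.lipschitzOnWith) hc₁ (fun t ht => ?_) (fun _ _ => trivial) hc₂
    (fun t ht => ?_) (fun _ _ => trivial) h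
  · have ht' := Ico_subset_Icc_self ht
    show HasDerivWithinAt γ₁ (G' (γ₁ t)) (Ici t) t
    rw [heq (hsub (Or.inl ⟨t, ht', rfl⟩))]
    exact (h₁ t ht').2.mono_of_mem_nhdsWithin (Icc_mem_nhdsGE_of_mem ht)
  · have ht' := Ico_subset_Icc_self ht
    show HasDerivWithinAt γ₂ (G' (γ₂ t)) (Ici t) t
    rw [heq (hsub (Or.inr ⟨t, ht', rfl⟩))]
    exact (h₂ t ht').2.mono_of_mem_nhdsWithin (Icc_mem_nhdsGE_of_mem ht)

/-- The derivative is continuous with compact support, hence uniformly continuous, and the mean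
value inequality makes the first-order remainder small uniformly in the base point. This uniformity
is needed along a whole orbit. -/
lemma exists_forall_norm_sub_sub_fderiv_le {E F : Type*} [NormedAddCommGroup E]
    [NormedSpace ℝ E] [NormedAddCommGroup F] [NormedSpace ℝ F]
    {G : E → F} (hG : ContDiff ℝ 1 G) (hcs : HasCompactSupport G) {ε : ℝ} (hε : 0 < ε) :
    ∃ η > 0, ∀ y z, ‖z - y‖ < η → ‖G z - G y - fderiv ℝ G y (z - y)‖ ≤ ε * ‖z - y‖ := by
  have huc := (hcs.fderiv (𝕜 := ℝ)).uniformContinuous_of_continuous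
    (hG.continuous_fderiv one_ne_zero)
  obtain ⟨η, hη, h⟩ := Metric.uniformContinuous_iff.1 huc ε hε
  refine ⟨η, hη, fun y z hyz => ?_⟩
  refine (convex_ball y η).norm_image_sub_le_of_norm_fderiv_le' (𝕜 := ℝ)
    (fun x _ => (hG.differentiable one_ne_zero) x) (fun x hx => ?_) (mem_ball_self hη)
    (by rwa [mem_ball, dist_eq_norm])
  rw [← dist_eq_norm]
  exact (h hx).le

/-- Linearity in the forcing term turns a small relative error in the equation into an equally small
relative error at the final time. -/
lemma gronwallBound_zero_left (K ε x : ℝ) :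
    gronwallBound 0 K ε x = ε * gronwallBound 0 K 1 x := by
  unfold gronwallBound
  split_ifs <;> ring

/-- Existence near a given orbit, and differentiability of the time-one map, for an autonomous
equation with a `C¹` right-hand side. -/
theorem exists_flow_hasFDerivAt {E : Type*} [NormedAddCommGroup E]
    [NormedSpace ℝ E] [FiniteDimensional ℝ E] {Ω : Set E} {G : E → E} (hΩ : IsOpen Ω)
    (hG : ContDiffOn ℝ 1 G Ω) {γ : ℝ → E}
    (hγ : ∀ t ∈ Icc (0 : ℝ) 1, γ t ∈ Ω ∧ HasDerivWithinAt γ (G (γ t)) (Icc 0 1) t) :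
    ∃ (φ : E → ℝ → E) (T : E →L[ℝ] E),
      (∀ᶠ x in 𝓝 (γ 0), φ x 0 = x ∧
        ∀ t ∈ Icc (0 : ℝ) 1, φ x t ∈ Ω ∧ HasDerivAt (φ x) (G (φ x t)) t) ∧
      HasFDerivAt (fun x => φ x 1) T (γ 0) ∧
      ∀ h, ∃ V : ℝ → E, V 0 = h ∧ V 1 = T h ∧
        ∀ t ∈ Icc (0 : ℝ) 1, HasDerivWithinAt V (fderiv ℝ G (γ t) (V t)) (Icc 0 1) t := by
  have hγc : ContinuousOn γ (Icc 0 1) := fun t ht => (hγ t ht).2.continuousWithinAt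
  have hK : IsCompact (γ '' Icc 0 1) := isCompact_Icc.image_of_continuousOn hγc
  obtain ⟨G', hG', hcs, δ, hδ, hδΩ, heq⟩ := exists_contDiff_hasCompactSupport_eqOn hΩ hK
    (by rintro _ ⟨t, ht, rfl⟩; exact (hγ t ht).1) hG
  obtain ⟨C, hC⟩ := ContDiff.lipschitzWith_of_hasCompactSupport hcs hG' one_ne_zero
  obtain ⟨B, hB⟩ := hcs.exists_bound_of_continuous hG'.continuous
  have hmem : ∀ t ∈ Icc (0 : ℝ) 1, γ t ∈ thickening δ (γ '' Icc 0 1) := fun t ht =>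
    self_subset_thickening hδ _ ⟨t, ht, rfl⟩
  have hfd : ∀ t ∈ Icc (0 : ℝ) 1, fderiv ℝ G' (γ t) = fderiv ℝ G (γ t) := fun t ht =>
    (heq.eventuallyEq_of_mem (isOpen_thickening.mem_nhds (hmem t ht))).fderiv_eq
  have hsol : ∀ x, ∃ α : ℝ → E, α 0 = x ∧ ∀ t ∈ Icc (0 : ℝ) 1, HasDerivAt α (G' (α t)) t := by
    intro x
    have hB0 : 0 ≤ B := (norm_nonneg _).trans (hB 0)
    let B' : NNReal := ⟨B, hB0⟩
    -- A field bounded by `B` moves a point by at most `2B` within time `2`, so the ball of radius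
    -- `2B` is never left. The interval `[-1, 2]` contains `[0, 1]` in its interior, which gives
    -- two-sided derivatives at both endpoints.
    have hpl : IsPicardLindelof (fun _ => G') (tmin := -1) (tmax := 2)
        ⟨0, by norm_num, by norm_num⟩ x (2 * B') 0 B' C := by
      refine ⟨fun _ _ => hC.lipschitzOnWith, fun _ _ => continuousOn_const,
        fun _ _ y _ => hB y, ?_⟩
      have : max ((2 : ℝ) - 0) (0 - (-1)) = 2 := by norm_num
      simp only [this, NNReal.coe_mul, NNReal.coe_zero, NNReal.coe_ofNat]
      linarith
    obtain ⟨α, h0, h⟩ := hpl.exists_eq_forall_mem_Icc_hasDerivWithinAt₀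
    exact ⟨α, h0, fun t ht => (h t ⟨by linarith [ht.1], by linarith [ht.2]⟩).hasDerivAt
      (Icc_mem_nhds (by linarith [ht.1]) (by linarith [ht.2]))⟩
  choose φ hφ0 hφ using hsol
  have hγ' : ∀ t ∈ Ico (0 : ℝ) 1, HasDerivWithinAt γ (G' (γ t)) (Ici t) t := by
    intro t ht
    have ht' := Ico_subset_Icc_self ht
    rw [heq (hmem t ht')]
    exact (hγ t ht').2.mono_of_mem_nhdsWithin (Icc_mem_nhdsGE_of_mem ht)
  have hdist : ∀ x, ∀ t ∈ Icc (0 : ℝ) 1, ‖φ x t - γ t‖ ≤ ‖x - γ 0‖ * Real.exp C := by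
    intro x t ht
    have := dist_le_of_trajectories_ODE (v := fun _ => G') (K := C) (fun _ => hC)
      (f := φ x) (g := γ) (a := 0) (b := 1) (δ := ‖x - γ 0‖)
      (fun t ht => (hφ x t ht).continuousAt.continuousWithinAt)
      (fun t ht => (hφ x t (Ico_subset_Icc_self ht)).hasDerivWithinAt) hγc hγ'
      (by rw [hφ0, dist_eq_norm]) t ht
    rw [dist_eq_norm] at this
    refine this.trans ?_
    gcongr
    have : (C : ℝ) * (t - 0) ≤ C * 1 := by
      apply mul_le_mul_of_nonneg_left _ C.2
      linarith [ht.2]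
    simpa using this
  -- The coefficient of the variational equation, frozen outside `[0, 1]` so as to be bounded and
  -- continuous on `ℝ`.
  let A : BoundedContinuousFunction ℝ (E →L[ℝ] E) := BoundedContinuousFunction.ofNormedAddCommGroup
    (fun t => fderiv ℝ G' (γ (projIcc (0 : ℝ) 1 zero_le_one t)))
    ((hG'.continuous_fderiv one_ne_zero).comp (by
      exact (hγc.comp_continuous (continuous_subtype_val.comp continuous_projIcc)
        (fun t => (projIcc (0 : ℝ) 1 zero_le_one t).2))) : Continuous _) C
    (fun t => norm_fderiv_le_of_lipschitz ℝ hC)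
  have hA : ∀ t ∈ Icc (0 : ℝ) 1, A t = fderiv ℝ G' (γ t) := by
    intro t ht
    show fderiv ℝ G' (γ (projIcc (0 : ℝ) 1 zero_le_one t)) = _
    rw [projIcc_of_mem _ ht]
  obtain ⟨Ψ', hΨ', -⟩ := exists_fundamentalSolution ℝ (E →L[ℝ] E) (‖A‖ + 1) (by positivity)
  obtain ⟨hΨ0, hΨ⟩ := hΨ' A (by linarith)
  set Ψ := Ψ' A
  refine ⟨φ, Ψ 1, ?_, ?_, fun h => ⟨fun t => Ψ t h, by simp [hΨ0], rfl, fun t ht => ?_⟩⟩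
  · have : ∀ᶠ x in 𝓝 (γ 0), ‖x - γ 0‖ * Real.exp C < δ := by
      have hc : Continuous fun x => ‖x - γ 0‖ * Real.exp C := by fun_prop
      exact hc.continuousAt.eventually_lt continuousAt_const (by simpa using hδ)
    filter_upwards [this] with x hx
    have hth : ∀ t ∈ Icc (0 : ℝ) 1, φ x t ∈ thickening δ (γ '' Icc 0 1) := fun t ht =>
      mem_thickening_iff.2 ⟨γ t, ⟨t, ht, rfl⟩, by
        rw [dist_eq_norm]; exact (hdist x t ht).trans_lt hx⟩
    refine ⟨hφ0 x, fun t ht => ⟨hδΩ (hth t ht), ?_⟩⟩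
    rw [← heq (hth t ht)]
    exact hφ x t ht
  · rw [hasFDerivAt_iff_isLittleO, Asymptotics.isLittleO_iff]
    intro c hc
    set g := gronwallBound 0 C 1 1 with hg
    have hg0 : 0 ≤ g := by
      have := gronwallBound_mono (δ := 0) (K := C) (ε := 1) le_rfl zero_le_one C.2
        (zero_le_one (α := ℝ))
      rwa [gronwallBound_x0] at this
    -- Gronwall multiplies the remainder by `exp C * g`; the summand `1` only keeps the denominator
    -- positive.
    obtain ⟨η, hη, hrem⟩ := exists_forall_norm_sub_sub_fderiv_le hG' hcs
      (ε := c / (Real.exp C * g + 1)) (by positivity)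
    have hnear : ∀ᶠ x in 𝓝 (γ 0), ‖x - γ 0‖ * Real.exp C < η := by
      have hc : Continuous fun x => ‖x - γ 0‖ * Real.exp C := by fun_prop
      exact hc.continuousAt.eventually_lt continuousAt_const (by simpa using hη)
    have hφγ : φ (γ 0) 1 = γ 1 := by
      have := hdist (γ 0) 1 (by simp)
      simpa [sub_eq_zero] using this
    filter_upwards [hnear] with x hx
    have hgw := norm_le_gronwallBound_of_norm_deriv_right_le
      (f := fun t => φ x t - γ t - Ψ t (x - γ 0))
      (f' := fun t => G' (φ x t) - G' (γ t) - A t (Ψ t (x - γ 0)))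
      (δ := 0) (K := C) (ε := c / (Real.exp C * g + 1) * (‖x - γ 0‖ * Real.exp C))
      (a := 0) (b := 1) ?_ ?_ ?_ ?_ 1 (by simp)
    · rw [hφγ]
      refine hgw.trans ?_
      rw [gronwallBound_zero_left, sub_zero, ← hg]
      have h1 : c / (Real.exp C * g + 1) * (‖x - γ 0‖ * Real.exp C) * g =
          c * ‖x - γ 0‖ * ((Real.exp C * g) / (Real.exp C * g + 1)) := by ring
      rw [h1]
      refine mul_le_of_le_one_right (by positivity) ?_
      rw [div_le_one (by positivity)]
      linarith
    · exact fun t ht => (((hφ x t ht).continuousAt.continuousWithinAt).sub (hγc t ht)).sub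
        ((hΨ t).continuousAt.clm_apply continuousAt_const).continuousWithinAt
    · intro t ht
      refine (((hφ x t (Ico_subset_Icc_self ht)).hasDerivWithinAt).sub (hγ' t ht)).sub ?_
      have := ((hΨ t).clm_apply (hasDerivAt_const t (x - γ 0))).hasDerivWithinAt (s := Ici t)
      simpa using this
    · simp [hφ0, hΨ0]
    · intro t ht
      have ht' := Ico_subset_Icc_self ht
      have e : G' (φ x t) - G' (γ t) - A t (Ψ t (x - γ 0)) =
          fderiv ℝ G' (γ t) (φ x t - γ t - Ψ t (x - γ 0)) +
          (G' (φ x t) - G' (γ t) - fderiv ℝ G' (γ t) (φ x t - γ t)) := by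
        rw [hA t ht', map_sub (fderiv ℝ G' (γ t)) (φ x t - γ t)]; abel
      rw [e]
      refine (norm_add_le _ _).trans (add_le_add ?_ ?_)
      · exact (ContinuousLinearMap.le_opNorm _ _).trans
          (mul_le_mul_of_nonneg_right (norm_fderiv_le_of_lipschitz ℝ hC) (norm_nonneg _))
      · refine (hrem _ _ ((hdist x t ht').trans_lt hx)).trans ?_
        gcongr
        exact hdist x t ht'
  · rw [← hfd t ht, ← hA t ht]
    have := ((hΨ t).clm_apply (hasDerivAt_const t h)).hasDerivWithinAt (s := Icc 0 1)
    simpa using this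

end

/-! ### Persistence of zeros of holomorphic functions. -/

section

open Set Filter Topology Metric

/-- If `f 0` has a zero `z₀` and does not vanish on a circle around `z₀`, then `f ε` has a zero in
the disc for every small `ε`. -/
theorem eventually_exists_zero_of_differentiableOn {f : ℂ → ℂ → ℂ} {z₀ : ℂ} {r ρ R : ℝ}
    (hr : 0 < r) (hρ : 0 < ρ) (hR : ρ < R)
    (hf : DifferentiableOn ℂ (fun p : ℂ × ℂ => f p.1 p.2) (ball 0 r ×ˢ ball z₀ R))
    (h0 : f 0 z₀ = 0) (hne : ∀ z ∈ sphere z₀ ρ, f 0 z ≠ 0) :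
    ∀ᶠ ε in 𝓝 (0 : ℂ), ∃ z ∈ closedBall z₀ ρ, f ε z = 0 := by
  have hopen : IsOpen (ball (0 : ℂ) r ×ˢ ball z₀ R) := isOpen_ball.prod isOpen_ball
  have hc : ∀ z ∈ ball z₀ R, ContinuousAt (fun p : ℂ × ℂ => f p.1 p.2) (0, z) := fun z hz =>
    (hf.continuousOn).continuousAt (hopen.mem_nhds ⟨mem_ball_self hr, hz⟩)
  -- At `ε = 0` the left side is `0` and the right side is positive; compactness of the circle makes
  -- the inequality stable.
  have hcmp : ∀ᶠ ε in 𝓝 (0 : ℂ), ∀ z ∈ sphere z₀ ρ, ‖f ε z₀‖ < ‖f ε z‖ := by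
    refine (isCompact_sphere z₀ ρ).eventually_forall_of_forall_eventually fun z hz => ?_
    have hzR : z ∈ ball z₀ R := by
      rw [mem_ball, mem_sphere.1 hz]; exact hR
    have h1 : ContinuousAt (fun p : ℂ × ℂ => ‖f p.1 z₀‖) (0, z) := by
      have h2 : ContinuousAt (fun p : ℂ × ℂ => ((p.1, z₀) : ℂ × ℂ)) (0, z) := by fun_prop
      exact (ContinuousAt.comp (f := fun p : ℂ × ℂ => ((p.1, z₀) : ℂ × ℂ))
        (g := fun p : ℂ × ℂ => f p.1 p.2) (hc z₀ (mem_ball_self (hρ.trans hR))) h2).norm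
    exact h1.eventually_lt (hc z hzR).norm (by simpa [h0] using hne z hz)
  filter_upwards [hcmp, ball_mem_nhds (0 : ℂ) hr] with ε hε hεr
  by_contra! hnz
  have hd : ∀ z ∈ closedBall z₀ ρ, DifferentiableAt ℂ (f ε) z := fun z hz => by
    have hp : ((ε, z) : ℂ × ℂ) ∈ ball (0 : ℂ) r ×ˢ ball z₀ R :=
      ⟨hεr, closedBall_subset_ball hR hz⟩
    have h1 := hf.differentiableAt (hopen.mem_nhds hp)
    exact DifferentiableAt.comp z (f := fun z => ((ε, z) : ℂ × ℂ)) h1 (by fun_prop)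
  -- Without a zero, the maximum principle for `1 / f ε` would force `‖f ε‖` at the centre to be at
  -- least its minimum on the circle.
  have hdi : DifferentiableOn ℂ (fun z => (f ε z)⁻¹) (closure (ball z₀ ρ)) := fun z hz => by
    rw [closure_ball _ hρ.ne'] at hz
    exact ((hd z hz).inv (hnz z hz)).differentiableWithinAt
  have hfc : ContinuousOn (fun z => ‖f ε z‖) (sphere z₀ ρ) := fun z hz =>
    (hd z (sphere_subset_closedBall hz)).continuousAt.continuousWithinAt.norm
  obtain ⟨z₁, hz₁, hmin⟩ := (isCompact_sphere z₀ ρ).exists_isMinOn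
    (NormedSpace.sphere_nonempty.2 hρ.le) hfc
  have hbound := Complex.norm_le_of_forall_mem_frontier_norm_le isBounded_ball
    hdi.diffContOnCl (C := ‖f ε z₁‖⁻¹) (fun z hz => by
      rw [frontier_ball _ hρ.ne'] at hz
      rw [norm_inv]
      exact inv_anti₀ (norm_pos_iff.2 (hnz z₁ (sphere_subset_closedBall hz₁))) (hmin hz))
    (subset_closure (mem_ball_self hρ))
  rw [norm_inv] at hbound
  have := (inv_le_inv₀ (norm_pos_iff.2 (hnz z₀ (mem_closedBall_self hρ.le)))
    (norm_pos_iff.2 (hnz z₁ (sphere_subset_closedBall hz₁)))).1 hbound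
  exact absurd this (not_le.2 (hε z₁ hz₁))

end

section

open Set Filter Topology

/-! ### Differentiability of matrix inverses -/

lemma contDiffOn_matrix_det {E ι : Type*} [NormedAddCommGroup E] [NormedSpace ℝ E] [Fintype ι]
    [DecidableEq ι] {k : WithTop ℕ∞} {s : Set E} {N : E → Matrix ι ι ℝ}
    (h : ∀ a b, ContDiffOn ℝ k (fun x => N x a b) s) :
    ContDiffOn ℝ k (fun x => (N x).det) s := by
  simp only [Matrix.det_apply']
  exact ContDiffOn.sum fun σ _ => contDiffOn_const.mul (contDiffOn_prod fun i _ => h _ _)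

/-- Cramer's rule: the entries are polynomials in the entries of the matrix, divided by the
determinant. -/
lemma contDiffOn_matrix_inv {E ι : Type*} [NormedAddCommGroup E] [NormedSpace ℝ E] [Fintype ι]
    [DecidableEq ι] {k : WithTop ℕ∞} {s : Set E} {N : E → Matrix ι ι ℝ}
    (h : ∀ a b, ContDiffOn ℝ k (fun x => N x a b) s) (hdet : ∀ x ∈ s, (N x).det ≠ 0) (a b : ι) :
    ContDiffOn ℝ k (fun x => (N x)⁻¹ a b) s := by
  have h1 : ContDiffOn ℝ k (fun x => (N x).adjugate a b) s := by
    simp only [Matrix.adjugate_apply]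
    refine contDiffOn_matrix_det fun i j => ?_
    by_cases hi : i = b
    · subst hi
      simp only [Matrix.updateRow_self]
      exact contDiffOn_const
    · simp only [Matrix.updateRow_ne hi]
      exact h i j
  have h2 := ((contDiffOn_matrix_det h).inv hdet).mul h1
  refine h2.congr fun x _ => ?_
  simp only [Matrix.inv_def, Ring.inverse_eq_inv', Matrix.smul_apply, smul_eq_mul]
  rfl

lemma contDiffOn_mulVec {E ι : Type*} [NormedAddCommGroup E] [NormedSpace ℝ E] [Fintype ι]
    {k : WithTop ℕ∞} {s : Set E} {N : E → Matrix ι ι ℝ} {v : E → ι → ℝ}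
    (h : ∀ a b, ContDiffOn ℝ k (fun x => N x a b) s) (hv : ContDiffOn ℝ k v s) :
    ContDiffOn ℝ k (fun x => N x *ᵥ v x) s := by
  rw [contDiffOn_pi]
  intro a
  simp only [Matrix.mulVec, dotProduct]
  exact ContDiffOn.sum fun b _ => (h a b).mul ((contDiffOn_pi.1 hv) b)

/-! ### Regularity of the wave and of the coefficients along it. -/

namespace ConsLaw

variable {n m : ℕ} {L : ConsLaw n m}

/-- The spectral bound in (H1) keeps `0` out of the complex spectrum. This is what makes the profile
equation solvable for the derivative. -/
lemma det_Bdir_ne_zero (h1 : L.H1) {u : Fin n → ℝ} (hu : u ∈ L.U) {ν : Fin (m + 1) → ℝ}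
    (hν : ∑ j, ν j ^ 2 = 1) : (L.Bdir ν u).det ≠ 0 := by
  obtain ⟨θ, hθ, h⟩ := h1
  intro h0
  have h2 : (0 : ℂ) ∈ spectrum ℂ ((L.Bdir ν u).map (fun x : ℝ => (x : ℂ))) := by
    rw [spectrum.zero_mem_iff, Matrix.isUnit_iff_isUnit_det]
    have : ((L.Bdir ν u).map (fun x : ℝ => (x : ℂ))).det = (((L.Bdir ν u).det : ℝ) : ℂ) :=
      (RingHom.map_det Complex.ofRealHom _).symm
    rw [this, h0]
    simp
  have := h u hu ν hν 0 h2
  simp only [Complex.zero_re] at this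
  linarith

lemma Bdir_single (u : Fin n → ℝ) : L.Bdir (Pi.single 0 1) u = L.B 0 0 u := by
  unfold Bdir
  rw [Finset.sum_eq_single 0, Finset.sum_eq_single 0]
  · simp
  · intro k _ hk; simp [hk]
  · simp
  · intro j _ hj; simp [hj]
  · simp

lemma det_B_ne_zero (h1 : L.H1) {u : Fin n → ℝ} (hu : u ∈ L.U) : (L.B 0 0 u).det ≠ 0 := by
  rw [← Bdir_single]
  refine det_Bdir_ne_zero h1 hu ?_
  rw [Finset.sum_eq_single 0] <;> simp +contextual

end ConsLaw

namespace PeriodicWave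

variable {n m : ℕ} {L : ConsLaw n m} (W : PeriodicWave L)

lemma deriv_u_eq (h1 : L.H1) (x : ℝ) :
    deriv W.u x = (L.B 0 0 (W.u x))⁻¹ *ᵥ (L.f 0 (W.u x) - W.q) := by
  rw [← W.profile x, Matrix.mulVec_mulVec, Matrix.nonsing_inv_mul _
    (isUnit_iff_ne_zero.2 (ConsLaw.det_B_ne_zero h1 (W.mem x))), Matrix.one_mulVec]

/-- Bootstrap: the wave solves `u' = G(u)` with `G` of class `C²`, so each degree of smoothness up
to `2` gives one more. The third derivative is needed because `ū'` must be a twice differentiable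
solution of the eigenvalue equation. -/
lemma contDiff_u (h0 : L.H0) (h1 : L.H1) : ContDiff ℝ 3 W.u := by
  have hG : ContDiffOn ℝ 2 (fun u => (L.B 0 0 u)⁻¹ *ᵥ (L.f 0 u - W.q)) L.U :=
    contDiffOn_mulVec (contDiffOn_matrix_inv (h0.2.2 0 0) fun u hu => ConsLaw.det_B_ne_zero h1 hu)
      ((h0.2.1 0).sub contDiffOn_const)
  have hd : deriv W.u = (fun u => (L.B 0 0 u)⁻¹ *ᵥ (L.f 0 u - W.q)) ∘ W.u :=
    funext fun x => W.deriv_u_eq h1 x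
  have step : ∀ k : ℕ, k ≤ 2 → ContDiff ℝ k W.u → ContDiff ℝ (k + 1 : ℕ) W.u := by
    intro k hk hu
    have hk' : (k : WithTop ℕ∞) ≤ 2 := by exact_mod_cast hk
    push_cast
    rw [contDiff_succ_iff_deriv]
    refine ⟨W.differentiable, by simp, ?_⟩
    rw [hd]
    exact (hG.of_le hk').comp_contDiff hu W.mem
  have c0 : ContDiff ℝ (0 : ℕ) W.u := contDiff_zero.2 W.differentiable.continuous
  exact_mod_cast step 2 le_rfl (step 1 (by norm_num) (step 0 (by norm_num) c0))

lemma contDiff_deriv_u (h0 : L.H0) (h1 : L.H1) : ContDiff ℝ 2 (deriv W.u) :=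
  ((contDiff_succ_iff_deriv (n := 2)).1 (W.contDiff_u h0 h1)).2.2

lemma contDiff_B (h0 : L.H0) (h1 : L.H1) (j k a b) :
    ContDiff ℝ 2 (fun x => L.B j k (W.u x) a b) :=
  (h0.2.2 j k a b).comp_contDiff ((W.contDiff_u h0 h1).of_le (by norm_num)) W.mem

lemma contDiff_B_inv (h0 : L.H0) (h1 : L.H1) (a b) :
    ContDiff ℝ 2 (fun x => (L.B 0 0 (W.u x))⁻¹ a b) :=
  (contDiffOn_matrix_inv (h0.2.2 0 0) (fun u hu => ConsLaw.det_B_ne_zero h1 hu) a b).comp_contDiff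
    ((W.contDiff_u h0 h1).of_le (by norm_num)) W.mem

lemma contDiff_A (h0 : L.H0) (h1 : L.H1) (j a b) : ContDiff ℝ 1 (fun x => W.A j x a b) := by
  have hu := (W.contDiff_u h0 h1).of_le (show (1 : WithTop ℕ∞) ≤ 3 by norm_num)
  have hdu := (W.contDiff_deriv_u h0 h1).of_le (show (1 : WithTop ℕ∞) ≤ 2 by norm_num)
  have hdu' := contDiff_pi.1 hdu
  have h2 : ContDiff ℝ 1 (fun x => fderiv ℝ (L.f j) (W.u x)) :=
    ((h0.2.1 j).fderiv_of_isOpen h0.1 (by norm_num)).comp_contDiff hu W.mem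
  have h3 : ∀ c, ContDiff ℝ 1 (fun x => fderiv ℝ (fun u => L.B j 0 u a c) (W.u x)) := fun c =>
    ((h0.2.2 j 0 a c).fderiv_of_isOpen h0.1 (by norm_num)).comp_contDiff hu W.mem
  simp only [A, Matrix.of_apply]
  refine ContDiff.sub ?_ (ContDiff.sum fun c _ => ?_)
  · exact contDiff_pi.1 (h2.clm_apply contDiff_const) a
  · exact ((h3 c).clm_apply contDiff_const).mul (hdu' c)

/-- The flux `fʲ(ū) - Bʲ¹(ū) ū'` along the wave. -/
noncomputable def flux (j : Fin (m + 1)) (x : ℝ) : Fin n → ℝ :=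
  L.f j (W.u x) - L.B j 0 (W.u x) *ᵥ deriv W.u x

lemma flux_zero (x : ℝ) : W.flux 0 x = W.q := by
  rw [flux, W.profile x]; abel

lemma A_mulVec (j : Fin (m + 1)) (x : ℝ) (v : Fin n → ℝ) (a : Fin n) :
    (W.A j x *ᵥ v) a = fderiv ℝ (L.f j) (W.u x) v a -
      ∑ c, fderiv ℝ (fun u => L.B j 0 u a c) (W.u x) v * deriv W.u x c := by
  have hv : v = ∑ b, v b • (Pi.single b 1 : Fin n → ℝ) := by
    ext i; simp [Finset.sum_apply, Pi.single_apply]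
  have e1 : fderiv ℝ (L.f j) (W.u x) v a =
      ∑ b, v b * fderiv ℝ (L.f j) (W.u x) (Pi.single b 1) a := by
    conv_lhs => rw [hv]
    simp [map_sum, Finset.sum_apply]
  have e2 : ∀ c, fderiv ℝ (fun u => L.B j 0 u a c) (W.u x) v =
      ∑ b, v b * fderiv ℝ (fun u => L.B j 0 u a c) (W.u x) (Pi.single b 1) := by
    intro c
    conv_lhs => rw [hv]
    simp [map_sum]
  rw [e1]
  simp only [e2, Matrix.mulVec, dotProduct, A, Matrix.of_apply, sub_mul, Finset.sum_sub_distrib,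
    Finset.sum_mul]
  congr 1
  · exact Finset.sum_congr rfl fun b _ => mul_comm _ _
  · rw [Finset.sum_comm]
    exact Finset.sum_congr rfl fun c _ => Finset.sum_congr rfl fun b _ => by ring

/-- The derivative of `fʲ` and that of the coefficient `Bʲ¹` combine into `Aʲ`. This identity lets
the flux absorb the first-order effect of the translation mode. -/
lemma hasDerivAt_flux (h0 : L.H0) (h1 : L.H1) (j : Fin (m + 1)) (x : ℝ) :
    HasDerivAt (W.flux j)
      (W.A j x *ᵥ deriv W.u x - L.B j 0 (W.u x) *ᵥ deriv (deriv W.u) x) x := by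
  have hu : HasDerivAt W.u (deriv W.u x) x := (W.differentiable x).hasDerivAt
  have hdu : HasDerivAt (deriv W.u) (deriv (deriv W.u) x) x :=
    ((W.contDiff_deriv_u h0 h1).differentiable (by norm_num) x).hasDerivAt
  have hf := (((h0.2.1 j).differentiableOn (by norm_num)).differentiableAt
    (h0.1.mem_nhds (W.mem x))).hasFDerivAt.comp_hasDerivAt x hu
  rw [hasDerivAt_pi] at hf hdu ⊢
  intro a
  have hB : ∀ c, HasDerivAt (fun x => L.B j 0 (W.u x) a c)
      (fderiv ℝ (fun u => L.B j 0 u a c) (W.u x) (deriv W.u x)) x := fun c =>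
    (((h0.2.2 j 0 a c).differentiableOn (by norm_num)).differentiableAt
    (h0.1.mem_nhds (W.mem x))).hasFDerivAt.comp_hasDerivAt x hu
  have h := (hf a).sub (HasDerivAt.fun_sum fun c (_ : c ∈ Finset.univ) => (hB c).mul (hdu c))
  refine h.congr_deriv ?_
  rw [Pi.sub_apply, A_mulVec]
  simp only [Matrix.mulVec, dotProduct, Finset.sum_add_distrib]
  ring

lemma periodic_deriv_u : Function.Periodic (deriv W.u) W.X := by
  intro x
  have : (fun y => W.u (y + W.X)) = W.u := funext W.periodic
  rw [← deriv_comp_add_const, this]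

lemma periodic_flux (j : Fin (m + 1)) : Function.Periodic (W.flux j) W.X := by
  intro x
  rw [flux, flux, W.periodic, W.periodic_deriv_u]

lemma periodic_A (j : Fin (m + 1)) : Function.Periodic (W.A j) W.X := by
  intro x
  simp only [A, W.periodic x, W.periodic_deriv_u x]

/-- If it vanished, `ū(0)` would be an equilibrium and uniqueness would make the wave constant.
Hence the section `a ⬝ ū'(0) = 0` really removes translations. -/
lemma deriv_u_zero_ne_zero (h0 : L.H0) (h1 : L.H1) : deriv W.u 0 ≠ 0 := by
  intro h
  have hG : ContDiffOn ℝ 1 (fun u => (L.B 0 0 u)⁻¹ *ᵥ (L.f 0 u - W.q)) L.U :=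
    contDiffOn_mulVec (contDiffOn_matrix_inv (fun a b => (h0.2.2 0 0 a b).of_le (by norm_num))
      fun u hu => ConsLaw.det_B_ne_zero h1 hu)
      (((h0.2.1 0).of_le (by norm_num)).sub contDiffOn_const)
  have hconst : EqOn W.u (fun _ => W.u 0) (Icc 0 W.X) := by
    refine eqOn_Icc_of_hasDerivWithinAt_of_contDiffOn h0.1 hG
      (fun t _ => ⟨W.mem t, ?_⟩) (fun t _ => ⟨W.mem 0, ?_⟩) rfl
    · rw [← W.deriv_u_eq h1]
      exact (W.differentiable t).hasDerivAt.hasDerivWithinAt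
    · rw [← W.deriv_u_eq h1, h]
      exact hasDerivWithinAt_const _ _ _
  have hall : ∀ x, W.u x = W.u 0 := fun x => by
    obtain ⟨y, hy, hxy⟩ := W.periodic.exists_mem_Ico₀ W.X_pos x
    rw [hxy, hconst (Ico_subset_Icc_self hy)]
  obtain ⟨x, y, hxy⟩ := W.nonconstant
  exact hxy (by rw [hall x, hall y])

end PeriodicWave

end

section

open Set Filter Topology

/-! ### The chart of the sphere -/

lemma one_add_sum_sq_pos {m : ℕ} (δ : Fin m → ℝ) : 0 < 1 + ∑ j, δ j ^ 2 := by positivity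

lemma sum_nuChart_sq {m : ℕ} (δ : Fin m → ℝ) : ∑ j, nuChart δ j ^ 2 = 1 := by
  have h := one_add_sum_sq_pos δ
  rw [Fin.sum_univ_succ]
  simp only [nuChart, Pi.smul_apply, Fin.cons_zero, Fin.cons_succ, smul_eq_mul, mul_pow, inv_pow,
    Real.sq_sqrt h.le, ← Finset.mul_sum]
  field_simp

lemma nuChart_zero {m : ℕ} : nuChart (0 : Fin m → ℝ) = Pi.single 0 1 := by
  ext j
  refine Fin.cases ?_ (fun i => ?_) j <;> simp [nuChart]

lemma contDiff_nuChart {m : ℕ} {k : WithTop ℕ∞} : ContDiff ℝ k (nuChart (m := m)) := by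
  have hs : ContDiff ℝ k (fun δ : Fin m → ℝ => (Real.sqrt (1 + ∑ j, δ j ^ 2))⁻¹) := by
    refine ContDiff.inv (ContDiff.sqrt (by fun_prop) fun δ => (one_add_sum_sq_pos δ).ne')
      fun δ => (Real.sqrt_pos.2 (one_add_sum_sq_pos δ)).ne'
  refine hs.smul (contDiff_pi.2 fun j => ?_)
  refine Fin.cases ?_ (fun i => ?_) j
  · simpa using contDiff_const
  · simpa using contDiff_apply ℝ ℝ i

/-- The normalizing factor differs from `1` only at second order, so it does not contribute. -/
lemma hasDerivAt_nuChart_line {m : ℕ} (δ : Fin m → ℝ) :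
    HasDerivAt (fun s : ℝ => nuChart (s • δ)) (Fin.cons 0 δ : Fin (m + 1) → ℝ) 0 := by
  have h1 : HasDerivAt (fun s : ℝ => 1 + ∑ j, (s * δ j) ^ 2) 0 0 := by
    have := (HasDerivAt.fun_sum fun j (_ : j ∈ Finset.univ) =>
      (((hasDerivAt_id (0 : ℝ)).mul_const (δ j)).pow 2)).const_add 1
    simpa using this
  have h2 : HasDerivAt (fun s : ℝ => (Real.sqrt (1 + ∑ j, (s * δ j) ^ 2))⁻¹) 0 0 := by
    have := (h1.sqrt (by simp)).fun_inv (by simp)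
    simpa using this
  rw [hasDerivAt_pi]
  intro j
  refine Fin.cases ?_ (fun i => ?_) j
  · simpa [nuChart] using h2
  · have := h2.fun_mul ((hasDerivAt_id (0 : ℝ)).mul_const (δ i))
    simpa [nuChart] using this

lemma sum_mul_matrix_mul {n m : ℕ} (δ : Fin m → ℝ) (N : Fin m → Matrix (Fin n) (Fin n) ℝ)
    (v : Fin n → ℝ) (a : Fin n) :
    ∑ c, (∑ j, δ j * N j a c) * v c = ∑ j, δ j * (N j *ᵥ v) a := by
  simp only [Matrix.mulVec, dotProduct, Finset.sum_mul, Finset.mul_sum, mul_assoc]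
  rw [Finset.sum_comm]

/-- Parameters are states with zero velocity, the period is a factor of the field, and integrals are
additional states. Dependence on parameters, period and integrals thereby reduces to dependence on
the initial value of one autonomous equation. -/
lemma contDiffOn_augmentedField {P E N : Type*} [NormedAddCommGroup P] [NormedSpace ℝ P]
    [NormedAddCommGroup E] [NormedSpace ℝ E] [NormedAddCommGroup N] [NormedSpace ℝ N]
    {X : P → ℝ} {F : P × E → E} {G : P × E → N} {U : Set E} (hX : ContDiff ℝ 1 X)
    (hF : ContDiffOn ℝ 1 F {z | z.2 ∈ U}) (hG : ContDiffOn ℝ 1 G {z | z.2 ∈ U}) :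
    ContDiffOn ℝ 1 (fun z : P × E × E × N =>
      (((0 : P), X z.1 • F (z.1, z.2.1), z.2.1, G (z.1, z.2.1)) : P × E × E × N))
      {z | z.2.1 ∈ U} := by
  have hc : ContDiffOn ℝ 1 (fun z : P × E × E × N => (z.1, z.2.1)) {z | z.2.1 ∈ U} := by fun_prop
  refine contDiffOn_const.prodMk (ContDiffOn.prodMk ?_ (ContDiffOn.prodMk (by fun_prop) ?_))
  · exact (hX.comp contDiff_fst).contDiffOn.fun_smul (hF.comp hc fun z hz => hz)
  · exact hG.comp hc fun z hz => hz

/-! ### The profile equation as a `C¹` field in state and parameters. -/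

namespace ConsLaw

variable {n m : ℕ} (L : ConsLaw n m)

/-- The right-hand side of the profile equation in explicit form. -/
noncomputable def profileField (p : WaveParam n m) (u : Fin n → ℝ) : Fin n → ℝ :=
  (L.Bdir p.dir u)⁻¹ *ᵥ (L.fdir p.dir u - p.speed • u - p.const)

/-- The integrand of the averaged flux. -/
noncomputable def fluxField (j : Fin (m + 1)) (p : WaveParam n m) (u : Fin n → ℝ) : Fin n → ℝ :=
  L.f j u - ∑ k, p.dir k • (L.B j k u *ᵥ L.profileField p u)

/-- The profile equation on the time interval `[0, 1]`, together with the parameters and with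
primitives of the integrands of `M` and `Fʲ`. -/
noncomputable def waveField
    (z : WaveParam n m × (Fin n → ℝ) × (Fin n → ℝ) × (Fin (m + 1) → Fin n → ℝ)) :
    WaveParam n m × (Fin n → ℝ) × (Fin n → ℝ) × (Fin (m + 1) → Fin n → ℝ) :=
  (0, z.1.period • L.profileField z.1 z.2.1, z.2.1, fun j => L.fluxField j z.1 z.2.1)

variable {L}

lemma Bdir_mulVec_profileField (h1 : L.H1) (p : WaveParam n m) {u : Fin n → ℝ} (hu : u ∈ L.U) :
    L.Bdir p.dir u *ᵥ L.profileField p u = L.fdir p.dir u - p.speed • u - p.const := by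
  rw [profileField, Matrix.mulVec_mulVec, Matrix.mul_nonsing_inv _
    (isUnit_iff_ne_zero.2 (det_Bdir_ne_zero (ν := p.dir) h1 hu (sum_nuChart_sq _))), Matrix.one_mulVec]

lemma eq_profileField (h1 : L.H1) (p : WaveParam n m) {u w : Fin n → ℝ} (hu : u ∈ L.U)
    (h : L.Bdir p.dir u *ᵥ w = L.fdir p.dir u - p.speed • u - p.const) :
    w = L.profileField p u := by
  rw [profileField, ← h, Matrix.mulVec_mulVec, Matrix.nonsing_inv_mul _
    (isUnit_iff_ne_zero.2 (det_Bdir_ne_zero (ν := p.dir) h1 hu (sum_nuChart_sq _))), Matrix.one_mulVec]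

lemma contDiff_dir {k : WithTop ℕ∞} : ContDiff ℝ k (WaveParam.dir (n := n) (m := m)) :=
  contDiff_nuChart.comp (by fun_prop)

lemma contDiffOn_profileField (h0 : L.H0) (h1 : L.H1) :
    ContDiffOn ℝ 1 (fun z : WaveParam n m × (Fin n → ℝ) => L.profileField z.1 z.2)
      {z | z.2 ∈ L.U} := by
  have hdir : ∀ j, ContDiffOn ℝ 1 (fun z : WaveParam n m × (Fin n → ℝ) => z.1.dir j)
      {z | z.2 ∈ L.U} := fun j =>
    ((contDiff_pi.1 contDiff_dir j).comp contDiff_fst).contDiffOn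
  have hsnd : ContDiffOn ℝ 1 (fun z : WaveParam n m × (Fin n → ℝ) => z.2) {z | z.2 ∈ L.U} :=
    contDiff_snd.contDiffOn
  refine contDiffOn_mulVec (contDiffOn_matrix_inv (fun a b => ?_) fun z hz =>
    det_Bdir_ne_zero h1 hz (sum_nuChart_sq _)) (ContDiffOn.sub (ContDiffOn.sub ?_ ?_) ?_)
  · simp only [Bdir, Matrix.sum_apply, Matrix.smul_apply, smul_eq_mul]
    exact ContDiffOn.sum fun j _ => ContDiffOn.sum fun k _ => ((hdir j).mul (hdir k)).mul
      (((h0.2.2 j k a b).of_le (by norm_num)).comp hsnd fun z hz => hz)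
  · simp only [fdir]
    exact ContDiffOn.sum fun j _ => (hdir j).smul
      (((h0.2.1 j).of_le (by norm_num)).comp hsnd fun z hz => hz)
  · have hs : ContDiffOn ℝ 1 (fun z : WaveParam n m × (Fin n → ℝ) => z.1.speed)
        {z | z.2 ∈ L.U} := by unfold WaveParam.speed; fun_prop
    exact hs.smul hsnd
  · unfold WaveParam.const; fun_prop

lemma contDiffOn_fluxField (h0 : L.H0) (h1 : L.H1) (j : Fin (m + 1)) :
    ContDiffOn ℝ 1 (fun z : WaveParam n m × (Fin n → ℝ) => L.fluxField j z.1 z.2)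
      {z | z.2 ∈ L.U} := by
  have hdir : ∀ j, ContDiffOn ℝ 1 (fun z : WaveParam n m × (Fin n → ℝ) => z.1.dir j)
      {z | z.2 ∈ L.U} := fun j =>
    ((contDiff_pi.1 contDiff_dir j).comp contDiff_fst).contDiffOn
  have hsnd : ContDiffOn ℝ 1 (fun z : WaveParam n m × (Fin n → ℝ) => z.2) {z | z.2 ∈ L.U} :=
    contDiff_snd.contDiffOn
  refine ContDiffOn.sub (((h0.2.1 j).of_le (by norm_num)).comp hsnd fun z hz => hz)
    (ContDiffOn.sum fun k _ => (hdir k).smul (contDiffOn_mulVec (fun a b => ?_)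
      (contDiffOn_profileField h0 h1)))
  exact ((h0.2.2 j k a b).of_le (by norm_num)).comp hsnd fun z hz => hz

lemma contDiff_period : ContDiff ℝ 1 (WaveParam.period (n := n) (m := m)) := contDiff_fst

lemma contDiffOn_waveField (h0 : L.H0) (h1 : L.H1) :
    ContDiffOn ℝ 1 L.waveField {z | z.2.1 ∈ L.U} :=
  contDiffOn_augmentedField contDiff_period (contDiffOn_profileField h0 h1)
    (G := fun z j => L.fluxField j z.1 z.2) (contDiffOn_pi.2 (contDiffOn_fluxField h0 h1))

end ConsLaw

/-! ### Linearization of the profile equation and of the fluxes at the wave. -/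

namespace PeriodicWave

variable {n m : ℕ} {L : ConsLaw n m} (W : PeriodicWave L)

/-- The derivative of the right-hand side of the profile equation in the direction `(h, w)`,
multiplied by `B¹¹`. -/
noncomputable def varRhs (h : WaveParam n m) (x : ℝ) (w : Fin n → ℝ) : Fin n → ℝ :=
  W.A 0 x *ᵥ w - ∑ k : Fin m, h.2.2.2.1 k • (L.B 0 k.succ (W.u x) *ᵥ deriv W.u x)
    + ∑ j : Fin m, h.2.2.2.1 j • W.flux j.succ x - h.speed • W.u x - h.const

lemma dir_base : W.base.dir = Pi.single 0 1 := nuChart_zero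

lemma profileField_base (h1 : L.H1) (x : ℝ) : L.profileField W.base (W.u x) = deriv W.u x := by
  refine (ConsLaw.eq_profileField h1 _ (W.mem x) ?_).symm
  rw [dir_base, ConsLaw.Bdir_single, W.profile]
  simp [ConsLaw.fdir, Pi.single_apply, base, WaveParam.speed, WaveParam.const]

lemma fluxField_base (h1 : L.H1) (j : Fin (m + 1)) (x : ℝ) :
    L.fluxField j W.base (W.u x) = W.flux j x := by
  rw [ConsLaw.fluxField, W.profileField_base h1, dir_base]
  simp [Pi.single_apply, flux]

lemma dir_line (h : WaveParam n m) (s : ℝ) : (W.base + s • h).dir = nuChart (s • h.2.2.2.1) := by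
  show nuChart ((0 : Fin m → ℝ) + s • h.2.2.2.1) = _
  rw [zero_add]

lemma hasDerivAt_f_line (h0 : L.H0) (x : ℝ) (w : Fin n → ℝ) (j : Fin (m + 1)) :
    HasDerivAt (fun s : ℝ => L.f j (W.u x + s • w)) (fderiv ℝ (L.f j) (W.u x) w) 0 := by
  have hd := ((h0.2.1 j).differentiableOn (by norm_num)).differentiableAt
    (h0.1.mem_nhds (W.mem x))
  exact hd.hasFDerivAt.hasLineDerivAt w

lemma hasDerivAt_B_line (h0 : L.H0) (x : ℝ) (w : Fin n → ℝ) (j k : Fin (m + 1)) (a b : Fin n) :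
    HasDerivAt (fun s : ℝ => L.B j k (W.u x + s • w) a b)
      (fderiv ℝ (fun u => L.B j k u a b) (W.u x) w) 0 := by
  have hd := ((h0.2.2 j k a b).differentiableOn (by norm_num)).differentiableAt
    (h0.1.mem_nhds (W.mem x))
  exact hd.hasFDerivAt.hasLineDerivAt w

lemma hasDerivAt_profileField_line (h0 : L.H0) (h1 : L.H1) (h : WaveParam n m) (x : ℝ)
    (w : Fin n → ℝ) :
    HasDerivAt (fun s : ℝ => L.profileField (W.base + s • h) (W.u x + s • w))
      (fderiv ℝ (fun z : WaveParam n m × (Fin n → ℝ) => L.profileField z.1 z.2)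
        (W.base, W.u x) (h, w)) 0 := by
  have hd := ((ConsLaw.contDiffOn_profileField h0 h1).differentiableOn (by norm_num)
    |>.differentiableAt ((h0.1.preimage continuous_snd).mem_nhds
      (x := (W.base, W.u x)) (W.mem x)))
  exact hd.hasFDerivAt.hasLineDerivAt (h, w)

/-- Implicit differentiation of the profile equation. -/
lemma B_mulVec_fderiv_profileField (h0 : L.H0) (h1 : L.H1) (h : WaveParam n m) (x : ℝ)
    (w : Fin n → ℝ) :
    L.B 0 0 (W.u x) *ᵥ (fderiv ℝ (fun z : WaveParam n m × (Fin n → ℝ) => L.profileField z.1 z.2)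
        (W.base, W.u x) (h, w)) = W.varRhs h x w := by
  set D := fderiv ℝ (fun z : WaveParam n m × (Fin n → ℝ) => L.profileField z.1 z.2)
        (W.base, W.u x) (h, w) with hD
  have hP := hasDerivAt_pi.1 (W.hasDerivAt_profileField_line h0 h1 h x w)
  have hν := hasDerivAt_pi.1 (hasDerivAt_nuChart_line h.2.2.2.1)
  have hU : ∀ᶠ s : ℝ in 𝓝 0, W.u x + s • w ∈ L.U := by
    have hc : Continuous fun s : ℝ => W.u x + s • w := by fun_prop
    exact hc.continuousAt.eventually_mem (by simpa using h0.1.mem_nhds (W.mem x))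
  ext a
  have hl : HasDerivAt (fun s : ℝ => ∑ c, (∑ j, ∑ k, nuChart (s • h.2.2.2.1) j *
      nuChart (s • h.2.2.2.1) k * L.B j k (W.u x + s • w) a c) *
      L.profileField (W.base + s • h) (W.u x + s • w) c) _ 0 :=
    HasDerivAt.fun_sum fun c _ => (HasDerivAt.fun_sum fun j _ => HasDerivAt.fun_sum fun k _ =>
      ((hν j).fun_mul (hν k)).fun_mul (W.hasDerivAt_B_line h0 x w j k a c)).fun_mul (hP c)
  have hr : HasDerivAt (fun s : ℝ => ∑ j, nuChart (s • h.2.2.2.1) j * L.f j (W.u x + s • w) a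
      - (s * h.speed) * (W.u x a + s * w a) - (W.q a + s * h.const a)) _ 0 :=
    ((HasDerivAt.fun_sum fun j (_ : j ∈ Finset.univ) =>
      (hν j).fun_mul (hasDerivAt_pi.1 (W.hasDerivAt_f_line h0 x w j) a)).fun_sub
      (((hasDerivAt_id (0 : ℝ)).mul_const h.speed).mul
        (((hasDerivAt_id (0 : ℝ)).mul_const (w a)).const_add (W.u x a)))).fun_sub
      (((hasDerivAt_id (0 : ℝ)).mul_const (h.const a)).const_add (W.q a))
  -- Both sides of the profile equation agree near `s = 0` along the line `(base + s h, ū(x) + s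
  -- w)`; comparing their derivatives gives the linearized equation.
  have heq := hl.unique (hr.congr_of_eventuallyEq (hU.mono fun s hs => by
    have := congrFun (ConsLaw.Bdir_mulVec_profileField h1 (W.base + s • h) hs) a
    rw [dir_line] at this
    simp only [ConsLaw.Bdir, ConsLaw.fdir, Matrix.mulVec, dotProduct, Matrix.sum_apply,
      Matrix.smul_apply, Pi.sub_apply, Finset.sum_apply, Pi.smul_apply, smul_eq_mul] at this
    simp only []
    rw [this]
    simp [WaveParam.speed, WaveParam.const, base]))
  simp only [zero_smul, add_zero, nuChart_zero, Fin.sum_univ_succ, W.profileField_base h1] at heq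
  simp [Finset.sum_add_distrib, add_mul] at heq
  rw [sum_mul_matrix_mul, sum_mul_matrix_mul] at heq
  simp only [varRhs, flux, Pi.add_apply, Pi.sub_apply, Pi.smul_apply, Finset.sum_apply,
    A_mulVec, smul_eq_mul, mul_sub, Finset.sum_sub_distrib]
  rw [Matrix.mulVec, dotProduct]
  linarith

/-- Product rule. At the wave the direction is `e₁`, so the state derivatives give `Aʲ`, and the
direction itself varies only transversally. -/
lemma hasDerivAt_fluxField_line (h0 : L.H0) (h1 : L.H1) (h : WaveParam n m) (x : ℝ)
    (w : Fin n → ℝ) (j : Fin (m + 1)) :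
    HasDerivAt (fun s : ℝ => L.fluxField j (W.base + s • h) (W.u x + s • w))
      (W.A j x *ᵥ w - L.B j 0 (W.u x) *ᵥ (fderiv ℝ (fun z : WaveParam n m × (Fin n → ℝ) =>
          L.profileField z.1 z.2) (W.base, W.u x) (h, w))
        - ∑ k : Fin m, h.2.2.2.1 k • (L.B j k.succ (W.u x) *ᵥ deriv W.u x)) 0 := by
  have hP := hasDerivAt_pi.1 (W.hasDerivAt_profileField_line h0 h1 h x w)
  have hν := hasDerivAt_pi.1 (hasDerivAt_nuChart_line h.2.2.2.1)
  rw [hasDerivAt_pi]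
  intro a
  have hl : HasDerivAt (fun s : ℝ => L.f j (W.u x + s • w) a -
      ∑ k, nuChart (s • h.2.2.2.1) k * ∑ c, L.B j k (W.u x + s • w) a c *
      L.profileField (W.base + s • h) (W.u x + s • w) c) _ 0 :=
    (hasDerivAt_pi.1 (W.hasDerivAt_f_line h0 x w j) a).fun_sub
    (HasDerivAt.fun_sum fun k _ => (hν k).fun_mul
      (HasDerivAt.fun_sum fun c _ => (W.hasDerivAt_B_line h0 x w j k a c).fun_mul (hP c)))
  have he : (fun s : ℝ => L.fluxField j (W.base + s • h) (W.u x + s • w) a) =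
      fun s : ℝ => L.f j (W.u x + s • w) a -
      ∑ k, nuChart (s • h.2.2.2.1) k * ∑ c, L.B j k (W.u x + s • w) a c *
      L.profileField (W.base + s • h) (W.u x + s • w) c := by
    ext s
    simp only [ConsLaw.fluxField, dir_line, Pi.sub_apply, Finset.sum_apply, Pi.smul_apply,
      smul_eq_mul, Matrix.mulVec, dotProduct]
  rw [he]
  refine hl.congr_deriv ?_
  simp only [zero_smul, add_zero, nuChart_zero, Fin.sum_univ_succ, W.profileField_base h1]
  rw [Pi.sub_apply, Pi.sub_apply, A_mulVec]
  simp [Finset.sum_add_distrib, Matrix.mulVec, dotProduct]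
  ring

end PeriodicWave

end

/-! ### The functions `H`, `M`, `Fʲ` through one augmented flow. -/

section

open Set Filter Topology

/-- Parameters, profile, and primitives of the integrands of `M` and `Fʲ`. -/
abbrev WaveState (n m : ℕ) : Type :=
  WaveParam n m × (Fin n → ℝ) × (Fin n → ℝ) × (Fin (m + 1) → Fin n → ℝ)

/-- The initial state of the profile with the given parameters. -/
noncomputable def WaveParam.initState (n m : ℕ) : WaveParam n m →L[ℝ] WaveState n m :=
  (ContinuousLinearMap.id ℝ (WaveParam n m)).prod
    (((ContinuousLinearMap.fst ℝ (Fin n → ℝ) _).comp (ContinuousLinearMap.snd ℝ ℝ _)).prod 0)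

lemma WaveParam.initState_apply {n m : ℕ} (p : WaveParam n m) :
    WaveParam.initState n m p = (p, p.init, 0, 0) := rfl

lemma hasDerivWithinAt_comp_div {E : Type*} [NormedAddCommGroup E] [NormedSpace ℝ E]
    {U : ℝ → E} {U' : E} {X x : ℝ} (hX : 0 < X) (h : HasDerivWithinAt U U' (Icc 0 1) (x / X)) :
    HasDerivWithinAt (fun x => U (x / X)) (X⁻¹ • U') (Icc 0 X) x := by
  have h2 : HasDerivWithinAt (fun x : ℝ => x / X) X⁻¹ (Icc 0 X) x := by
    simpa using ((hasDerivAt_id x).div_const X).hasDerivWithinAt (s := Icc 0 X)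
  refine HasDerivWithinAt.scomp x h h2 fun y hy => ?_
  exact ⟨div_nonneg hy.1 hX.le, (div_le_one hX).2 hy.2⟩

lemma HasDerivWithinAt.prod_fst {E F : Type*} [NormedAddCommGroup E] [NormedSpace ℝ E]
    [NormedAddCommGroup F] [NormedSpace ℝ F] {z : ℝ → E × F} {z' : E × F} {t : ℝ} {s : Set ℝ}
    (h : HasDerivWithinAt z z' s t) : HasDerivWithinAt (fun t => (z t).1) z'.1 s t :=
  (ContinuousLinearMap.fst ℝ E F).hasFDerivAt.comp_hasDerivWithinAt t h

lemma HasDerivWithinAt.prod_snd {E F : Type*} [NormedAddCommGroup E] [NormedSpace ℝ E]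
    [NormedAddCommGroup F] [NormedSpace ℝ F] {z : ℝ → E × F} {z' : E × F} {t : ℝ} {s : Set ℝ}
    (h : HasDerivWithinAt z z' s t) : HasDerivWithinAt (fun t => (z t).2) z'.2 s t :=
  (ContinuousLinearMap.snd ℝ E F).hasFDerivAt.comp_hasDerivWithinAt t h

lemma HasDerivAt.prod_fst {E F : Type*} [NormedAddCommGroup E] [NormedSpace ℝ E]
    [NormedAddCommGroup F] [NormedSpace ℝ F] {z : ℝ → E × F} {z' : E × F} {t : ℝ}
    (h : HasDerivAt z z' t) : HasDerivAt (fun t => (z t).1) z'.1 t :=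
  (ContinuousLinearMap.fst ℝ E F).hasFDerivAt.comp_hasDerivAt t h

lemma HasDerivAt.prod_snd {E F : Type*} [NormedAddCommGroup E] [NormedSpace ℝ E]
    [NormedAddCommGroup F] [NormedSpace ℝ F] {z : ℝ → E × F} {z' : E × F} {t : ℝ}
    (h : HasDerivAt z z' t) : HasDerivAt (fun t => (z t).2) z'.2 t :=
  (ContinuousLinearMap.snd ℝ E F).hasFDerivAt.comp_hasDerivAt t h

namespace ConsLaw

variable {n m : ℕ} {L : ConsLaw n m}

lemma hasDerivAt_comp_div_period {p : WaveParam n m} {U : ℝ → Fin n → ℝ} (hp : 0 < p.period)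
    (hU : ∀ t ∈ Icc (0 : ℝ) 1, U t ∈ L.U ∧
      HasDerivAt U (p.period • L.profileField p (U t)) t) {y : ℝ} (hy : y ∈ Icc 0 p.period) :
    U (y / p.period) ∈ L.U ∧
    HasDerivAt (fun y => U (y / p.period)) (L.profileField p (U (y / p.period))) y := by
  obtain ⟨h2, h3⟩ := hU (y / p.period) ⟨div_nonneg hy.1 hp.le, (div_le_one hp).2 hy.2⟩
  refine ⟨h2, ?_⟩
  have h4 := h3.scomp y ((hasDerivAt_id y).div_const p.period)
  refine h4.congr_deriv ?_
  rw [smul_smul, one_div, inv_mul_cancel₀ hp.ne', one_smul]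

/-- For each `y` the value `L.flow p y` comes from a separately chosen solution on `[0, y]`;
uniqueness identifies all these choices with one solution in rescaled time. -/
lemma flow_eq {p : WaveParam n m} {U : ℝ → Fin n → ℝ} (h0 : L.H0) (h1 : L.H1)
    (hp : 0 < p.period) (hU0 : U 0 = p.init)
    (hU : ∀ t ∈ Icc (0 : ℝ) 1, U t ∈ L.U ∧
      HasDerivAt U (p.period • L.profileField p (U t)) t) {y : ℝ} (hy : y ∈ Icc 0 p.period) : L.flow p y = U (y / p.period) := by
  have hsol : ∀ x ∈ Icc 0 y, U (x / p.period) ∈ L.U ∧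
      HasDerivAt (fun y => U (y / p.period)) (L.profileField p (U (x / p.period))) x :=
    fun x hx => hasDerivAt_comp_div_period hp hU ⟨hx.1, hx.2.trans hy.2⟩
  have hex : ∃ v : ℝ → Fin n → ℝ, v 0 = p.init ∧
      L.IsProfileOn p.speed p.dir p.const v (Set.uIcc 0 y) := by
    refine ⟨fun y => U (y / p.period), by simpa using hU0, ?_⟩
    rw [uIcc_of_le hy.1]
    intro x hx
    obtain ⟨h2, h3⟩ := hsol x hx
    refine ⟨h2, h3.differentiableAt, ?_⟩
    rw [h3.deriv]
    exact Bdir_mulVec_profileField h1 p h2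
  rw [flow, dif_pos hex]
  obtain ⟨hc0, hc⟩ := hex.choose_spec
  have hc : ∀ x ∈ Icc 0 y, _ := fun x hx => hc x (by rwa [uIcc_of_le hy.1])
  have hG : ContDiffOn ℝ 1 (fun u => L.profileField p u) L.U :=
    (contDiffOn_profileField h0 h1).comp (f := fun u => (p, u))
      (contDiff_prodMk_right p).contDiffOn fun u hu => hu
  refine eqOn_Icc_of_hasDerivWithinAt_of_contDiffOn h0.1 hG (γ₁ := hex.choose)
    (γ₂ := fun y => U (y / p.period)) (a := 0) (b := y) (fun t ht => ?_)
    (fun t ht => ⟨(hsol t ht).1, (hsol t ht).2.hasDerivWithinAt⟩) ?_ (right_mem_Icc.2 hy.1)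
  · obtain ⟨h2, h3, h4⟩ := hc t ht
    refine ⟨h2, ?_⟩
    rw [← eq_profileField h1 p h2 h4]
    exact h3.hasDerivAt.hasDerivWithinAt
  · rw [hc0]; simp [hU0]

/-- Restricted to the open interval, because `flow` is not controlled outside `[0, X]` and its
two-sided derivative at the endpoints is therefore unknown. The integral in `Fʲ` ignores the
endpoints. -/
lemma deriv_flow_eq {p : WaveParam n m} {U : ℝ → Fin n → ℝ} (h0 : L.H0) (h1 : L.H1)
    (hp : 0 < p.period) (hU0 : U 0 = p.init)
    (hU : ∀ t ∈ Icc (0 : ℝ) 1, U t ∈ L.U ∧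
      HasDerivAt U (p.period • L.profileField p (U t)) t) {y : ℝ} (hy : y ∈ Ioo 0 p.period) :
    deriv (L.flow p) y = L.profileField p (L.flow p y) := by
  have h2 : L.flow p =ᶠ[𝓝 y] fun y => U (y / p.period) := by
    filter_upwards [isOpen_Ioo.mem_nhds hy] with x hx
    exact flow_eq h0 h1 hp hU0 hU (Ioo_subset_Icc_self hx)
  rw [h2.deriv_eq, flow_eq h0 h1 hp hU0 hU (Ioo_subset_Icc_self hy)]
  exact (hasDerivAt_comp_div_period hp hU (Ioo_subset_Icc_self hy)).2.deriv

lemma integral_comp_div_eq_of_hasDerivAt {E : Type*} [NormedAddCommGroup E] [NormedSpace ℝ E]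
    [CompleteSpace E] {g Q : ℝ → E} {X : ℝ} (hX : 0 < X) (hQ0 : Q 0 = 0)
    (hQ : ∀ t ∈ Icc (0 : ℝ) 1, HasDerivAt Q (g t) t) (hg : ContinuousOn g (Icc 0 1)) :
    X⁻¹ • ∫ y in (0 : ℝ)..X, g (y / X) = Q 1 := by
  rw [intervalIntegral.integral_comp_div _ hX.ne', smul_smul, inv_mul_cancel₀ hX.ne', one_smul,
    zero_div, div_self hX.ne', intervalIntegral.integral_eq_sub_of_hasDerivAt (f := Q), hQ0,
    sub_zero]
  · intro t ht
    exact hQ t (by rwa [uIcc_of_le zero_le_one] at ht)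
  · exact ContinuousOn.intervalIntegrable (by rwa [uIcc_of_le zero_le_one])

/-- The functions `H`, `M`, `Fʲ` in terms of the solution of the augmented profile equation. -/
lemma H_M_F_eq (h0 : L.H0) (h1 : L.H1) {p : WaveParam n m} (hp : 0 < p.period)
    {z : ℝ → WaveState n m} (hz0 : z 0 = WaveParam.initState n m p)
    (hz : ∀ t ∈ Icc (0 : ℝ) 1, z t ∈ {z : WaveState n m | z.2.1 ∈ L.U} ∧
      HasDerivAt z (L.waveField (z t)) t) :
    L.H p = (z 1).2.1 - p.init ∧ L.M p = (z 1).2.2.1 ∧ ∀ j, L.F j p = (z 1).2.2.2 j := by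
  have hzc : ContinuousOn z (Icc 0 1) := fun t ht => (hz t ht).2.continuousAt.continuousWithinAt
  have hconst : ∀ t ∈ Icc (0 : ℝ) 1, (z t).1 = p := by
    intro t ht
    have := constant_of_has_deriv_right_zero (f := fun t => (z t).1)
      (continuous_fst.comp_continuousOn hzc) (fun t ht =>
        (hz t (Ico_subset_Icc_self ht)).2.prod_fst.hasDerivWithinAt) t ht
    rw [this, hz0]; rfl
  have hd2 : ∀ t ∈ Icc (0 : ℝ) 1, HasDerivAt (fun t => (z t).2)
      (L.waveField (z t)).2 t := fun t ht =>
    (hz t ht).2.prod_snd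
  have hU : ∀ t ∈ Icc (0 : ℝ) 1, (z t).2.1 ∈ L.U ∧
      HasDerivAt (fun t => (z t).2.1) (p.period • L.profileField p (z t).2.1) t := by
    intro t ht
    refine ⟨(hz t ht).1, ?_⟩
    have := (hd2 t ht).prod_fst
    rw [← hconst t ht]
    exact this
  have hU0 : (z 0).2.1 = p.init := by rw [hz0]; rfl
  have hd3 : ∀ t ∈ Icc (0 : ℝ) 1, HasDerivAt (fun t => (z t).2.2)
      (L.waveField (z t)).2.2 t := fun t ht =>
    (hd2 t ht).prod_snd
  have hM : ∀ t ∈ Icc (0 : ℝ) 1, HasDerivAt (fun t => (z t).2.2.1) ((z t).2.1) t := fun t ht =>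
    (hd3 t ht).prod_fst
  have hF : ∀ j, ∀ t ∈ Icc (0 : ℝ) 1, HasDerivAt (fun t => (z t).2.2.2 j)
      (L.fluxField j p (z t).2.1) t := by
    intro j t ht
    have := (hd3 t ht).prod_snd
    rw [← hconst t ht]
    exact hasDerivAt_pi.1 this j
  have hUc : ContinuousOn (fun t => (z t).2.1) (Icc 0 1) := fun t ht =>
    (hU t ht).2.continuousAt.continuousWithinAt
  have hflow : ∀ y ∈ Icc 0 p.period, L.flow p y = (z (y / p.period)).2.1 := fun y hy =>
    flow_eq h0 h1 hp hU0 hU hy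
  refine ⟨?_, ?_, fun j => ?_⟩
  · rw [H, hflow _ (right_mem_Icc.2 hp.le), div_self hp.ne']
  · rw [M, intervalIntegral.integral_congr (g := fun y => (z (y / p.period)).2.1)]
    · exact integral_comp_div_eq_of_hasDerivAt hp (g := fun t => (z t).2.1)
        (Q := fun t => (z t).2.2.1) (by rw [hz0]; rfl) hM hUc
    · rw [uIcc_of_le hp.le]; exact hflow
  · rw [F, intervalIntegral.integral_congr_Ioo_of_le hp.le
      (g := fun y => L.fluxField j p (z (y / p.period)).2.1)]
    · refine integral_comp_div_eq_of_hasDerivAt hp (g := fun t => L.fluxField j p (z t).2.1)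
        (Q := fun t => (z t).2.2.2 j) (by rw [hz0]; rfl) (hF j) ?_
      exact (contDiffOn_fluxField h0 h1 j).continuousOn.comp (f := fun t => (p, (z t).2.1))
        (continuousOn_const.prodMk hUc) fun t ht => (hU t ht).1
    · intro y hy
      simp only [deriv_flow_eq h0 h1 hp hU0 hU hy, hflow y (Ioo_subset_Icc_self hy), fluxField]

end ConsLaw

namespace PeriodicWave

variable {n m : ℕ} {L : ConsLaw n m} (W : PeriodicWave L)

/-- The mean of the wave over a period. -/
noncomputable def meanU : Fin n → ℝ := W.X⁻¹ • ∫ y in (0 : ℝ)..W.X, W.u y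

/-- The mean of the flux of the wave over a period. -/
noncomputable def meanFlux (j : Fin (m + 1)) : Fin n → ℝ :=
  W.X⁻¹ • ∫ y in (0 : ℝ)..W.X, W.flux j y

/-- The solution of the augmented profile equation that corresponds to the wave. -/
noncomputable def stateCurve (t : ℝ) : WaveState n m :=
  (W.base, W.u (W.X * t), W.X⁻¹ • ∫ y in (0 : ℝ)..(W.X * t), W.u y,
    fun j => W.X⁻¹ • ∫ y in (0 : ℝ)..(W.X * t), W.flux j y)

lemma continuous_flux (h0 : L.H0) (h1 : L.H1) (j : Fin (m + 1)) : Continuous (W.flux j) :=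
  continuous_iff_continuousAt.2 fun x => (W.hasDerivAt_flux h0 h1 j x).continuousAt

lemma stateCurve_zero : W.stateCurve 0 = WaveParam.initState n m W.base := by
  rw [WaveParam.initState_apply, stateCurve]
  simp only [mul_zero, intervalIntegral.integral_same, smul_zero]
  rfl

lemma hasDerivAt_scaled_primitive {E : Type*} [NormedAddCommGroup E] [NormedSpace ℝ E]
    [CompleteSpace E] {g : ℝ → E} (hg : Continuous g) {X : ℝ} (hX : X ≠ 0) (t : ℝ) :
    HasDerivAt (fun t => X⁻¹ • ∫ y in (0 : ℝ)..(X * t), g y) (g (X * t)) t := by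
  have h2 : HasDerivAt (fun t : ℝ => X * t) X t := by
    simpa using (hasDerivAt_id t).const_mul X
  have h3 := (HasDerivAt.scomp t ((hg.integral_hasStrictDerivAt 0 (X * t)).hasDerivAt)
    h2).const_smul X⁻¹
  refine h3.congr_deriv ?_
  rw [smul_smul, inv_mul_cancel₀ hX, one_smul]

lemma hasDerivAt_stateCurve (h0 : L.H0) (h1 : L.H1) (t : ℝ) :
    HasDerivAt W.stateCurve (L.waveField (W.stateCurve t)) t := by
  have hu : HasDerivAt (fun t => W.u (W.X * t)) (W.X • deriv W.u (W.X * t)) t := by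
    have h2 : HasDerivAt (fun t : ℝ => W.X * t) W.X t := by
      simpa using (hasDerivAt_id t).const_mul W.X
    exact HasDerivAt.scomp t (W.differentiable (W.X * t)).hasDerivAt h2
  have hM := hasDerivAt_scaled_primitive W.differentiable.continuous W.X_pos.ne' t
  have hF : ∀ j, _ := fun j =>
    hasDerivAt_scaled_primitive (W.continuous_flux h0 h1 j) W.X_pos.ne' t
  have h := (hasDerivAt_const t W.base).prodMk (hu.prodMk (hM.prodMk (hasDerivAt_pi.2 hF)))
  refine h.congr_deriv ?_
  simp only [ConsLaw.waveField, stateCurve, W.profileField_base h1, W.fluxField_base h1]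
  rfl

/-- Since the field is differentiable, its derivative can be read off along a line. Varying the
factor `X` produces the term `h.period • ū'`. -/
lemma fderiv_waveField (h0 : L.H0) (h1 : L.H1) (x : ℝ) (M₀ : Fin n → ℝ)
    (F₀ : Fin (m + 1) → Fin n → ℝ) (h : WaveParam n m) (w M' : Fin n → ℝ)
    (F' : Fin (m + 1) → Fin n → ℝ) :
    fderiv ℝ L.waveField (W.base, W.u x, M₀, F₀) (h, w, M', F') =
    (0, W.X • (fderiv ℝ (fun z : WaveParam n m × (Fin n → ℝ) => L.profileField z.1 z.2)
        (W.base, W.u x) (h, w)) + h.period • deriv W.u x, w, fun j =>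
      W.A j x *ᵥ w - L.B j 0 (W.u x) *ᵥ (fderiv ℝ (fun z : WaveParam n m × (Fin n → ℝ) =>
          L.profileField z.1 z.2) (W.base, W.u x) (h, w))
        - ∑ k : Fin m, h.2.2.2.1 k • (L.B j k.succ (W.u x) *ᵥ deriv W.u x)) := by
  have hd : DifferentiableAt ℝ L.waveField (W.base, W.u x, M₀, F₀) :=
    ((ConsLaw.contDiffOn_waveField h0 h1).differentiableOn (by norm_num)).differentiableAt
      ((h0.1.preimage (continuous_fst.comp continuous_snd)).mem_nhds (W.mem x))
  have h2 : HasDerivAt (fun s : ℝ => L.waveField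
      ((W.base, W.u x, M₀, F₀) + s • (h, w, M', F'))) _ 0 :=
    hd.hasFDerivAt.hasLineDerivAt (h, w, M', F')
  refine h2.unique ?_
  have hX : HasDerivAt (fun s : ℝ => W.X + s * h.period) h.period 0 := by
    simpa using ((hasDerivAt_id (0 : ℝ)).mul_const h.period).const_add W.X
  have hP := hX.fun_smul (W.hasDerivAt_profileField_line h0 h1 h x w)
  have hw : HasDerivAt (fun s : ℝ => W.u x + s • w) w 0 := by
    simpa using ((hasDerivAt_id (0 : ℝ)).smul_const w).const_add (W.u x)
  have h3 := (hasDerivAt_const (0 : ℝ) (0 : WaveParam n m)).prodMk (hP.prodMk (hw.prodMk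
    (hasDerivAt_pi.2 fun j => W.hasDerivAt_fluxField_line h0 h1 h x w j)))
  refine h3.congr_deriv ?_
  simp only [zero_mul, add_zero, zero_smul, W.profileField_base h1]

/-- `v` solves the linearized profile equation in the direction `h`, and `Mh`, `Fh j` are
primitives of the linearized integrands of `M` and `Fʲ`. -/
structure IsVariation (h : WaveParam n m) (v vd Mh : ℝ → Fin n → ℝ)
    (Fh : Fin (m + 1) → ℝ → Fin n → ℝ) : Prop where
  init : v 0 = h.init
  M_zero : Mh 0 = 0
  F_zero : ∀ j, Fh j 0 = 0
  hasDeriv : ∀ x ∈ Icc 0 W.X, HasDerivWithinAt v (vd x) (Icc 0 W.X) x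
  profile : ∀ x ∈ Icc 0 W.X, L.B 0 0 (W.u x) *ᵥ vd x = W.varRhs h x (v x)
  hasDeriv_M : ∀ x ∈ Icc 0 W.X, HasDerivWithinAt Mh (v x) (Icc 0 W.X) x
  hasDeriv_F : ∀ j, ∀ x ∈ Icc 0 W.X, HasDerivWithinAt (Fh j)
    (W.A j x *ᵥ v x - L.B j 0 (W.u x) *ᵥ vd x
      - ∑ k : Fin m, h.2.2.2.1 k • (L.B j k.succ (W.u x) *ᵥ deriv W.u x)) (Icc 0 W.X) x

end PeriodicWave

end

/-! ### The differentials of `H`, `(M, Ω N)` and `(Fʲ, S Ω eⱼ)`. -/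

section

open Set Filter Topology

namespace PeriodicWave

variable {n m : ℕ} {L : ConsLaw n m} (W : PeriodicWave L)

lemma stateCurve_one : W.stateCurve 1 = (W.base, W.u W.X, W.meanU, W.meanFlux) := by
  simp only [stateCurve, mul_one, meanU]
  rfl

/-- Differentiability of `H`, `M`, `Fʲ` at the wave. -/
theorem exists_hasFDerivAt (h0 : L.H0) (h1 : L.H1) :
    ∃ T : WaveState n m →L[ℝ] WaveState n m,
      HasFDerivAt L.H ((ContinuousLinearMap.fst ℝ _ _ ∘L ContinuousLinearMap.snd ℝ _ _) ∘L T ∘L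
        WaveParam.initState n m - ContinuousLinearMap.fst ℝ _ _ ∘L ContinuousLinearMap.snd ℝ _ _)
        W.base ∧
      HasFDerivAt L.M ((ContinuousLinearMap.fst ℝ _ _ ∘L ContinuousLinearMap.snd ℝ _ _ ∘L
        ContinuousLinearMap.snd ℝ _ _) ∘L T ∘L WaveParam.initState n m) W.base ∧
      (∀ j, HasFDerivAt (L.F j) (ContinuousLinearMap.proj j ∘L (ContinuousLinearMap.snd ℝ _ _ ∘L
        ContinuousLinearMap.snd ℝ _ _ ∘L
        ContinuousLinearMap.snd ℝ _ _) ∘L T ∘L WaveParam.initState n m) W.base) ∧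
      (L.M W.base = W.meanU ∧ ∀ j, L.F j W.base = W.meanFlux j) ∧
      ∀ h, ∃ V : ℝ → WaveState n m, V 0 = h ∧ V 1 = T h ∧
        ∀ t ∈ Icc (0 : ℝ) 1, HasDerivWithinAt V
          (fderiv ℝ L.waveField (W.stateCurve t) (V t)) (Icc 0 1) t := by
  -- All the functions in question are linear images of the time-one state, up to subtraction of the
  -- initial value, so a single derivative `T` serves them all.
  obtain ⟨φ, T, hφ, hT, hV⟩ := exists_flow_hasFDerivAt
    (h0.1.preimage (continuous_fst.comp continuous_snd)) (ConsLaw.contDiffOn_waveField h0 h1)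
    (γ := W.stateCurve) (fun t _ => ⟨W.mem _, (W.hasDerivAt_stateCurve h0 h1 t).hasDerivWithinAt⟩)
  rw [stateCurve_zero] at hφ hT
  have hpos : ∀ᶠ p : WaveParam n m in 𝓝 W.base, 0 < p.period :=
    (continuous_fst.isOpen_preimage _ isOpen_Ioi).mem_nhds W.X_pos
  have hev : ∀ᶠ p in 𝓝 W.base, L.H p = (φ (WaveParam.initState n m p) 1).2.1 - p.init ∧
      L.M p = (φ (WaveParam.initState n m p) 1).2.2.1 ∧
      ∀ j, L.F j p = (φ (WaveParam.initState n m p) 1).2.2.2 j := by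
    filter_upwards [(WaveParam.initState n m).continuous.continuousAt.eventually hφ, hpos]
      with p hp hp0
    exact ConsLaw.H_M_F_eq h0 h1 hp0 hp.1 hp.2
  have hTι : HasFDerivAt (fun p => φ (WaveParam.initState n m p) 1)
      (T ∘L WaveParam.initState n m) W.base :=
    hT.comp W.base (WaveParam.initState n m).hasFDerivAt
  have hbase := ConsLaw.H_M_F_eq h0 h1 W.X_pos (p := W.base) W.stateCurve_zero
    (fun t _ => ⟨W.mem _, W.hasDerivAt_stateCurve h0 h1 t⟩)
  rw [stateCurve_one] at hbase
  refine ⟨T, ?_, ?_, fun j => ?_, hbase.2, hV⟩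
  · refine HasFDerivAt.congr_of_eventuallyEq (f := fun p : WaveParam n m =>
      (φ (WaveParam.initState n m p) 1).2.1 - p.2.1) ?_ (hev.mono fun p hp => hp.1)
    let π : WaveState n m →L[ℝ] (Fin n → ℝ) :=
      ContinuousLinearMap.fst ℝ _ _ ∘L ContinuousLinearMap.snd ℝ _ _
    have h3 : HasFDerivAt (fun p => (φ (WaveParam.initState n m p) 1).2.1) _ W.base :=
      π.hasFDerivAt.comp W.base hTι
    let ρ : WaveParam n m →L[ℝ] (Fin n → ℝ) :=
      ContinuousLinearMap.fst ℝ _ _ ∘L ContinuousLinearMap.snd ℝ _ _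
    have h4 : HasFDerivAt (fun p : WaveParam n m => p.2.1) ρ W.base := ρ.hasFDerivAt
    exact h3.fun_sub h4
  · refine HasFDerivAt.congr_of_eventuallyEq (f := fun p : WaveParam n m =>
      (φ (WaveParam.initState n m p) 1).2.2.1) ?_ (hev.mono fun p hp => hp.2.1)
    exact (ContinuousLinearMap.fst ℝ _ _ ∘L ContinuousLinearMap.snd ℝ _ _ ∘L
      ContinuousLinearMap.snd ℝ _ _).hasFDerivAt.comp W.base hTι
  · refine HasFDerivAt.congr_of_eventuallyEq (f := fun p : WaveParam n m =>
      (φ (WaveParam.initState n m p) 1).2.2.2 j) ?_ (hev.mono fun p hp => hp.2.2 j)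
    exact (ContinuousLinearMap.proj j ∘L (ContinuousLinearMap.snd ℝ _ _ ∘L
        ContinuousLinearMap.snd ℝ _ _ ∘L
        ContinuousLinearMap.snd ℝ _ _)).hasFDerivAt.comp W.base hTι

lemma hasDerivAt_period_inv_line (h : WaveParam n m) :
    HasDerivAt (fun s : ℝ => (W.base + s • h).period⁻¹) (-(h.period / W.X ^ 2)) 0 := by
  have hX : HasDerivAt (fun s : ℝ => W.X + s * h.period) h.period 0 := by
    simpa using ((hasDerivAt_id (0 : ℝ)).mul_const h.period).const_add W.X
  have := hX.fun_inv (by simpa using W.X_pos.ne')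
  have h2 : (fun s : ℝ => (W.base + s • h).period⁻¹) = fun s : ℝ => (W.X + s * h.period)⁻¹ := rfl
  rw [h2]
  simpa [neg_div] using this

lemma differentiableAt_period_inv :
    DifferentiableAt ℝ (fun p : WaveParam n m => p.period⁻¹) W.base :=
  DifferentiableAt.inv differentiableAt_fst W.X_pos.ne'

/-- The differential of `(M, Ω N)` at the wave. -/
lemma fderiv_density {M' : WaveParam n m →L[ℝ] (Fin n → ℝ)} (hM : HasFDerivAt L.M M' W.base)
    (h : WaveParam n m) :
    fderiv ℝ L.density W.base h = Sum.elim (M' h)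
      (W.X⁻¹ • (Fin.cons 0 h.2.2.2.1 : Fin (m + 1) → ℝ)
        - (h.period / W.X ^ 2) • (Pi.single 0 1 : Fin (m + 1) → ℝ)) := by
  have hd : DifferentiableAt ℝ L.density W.base := by
    rw [differentiableAt_pi]
    rintro (a | j)
    · exact differentiableAt_pi.1 hM.differentiableAt a
    · exact W.differentiableAt_period_inv.mul (differentiableAt_pi.1
        ((ConsLaw.contDiff_dir (k := 1)).differentiable one_ne_zero W.base) j)
  have h2 : HasDerivAt (fun s : ℝ => L.density (W.base + s • h)) _ 0 :=
    hd.hasFDerivAt.hasLineDerivAt h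
  refine h2.unique ?_
  rw [hasDerivAt_pi]
  have h3 : HasDerivAt (fun s : ℝ => L.M (W.base + s • h)) _ 0 := hM.hasLineDerivAt h
  rintro (a | j)
  · exact hasDerivAt_pi.1 h3 a
  · have h4 := (W.hasDerivAt_period_inv_line h).fun_mul
      (hasDerivAt_pi.1 (hasDerivAt_nuChart_line h.2.2.2.1) j)
    refine (h4.congr_of_eventuallyEq (Eventually.of_forall fun s => ?_)).congr_deriv ?_
    · simp [ConsLaw.density, dir_line]
    · have hX : (W.base + (0 : ℝ) • h).period = W.X := by
        rw [zero_smul, add_zero]; rfl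
      rw [hX]
      simp only [zero_smul, nuChart_zero, Sum.elim_inr, Pi.sub_apply, Pi.smul_apply, smul_eq_mul]
      ring

/-- The differential of `(Fʲ, S Ω eⱼ)` at the wave. -/
lemma fderiv_avgFlux {j : Fin (m + 1)} {F' : WaveParam n m →L[ℝ] (Fin n → ℝ)}
    (hF : HasFDerivAt (L.F j) F' W.base) (h : WaveParam n m) :
    fderiv ℝ (L.avgFlux j) W.base h = Sum.elim (F' h) (Pi.single j (h.speed * W.X⁻¹)) := by
  have hs : DifferentiableAt ℝ (fun p : WaveParam n m => p.speed) W.base := by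
    unfold WaveParam.speed; fun_prop
  have hd : DifferentiableAt ℝ (L.avgFlux j) W.base := by
    rw [differentiableAt_pi]
    rintro (a | k)
    · exact differentiableAt_pi.1 hF.differentiableAt a
    · by_cases hk : k = j
      · subst hk
        simp only [ConsLaw.avgFlux, Sum.elim_inr, Pi.single_eq_same]
        exact hs.mul W.differentiableAt_period_inv
      · simp only [ConsLaw.avgFlux, Sum.elim_inr, Pi.single_eq_of_ne hk]
        exact differentiableAt_const _
  have h2 : HasDerivAt (fun s : ℝ => L.avgFlux j (W.base + s • h)) _ 0 :=
    hd.hasFDerivAt.hasLineDerivAt h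
  refine h2.unique ?_
  rw [hasDerivAt_pi]
  have h3 : HasDerivAt (fun s : ℝ => L.F j (W.base + s • h)) _ 0 := hF.hasLineDerivAt h
  rintro (a | k)
  · exact hasDerivAt_pi.1 h3 a
  · by_cases hk : k = j
    · subst hk
      have h4 := ((hasDerivAt_id (0 : ℝ)).mul_const h.speed).fun_mul
        (W.hasDerivAt_period_inv_line h)
      refine (h4.congr_of_eventuallyEq (Eventually.of_forall fun s => ?_)).congr_deriv ?_
      · simp [ConsLaw.avgFlux, WaveParam.speed, base]
      · have hX : (W.base + (0 : ℝ) • h).period = W.X := by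
          rw [zero_smul, add_zero]; rfl
        rw [hX]
        simp
    · simp only [ConsLaw.avgFlux, Sum.elim_inr, Pi.single_eq_of_ne hk]
      exact hasDerivAt_const _ _

/-- The first component of the flux is the constant `q̄`; differentiating it shows that `ū'` solves
the linearized profile equation. -/
lemma A_zero_mulVec_deriv_u (h0 : L.H0) (h1 : L.H1) (x : ℝ) :
    W.A 0 x *ᵥ deriv W.u x = L.B 0 0 (W.u x) *ᵥ deriv (deriv W.u) x := by
  have h2 := W.hasDerivAt_flux h0 h1 0 x
  have h3 : W.flux 0 = fun _ => W.q := funext W.flux_zero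
  rw [h3] at h2
  exact sub_eq_zero.1 (h2.unique (hasDerivAt_const x W.q))

/-- Subtracting a multiple of the translation mode, even with a factor that depends on `x`, changes
the right-hand side as it changes `B¹¹ v'`, apart from the derivative of the factor. -/
lemma varRhs_add_smul (h0 : L.H0) (h1 : L.H1) (h : WaveParam n m) (x c : ℝ) (w : Fin n → ℝ) :
    W.varRhs h x (w - c • deriv W.u x) =
      W.varRhs h x w - c • (L.B 0 0 (W.u x) *ᵥ deriv (deriv W.u) x) := by
  rw [← W.A_zero_mulVec_deriv_u h0 h1]
  simp only [varRhs, Matrix.mulVec_sub, Matrix.mulVec_smul]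
  abel

/-- The differentials of `H`, `(M, Ω N)` and `(Fʲ, S Ω eⱼ)` at the wave, in terms of the
linearized profile equation. -/
theorem exists_isVariation (h0 : L.H0) (h1 : L.H1) (h : WaveParam n m) :
    ∃ v vd Mh Fh, W.IsVariation h v vd Mh Fh ∧
      fderiv ℝ L.H W.base h = v W.X + h.period • deriv W.u 0 - h.init ∧
      fderiv ℝ L.density W.base h = Sum.elim
        (W.X⁻¹ • (Mh W.X + h.period • (W.u 0 - W.meanU)))
        (W.X⁻¹ • (Fin.cons 0 h.2.2.2.1 : Fin (m + 1) → ℝ)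
          - (h.period / W.X ^ 2) • (Pi.single 0 1 : Fin (m + 1) → ℝ)) ∧
      ∀ j, fderiv ℝ (L.avgFlux j) W.base h = Sum.elim
        (W.X⁻¹ • (Fh j W.X + h.period • (W.flux j 0 - W.meanFlux j)))
        (Pi.single j (h.speed * W.X⁻¹)) := by
  obtain ⟨T, hH, hM, hF, -, hV⟩ := W.exists_hasFDerivAt h0 h1
  obtain ⟨V, hV0, hV1, hV⟩ := hV (WaveParam.initState n m h)
  have hXX : W.X ≠ 0 := W.X_pos.ne'
  have hVc : ContinuousOn V (Icc 0 1) := fun t ht => (hV t ht).continuousWithinAt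
  have hconst : ∀ t ∈ Icc (0 : ℝ) 1, (V t).1 = h := by
    intro t ht
    have := constant_of_has_deriv_right_zero (f := fun t => (V t).1)
      (continuous_fst.comp_continuousOn hVc) (fun t ht => by
        have h3 := (hV t (Ico_subset_Icc_self ht)).prod_fst
        rw [stateCurve, show V t = ((V t).1, (V t).2.1, (V t).2.2.1, (V t).2.2.2) from rfl,
          W.fderiv_waveField h0 h1] at h3
        exact h3.mono_of_mem_nhdsWithin (Icc_mem_nhdsGE_of_mem ht)) t ht
    rw [this, hV0]; rfl
  let D : ℝ → Fin n → ℝ := fun t =>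
    fderiv ℝ (fun z : WaveParam n m × (Fin n → ℝ) => L.profileField z.1 z.2)
        (W.base, W.u (W.X * t)) (h, (V t).2.1)
  have hV' : ∀ t ∈ Icc (0 : ℝ) 1, HasDerivWithinAt V
      (0, W.X • D t + h.period • deriv W.u (W.X * t), (V t).2.1, fun j =>
      W.A j (W.X * t) *ᵥ (V t).2.1 - L.B j 0 (W.u (W.X * t)) *ᵥ D t
        - ∑ k : Fin m, h.2.2.2.1 k • (L.B j k.succ (W.u (W.X * t)) *ᵥ deriv W.u (W.X * t)))
      (Icc 0 1) t := by
    intro t ht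
    have h3 := hV t ht
    rw [stateCurve, show V t = ((V t).1, (V t).2.1, (V t).2.2.1, (V t).2.2.2) from rfl,
      W.fderiv_waveField h0 h1, hconst t ht] at h3
    exact h3
  have hmem : ∀ x ∈ Icc 0 W.X, x / W.X ∈ Icc (0 : ℝ) 1 := fun x hx =>
    ⟨div_nonneg hx.1 W.X_pos.le, (div_le_one W.X_pos).2 hx.2⟩
  have hmul : ∀ x, W.X * (x / W.X) = x := fun x => mul_div_cancel₀ x hXX
  have hτ : ∀ x, HasDerivWithinAt (fun x => h.period * (x / W.X)) (h.period * W.X⁻¹)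
      (Icc 0 W.X) x := fun x => by
    simpa using (((hasDerivAt_id x).div_const W.X).const_mul h.period).hasDerivWithinAt
  have hu : ∀ x, HasDerivWithinAt W.u (deriv W.u x) (Icc 0 W.X) x := fun x =>
    (W.differentiable x).hasDerivAt.hasDerivWithinAt
  have hdu : ∀ x, HasDerivWithinAt (deriv W.u) (deriv (deriv W.u) x) (Icc 0 W.X) x := fun x =>
    ((W.contDiff_deriv_u h0 h1).differentiable (by norm_num) x).hasDerivAt.hasDerivWithinAt
  -- In rescaled time a change of period stretches the profile. Removing this stretching leaves the
  -- variation at fixed `x`; the period then enters only through the boundary term `h.period •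
  -- ū'(0)`.
  let v : ℝ → Fin n → ℝ := fun x => (V (x / W.X)).2.1 - (h.period * (x / W.X)) • deriv W.u x
  let vd : ℝ → Fin n → ℝ := fun x =>
    D (x / W.X) - (h.period * (x / W.X)) • deriv (deriv W.u) x
  -- The subtracted bracket is the primitive of `(h.period * (x / X)) ū'`, found by integration by
  -- parts; `Fh` is analogous.
  let Mh : ℝ → Fin n → ℝ := fun x => W.X • (V (x / W.X)).2.2.1 -
    ((h.period * (x / W.X)) • W.u x - (h.period * W.X⁻¹) • ∫ y in (0 : ℝ)..x, W.u y)
  let Fh : Fin (m + 1) → ℝ → Fin n → ℝ := fun j x => W.X • (V (x / W.X)).2.2.2 j -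
    ((h.period * (x / W.X)) • W.flux j x - (h.period * W.X⁻¹) • ∫ y in (0 : ℝ)..x, W.flux j y)
  refine ⟨v, vd, Mh, Fh, ⟨?_, ?_, fun j => ?_, fun x hx => ?_, fun x hx => ?_, fun x hx => ?_,
    fun j x hx => ?_⟩, ?_, ?_, fun j => ?_⟩
  · simp [v, hV0, WaveParam.initState_apply]
  · simp [Mh, hV0, WaveParam.initState_apply]
  · simp [Fh, hV0, WaveParam.initState_apply]
  · have h3 := (hasDerivWithinAt_comp_div W.X_pos
      (hV' _ (hmem x hx)).prod_snd.prod_fst).fun_sub ((hτ x).fun_smul (hdu x))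
    refine h3.congr_deriv ?_
    simp only [hmul, vd, smul_add, smul_smul, inv_mul_cancel₀ hXX, one_smul]
    module
  · have h3 : L.B 0 0 (W.u x) *ᵥ D (x / W.X) = W.varRhs h x (V (x / W.X)).2.1 := by
      simp only [D, hmul]
      exact W.B_mulVec_fderiv_profileField h0 h1 h x _
    simp only [v, vd, Matrix.mulVec_sub, Matrix.mulVec_smul, h3, W.varRhs_add_smul h0 h1]
  · have h3 := ((hasDerivWithinAt_comp_div W.X_pos
      (hV' _ (hmem x hx)).prod_snd.prod_snd.prod_fst).const_smul W.X).fun_sub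
      (((hτ x).fun_smul (hu x)).fun_sub
      (((W.differentiable.continuous.integral_hasStrictDerivAt 0 x).hasDerivAt.hasDerivWithinAt
        (s := Icc 0 W.X)).const_smul (h.period * W.X⁻¹)))
    refine h3.congr_deriv ?_
    simp only [v, smul_smul, mul_inv_cancel₀ hXX, one_smul]
    module
  · have h3 := ((hasDerivWithinAt_comp_div W.X_pos
      (hasDerivWithinAt_pi.1 (hV' _ (hmem x hx)).prod_snd.prod_snd.prod_snd j)).const_smul
        W.X).fun_sub (((hτ x).fun_smul (W.hasDerivAt_flux h0 h1 j x).hasDerivWithinAt).fun_sub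
      ((((W.continuous_flux h0 h1 j).integral_hasStrictDerivAt 0 x).hasDerivAt.hasDerivWithinAt
        (s := Icc 0 W.X)).const_smul (h.period * W.X⁻¹)))
    refine h3.congr_deriv ?_
    simp only [v, vd, hmul, smul_smul, mul_inv_cancel₀ hXX, one_smul, Matrix.mulVec_sub,
      Matrix.mulVec_smul]
    module
  · rw [hH.fderiv]
    show (T (WaveParam.initState n m h)).2.1 - h.init = _
    rw [← hV1]
    simp only [v, div_self hXX, mul_one]
    have := W.periodic_deriv_u 0
    rw [zero_add] at this
    rw [this]; abel
  · rw [W.fderiv_density hM]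
    congr 1
    show (T (WaveParam.initState n m h)).2.2.1 = _
    rw [← hV1]
    have := W.periodic 0
    rw [zero_add] at this
    simp only [Mh, div_self hXX, mul_one, this, meanU, smul_add, smul_sub, smul_smul,
      inv_mul_cancel₀ hXX, one_smul]
    module
  · rw [W.fderiv_avgFlux (hF j)]
    congr 1
    show (T (WaveParam.initState n m h)).2.2.2 j = _
    rw [← hV1]
    have := W.periodic_flux j 0
    rw [zero_add] at this
    simp only [Fh, div_self hXX, mul_one, this, meanFlux, smul_add, smul_sub, smul_smul,
      inv_mul_cancel₀ hXX, one_smul]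
    module

end PeriodicWave

end

section

open Set Filter Topology

/-! ### Complexification -/

/-- The inclusion of `ℝⁿ` into `ℂⁿ`. -/
noncomputable def cplx (n : ℕ) : (Fin n → ℝ) →L[ℝ] (Fin n → ℂ) :=
  ContinuousLinearMap.pi fun a => Complex.ofRealCLM ∘L ContinuousLinearMap.proj a

@[simp] lemma cplx_apply {n : ℕ} (v : Fin n → ℝ) (a : Fin n) : cplx n v a = (v a : ℂ) := rfl

lemma cplx_smul {n : ℕ} (c : ℝ) (v : Fin n → ℝ) : cplx n (c • v) = (c : ℂ) • cplx n v := by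
  ext a; simp

lemma map_mulVec_cplx {n : ℕ} (N : Matrix (Fin n) (Fin n) ℝ) (v : Fin n → ℝ) :
    (N.map fun r : ℝ => (r : ℂ)) *ᵥ cplx n v = cplx n (N *ᵥ v) := by
  ext a
  simp [Matrix.mulVec, dotProduct]

lemma HasDerivAt.cplx {n : ℕ} {v : ℝ → Fin n → ℝ} {v' : Fin n → ℝ} {x : ℝ}
    (h : HasDerivAt v v' x) : HasDerivAt (fun x => cplx n (v x)) (cplx n v') x :=
  (_root_.cplx n).hasFDerivAt.comp_hasDerivAt x h

lemma HasDerivWithinAt.cplx {n : ℕ} {v : ℝ → Fin n → ℝ} {v' : Fin n → ℝ} {x : ℝ} {s : Set ℝ}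
    (h : HasDerivWithinAt v v' s x) :
    HasDerivWithinAt (fun x => cplx n (v x)) (cplx n v') s x :=
  (_root_.cplx n).hasFDerivAt.comp_hasDerivWithinAt x h

lemma differentiable_mulVec {n : ℕ} {N : ℝ → Matrix (Fin n) (Fin n) ℂ} {v : ℝ → Fin n → ℂ}
    (hN : ∀ a b, Differentiable ℝ (fun t => N t a b)) (hv : Differentiable ℝ v) :
    Differentiable ℝ (fun t => N t *ᵥ v t) := by
  rw [differentiable_pi] at hv ⊢
  intro a
  simp only [Matrix.mulVec, dotProduct]
  exact Differentiable.fun_sum fun b _ => (hN a b).mul (hv b)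

/-! ### Holomorphic dependence on two complex parameters. -/

lemma differentiable_affine_pair {E : Type*} [NormedAddCommGroup E] [NormedSpace ℂ E]
    (a b c : E) : Differentiable ℂ fun p : ℂ × ℂ => a + p.1 • b + p.2 • c := by
  fun_prop

lemma exists_norm_affine_pair_lt {E : Type*} [NormedAddCommGroup E] [NormedSpace ℂ E] {R : ℝ}
    (hR : 0 < R) (a b c : E) :
    ∃ K > 0, ∀ p : ℂ × ℂ, ‖p.1‖ < R → ‖p.2‖ < R → ‖a + p.1 • b + p.2 • c‖ < K := by
  refine ⟨‖a‖ + R * ‖b‖ + R * ‖c‖ + 1, by positivity, fun p h1 h2 => ?_⟩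
  have e1 : ‖p.1 • b‖ ≤ R * ‖b‖ := by
    rw [norm_smul]; gcongr
  have e2 : ‖p.2 • c‖ ≤ R * ‖c‖ := by
    rw [norm_smul]; gcongr
  have e3 := norm_add₃_le (a := a) (b := p.1 • b) (c := p.2 • c)
  linarith

/-- The evolution operator of a linear equation whose coefficient is affine in two complex
parameters depends holomorphically on these parameters. -/
theorem exists_evolution_affine {V : Type*} [NormedAddCommGroup V] [NormedSpace ℝ V]
    [NormedSpace ℂ V] [IsScalarTower ℝ ℂ V] [CompleteSpace V] {R : ℝ} (hR : 0 < R)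
    (A₀ A₁ A₂ : BoundedContinuousFunction ℝ (V →L[ℂ] V)) :
    ∃ Ψ : ℂ → ℂ → ℝ → (V →L[ℂ] V),
      (∀ ε lam, ‖ε‖ < R → ‖lam‖ < R → ∀ Y₀, Ψ ε lam 0 Y₀ = Y₀ ∧
        ∀ t, HasDerivAt (fun t => Ψ ε lam t Y₀)
          ((A₀ t + ε • A₁ t + lam • A₂ t) (Ψ ε lam t Y₀)) t) ∧
      ∀ t, DifferentiableOn ℂ (fun p : ℂ × ℂ => Ψ p.1 p.2 t)
        (Metric.ball 0 R ×ˢ Metric.ball 0 R) := by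
  have : IsScalarTower ℝ (V →L[ℂ] V) (V →L[ℂ] V) :=
    ⟨fun r f g => ContinuousLinearMap.ext fun v => rfl⟩
  have : SMulCommClass ℝ (V →L[ℂ] V) (V →L[ℂ] V) :=
    ⟨fun r f g => ContinuousLinearMap.ext fun v => (f.map_smul_of_tower r (g v)).symm⟩
  have hAd : Differentiable ℂ fun p : ℂ × ℂ => A₀ + p.1 • A₁ + p.2 • A₂ :=
    differentiable_affine_pair A₀ A₁ A₂
  obtain ⟨K, hK, hnorm⟩ := exists_norm_affine_pair_lt hR A₀ A₁ A₂
  obtain ⟨Ψ, hΨ, hΨd⟩ := exists_fundamentalSolution ℂ (V →L[ℂ] V) K hK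
  refine ⟨fun ε lam => Ψ (A₀ + ε • A₁ + lam • A₂), fun ε lam hε hlam Y₀ => ?_, fun t => ?_⟩
  · obtain ⟨h2, h3⟩ := hΨ _ (hnorm (ε, lam) hε hlam)
    refine ⟨congrArg (fun f : V →L[ℂ] V => f Y₀) h2, fun t => ?_⟩
    exact ((ContinuousLinearMap.apply ℂ V Y₀).restrictScalars ℝ).hasFDerivAt.comp_hasDerivAt t
      (h3 t)
  · refine (hΨd t).comp hAd.differentiableOn fun p hp => ?_
    rw [mem_ball_zero_iff]
    exact hnorm p (by simpa using hp.1) (by simpa using hp.2)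

namespace PeriodicWave

variable {n m : ℕ} {L : ConsLaw n m} (W : PeriodicWave L)

/-! ### The coefficients of the linearized operator -/

lemma periodic_Bc (j k : Fin (m + 1)) : Function.Periodic (W.Bc j k) W.X := fun x => by
  rw [Bc, Bc, W.periodic]

lemma periodic_Ac (j : Fin (m + 1)) : Function.Periodic (W.Ac j) W.X := fun x => by
  rw [Ac, Ac, W.periodic_A]

lemma differentiable_Bc (h0 : L.H0) (h1 : L.H1) (j k a b) :
    Differentiable ℝ (fun x => W.Bc j k x a b) := fun x =>
  (((W.contDiff_B h0 h1 j k a b).differentiable (by norm_num) x).hasDerivAt.ofReal_comp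
    ).differentiableAt

lemma differentiable_Ac (h0 : L.H0) (h1 : L.H1) (j a b) :
    Differentiable ℝ (fun x => W.Ac j x a b) := fun x =>
  (((W.contDiff_A h0 h1 j a b).differentiable (by norm_num) x).hasDerivAt.ofReal_comp
    ).differentiableAt

lemma Bc_inv_mul (h1 : L.H1) (x : ℝ) : (W.Bc 0 0 x)⁻¹ * W.Bc 0 0 x = 1 ∧
    W.Bc 0 0 x * (W.Bc 0 0 x)⁻¹ = 1 ∧
    (W.Bc 0 0 x)⁻¹ = ((L.B 0 0 (W.u x))⁻¹).map fun r : ℝ => (r : ℂ) := by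
  have hdet := isUnit_iff_ne_zero.2 (ConsLaw.det_B_ne_zero h1 (W.mem x))
  have h2 : W.Bc 0 0 x * ((L.B 0 0 (W.u x))⁻¹).map (fun r : ℝ => (r : ℂ)) = 1 := by
    have := congrArg (fun N => N.map Complex.ofRealHom) (Matrix.mul_nonsing_inv _ hdet)
    simp only [Matrix.map_mul] at this
    rw [Matrix.map_one _ (map_zero _) (map_one _)] at this
    exact this
  have h3 := Matrix.inv_eq_right_inv h2
  exact ⟨by rw [h3]; exact mul_eq_one_comm.1 h2, by rw [h3]; exact h2, h3⟩

lemma differentiable_Bc_inv (h0 : L.H0) (h1 : L.H1) (a b) :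
    Differentiable ℝ (fun x => (W.Bc 0 0 x)⁻¹ a b) := fun x => by
  have h2 : (fun x => (W.Bc 0 0 x)⁻¹ a b) = fun x => (((L.B 0 0 (W.u x))⁻¹ a b : ℝ) : ℂ) := by
    ext x; rw [(W.Bc_inv_mul h1 x).2.2]; rfl
  rw [h2]
  exact (((W.contDiff_B_inv h0 h1 a b).differentiable (by norm_num) x).hasDerivAt.ofReal_comp
    ).differentiableAt

variable (ξ : Fin (m + 1) → ℝ)

/-- `∑ₖ ξₖ B¹ᵏ`, summed over the transverse indices. -/
noncomputable def rowB (x : ℝ) : Matrix (Fin n) (Fin n) ℂ :=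
  ∑ k : Fin m, (ξ k.succ : ℂ) • W.Bc 0 k.succ x

/-- `∑ⱼ ξⱼ Bʲ¹`, summed over the transverse indices. -/
noncomputable def colB (x : ℝ) : Matrix (Fin n) (Fin n) ℂ :=
  ∑ j : Fin m, (ξ j.succ : ℂ) • W.Bc j.succ 0 x

/-- `∑ⱼ ξⱼ Aʲ`, summed over the transverse indices. -/
noncomputable def transA (x : ℝ) : Matrix (Fin n) (Fin n) ℂ :=
  ∑ j : Fin m, (ξ j.succ : ℂ) • W.Ac j.succ x

/-- `∑ⱼₖ ξⱼ ξₖ Bʲᵏ`, summed over the transverse indices. -/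
noncomputable def transB (x : ℝ) : Matrix (Fin n) (Fin n) ℂ :=
  ∑ j : Fin m, ∑ k : Fin m, ((ξ k.succ : ℂ) * (ξ j.succ : ℂ)) • W.Bc j.succ k.succ x

/-- `∑ⱼ ξⱼ (fʲ(ū) - Bʲ¹(ū) ū')`, summed over the transverse indices. -/
noncomputable def transFlux (x : ℝ) : Fin n → ℂ :=
  ∑ j : Fin m, (ξ j.succ : ℂ) • cplx n (W.flux j.succ x)

lemma differentiable_sum_smul_apply {ι : Type*} [Fintype ι] {c : ι → ℂ}
    {N : ι → ℝ → Matrix (Fin n) (Fin n) ℂ} {a b : Fin n}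
    (h : ∀ i, Differentiable ℝ fun x => N i x a b) :
    Differentiable ℝ (fun x => (∑ i, c i • N i x) a b) := by
  simp only [Matrix.sum_apply, Matrix.smul_apply, smul_eq_mul]
  exact Differentiable.fun_sum fun i _ => (h i).const_mul _

lemma differentiable_rowB (h0 : L.H0) (h1 : L.H1) (a b) :
    Differentiable ℝ (fun x => W.rowB ξ x a b) :=
  differentiable_sum_smul_apply fun _ => W.differentiable_Bc h0 h1 _ _ a b

lemma differentiable_colB (h0 : L.H0) (h1 : L.H1) (a b) :
    Differentiable ℝ (fun x => W.colB ξ x a b) :=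
  differentiable_sum_smul_apply fun _ => W.differentiable_Bc h0 h1 _ _ a b

lemma differentiable_transA (h0 : L.H0) (h1 : L.H1) (a b) :
    Differentiable ℝ (fun x => W.transA ξ x a b) :=
  differentiable_sum_smul_apply fun _ => W.differentiable_Ac h0 h1 _ a b

lemma differentiable_transB (h0 : L.H0) (h1 : L.H1) (a b) :
    Differentiable ℝ (fun x => W.transB ξ x a b) := by
  have : ∀ x, W.transB ξ x = ∑ j : Fin m, (1 : ℂ) • ∑ k : Fin m,
      ((ξ k.succ : ℂ) * (ξ j.succ : ℂ)) • W.Bc j.succ k.succ x := fun x => by simp [transB]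
  simp only [this]
  exact differentiable_sum_smul_apply fun _ =>
    differentiable_sum_smul_apply fun _ => W.differentiable_Bc h0 h1 _ _ a b

lemma hasDerivAt_cplx_u (x : ℝ) :
    HasDerivAt (fun x => cplx n (W.u x)) (cplx n (deriv W.u x)) x :=
  (W.differentiable x).hasDerivAt.cplx

lemma hasDerivAt_cplx_deriv_u (h0 : L.H0) (h1 : L.H1) (x : ℝ) :
    HasDerivAt (fun x => cplx n (deriv W.u x)) (cplx n (deriv (deriv W.u) x)) x :=
  ((W.contDiff_deriv_u h0 h1).differentiable (by norm_num) x).hasDerivAt.cplx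

lemma hasDerivAt_transFlux (h0 : L.H0) (h1 : L.H1) (x : ℝ) :
    HasDerivAt (W.transFlux ξ) (W.transA ξ x *ᵥ cplx n (deriv W.u x)
      - W.colB ξ x *ᵥ cplx n (deriv (deriv W.u) x)) x := by
  have h2 : HasDerivAt (W.transFlux ξ) (∑ j : Fin m, (ξ j.succ : ℂ) • cplx n _) x :=
    HasDerivAt.fun_sum fun j _ =>
      ((W.hasDerivAt_flux h0 h1 j.succ x).cplx).const_smul (ξ j.succ : ℂ)
  refine h2.congr_deriv ?_
  simp only [transA, colB, Matrix.sum_mulVec, Matrix.smul_mulVec, ← Finset.sum_sub_distrib,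
    ← smul_sub, map_sub, Ac, Bc, map_mulVec_cplx]

lemma periodic_transFlux : Function.Periodic (W.transFlux ξ) W.X := fun x => by
  simp only [transFlux, W.periodic_flux _ x]

lemma periodic_rowB : Function.Periodic (W.rowB ξ) W.X := fun x => by
  simp only [rowB, W.periodic_Bc _ _ x]

lemma periodic_colB : Function.Periodic (W.colB ξ) W.X := fun x => by
  simp only [colB, W.periodic_Bc _ _ x]

lemma periodic_transA : Function.Periodic (W.transA ξ) W.X := fun x => by
  simp only [transA, W.periodic_Ac _ x]

lemma periodic_transB : Function.Periodic (W.transB ξ) W.X := fun x => by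
  simp only [transB, W.periodic_Bc _ _ x]

/-! ### The regularized first-order system -/

/-- The derivative of the component `v` of the state `(c, q, v, y)`. -/
noncomputable def vField (ε lam : ℂ) (x : ℝ) (c : ℂ) (q v y : Fin n → ℂ) : Fin n → ℂ :=
  (W.Bc 0 0 x)⁻¹ *ᵥ (W.Ac 0 x *ᵥ v + c • (Complex.I • W.transFlux ξ x + lam • cplx n (W.u x)
    - Complex.I • (W.rowB ξ x *ᵥ cplx n (deriv W.u x))) - q
    + ε • (y - Complex.I • (W.rowB ξ x *ᵥ v)))

/-- The derivative of the component `y` of the state `(c, q, v, y)`. -/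
noncomputable def yField (ε lam : ℂ) (x : ℝ) (c : ℂ) (q v y : Fin n → ℂ) : Fin n → ℂ :=
  c • (W.transB ξ x *ᵥ cplx n (deriv W.u x)) + Complex.I • (W.transA ξ x *ᵥ v)
    - Complex.I • (W.colB ξ x *ᵥ W.vField ξ ε lam x c q v y) + ε • (W.transB ξ x *ᵥ v) + lam • v

/-- States `(c, q, v, y)`: the function `w = (c / ε) ū' + v` solves the eigenvalue equation with
frequencies `ε ξ`, `ε λ`, and its flux is `c (i ∑ⱼ ξⱼ gʲ + λ ū) - q + ε y`. -/
abbrev EigState (n : ℕ) : Type := ℂ × (Fin n → ℂ) × (Fin n → ℂ) × (Fin n → ℂ)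

/-- The coefficients of the first-order system for the state `(c, q, v, y)`. -/
noncomputable def sysMap (ε lam : ℂ) (x : ℝ) : EigState n →L[ℂ] EigState n :=
  LinearMap.toContinuousLinearMap
    { toFun := fun Y => (0, 0, W.vField ξ ε lam x Y.1 Y.2.1 Y.2.2.1 Y.2.2.2,
        W.yField ξ ε lam x Y.1 Y.2.1 Y.2.2.1 Y.2.2.2)
      map_add' := by
        rintro ⟨c, q, v, y⟩ ⟨c', q', v', y'⟩
        simp only [Prod.mk_add_mk, vField, yField, Matrix.mulVec_add, Matrix.mulVec_sub,
          Matrix.mulVec_smul, Prod.mk.injEq, add_zero, true_and]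
        constructor <;> module
      map_smul' := by
        rintro r ⟨c, q, v, y⟩
        simp only [Prod.smul_mk, vField, yField, Matrix.mulVec_add, Matrix.mulVec_sub,
          Matrix.mulVec_smul, Prod.mk.injEq, smul_zero, mul_zero, true_and, smul_eq_mul, RingHom.id_apply]
        constructor <;> module }

lemma sysMap_apply (ε lam : ℂ) (x : ℝ) (Y : EigState n) : W.sysMap ξ ε lam x Y =
    (0, 0, W.vField ξ ε lam x Y.1 Y.2.1 Y.2.2.1 Y.2.2.2,
        W.yField ξ ε lam x Y.1 Y.2.1 Y.2.2.1 Y.2.2.2) := rfl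

/-- There is no mixed term `ε λ` and no power of `1 / ε`: the coefficients extend regularly to `ε =
0`, and `exists_evolution_affine` applies. -/
lemma sysMap_affine (ε lam : ℂ) (x : ℝ) : W.sysMap ξ ε lam x = W.sysMap ξ 0 0 x +
    ε • (W.sysMap ξ 1 0 x - W.sysMap ξ 0 0 x) + lam • (W.sysMap ξ 0 1 x - W.sysMap ξ 0 0 x) := by
  refine ContinuousLinearMap.ext fun Y => ?_
  obtain ⟨c, q, v, y⟩ := Y
  simp only [_root_.add_apply, _root_.smul_apply,
    _root_.sub_apply, sysMap_apply, vField, yField, Matrix.mulVec_add,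
    Matrix.mulVec_sub, Matrix.mulVec_smul, Prod.mk_add_mk, Prod.smul_mk, Prod.mk_sub_mk,
    Prod.mk.injEq, smul_zero, add_zero, sub_zero, true_and]
  constructor <;> module

lemma periodic_sysMap (ε lam : ℂ) : Function.Periodic (W.sysMap ξ ε lam) W.X := fun x => by
  refine ContinuousLinearMap.ext fun Y => ?_
  simp only [sysMap_apply, vField, yField, W.periodic_Bc 0 0 x, W.periodic_Ac 0 x,
    W.periodic_transFlux ξ x, W.periodic x, W.periodic_rowB ξ x, W.periodic_deriv_u x,
    W.periodic_transA ξ x, W.periodic_colB ξ x, W.periodic_transB ξ x]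

lemma differentiable_vField (h0 : L.H0) (h1 : L.H1) (ε lam c : ℂ) (q : Fin n → ℂ)
    {v y : ℝ → Fin n → ℂ} (hv : Differentiable ℝ v) (hy : Differentiable ℝ y) :
    Differentiable ℝ (fun x => W.vField ξ ε lam x c q (v x) (y x)) := by
  have hg : Differentiable ℝ (W.transFlux ξ) := fun x =>
    (W.hasDerivAt_transFlux ξ h0 h1 x).differentiableAt
  have hu : Differentiable ℝ (fun x => cplx n (W.u x)) := fun x =>
    (W.hasDerivAt_cplx_u x).differentiableAt
  have hdu : Differentiable ℝ (fun x => cplx n (deriv W.u x)) := fun x =>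
    (W.hasDerivAt_cplx_deriv_u h0 h1 x).differentiableAt
  have hB := W.differentiable_rowB ξ h0 h1
  exact differentiable_mulVec (W.differentiable_Bc_inv h0 h1)
    ((((differentiable_mulVec (W.differentiable_Ac h0 h1 0) hv).add
      (((((hg.const_smul Complex.I).add (hu.const_smul lam)).sub
        ((differentiable_mulVec hB hdu).const_smul Complex.I))).const_smul c)).sub_const q).add
      ((hy.sub ((differentiable_mulVec hB hv).const_smul Complex.I)).const_smul ε))

lemma differentiable_yField (h0 : L.H0) (h1 : L.H1) (ε lam c : ℂ) (q : Fin n → ℂ)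
    {v y : ℝ → Fin n → ℂ} (hv : Differentiable ℝ v) (hy : Differentiable ℝ y) :
    Differentiable ℝ (fun x => W.yField ξ ε lam x c q (v x) (y x)) := by
  have hdu : Differentiable ℝ (fun x => cplx n (deriv W.u x)) := fun x =>
    (W.hasDerivAt_cplx_deriv_u h0 h1 x).differentiableAt
  have hB := W.differentiable_transB ξ h0 h1
  exact (((((differentiable_mulVec hB hdu).const_smul c).add
    ((differentiable_mulVec (W.differentiable_transA ξ h0 h1) hv).const_smul Complex.I)).sub
    ((differentiable_mulVec (W.differentiable_colB ξ h0 h1)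
      (W.differentiable_vField ξ h0 h1 ε lam c q hv hy)).const_smul Complex.I)).add
    ((differentiable_mulVec hB hv).const_smul ε)).add (hv.const_smul lam)

lemma continuous_sysMap (h0 : L.H0) (h1 : L.H1) (ε lam : ℂ) :
    Continuous (W.sysMap ξ ε lam) := by
  refine continuous_clm_apply.2 fun Y => ?_
  simp only [sysMap_apply]
  exact continuous_const.prodMk (continuous_const.prodMk
    ((W.differentiable_vField ξ h0 h1 ε lam _ _ (differentiable_const _)
      (differentiable_const _)).continuous.prodMk (W.differentiable_yField ξ h0 h1 ε lam _ _
      (differentiable_const _) (differentiable_const _)).continuous))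

lemma exists_norm_sysMap_le (h0 : L.H0) (h1 : L.H1) (ε lam : ℂ) :
    ∃ C : ℝ, ∀ x, ‖W.sysMap ξ ε lam x‖ ≤ C := by
  have := Function.Periodic.isBounded_of_continuous (W.periodic_sysMap ξ ε lam) W.X_pos.ne'
    (W.continuous_sysMap ξ h0 h1 ε lam)
  obtain ⟨C, hC⟩ := this.exists_norm_le
  exact ⟨C, fun x => hC _ ⟨x, rfl⟩⟩

lemma sys_unique (h0 : L.H0) (h1 : L.H1) (ε lam : ℂ) {Y₁ Y₂ : ℝ → EigState n}
    (hY₁ : ∀ t, HasDerivAt Y₁ (W.sysMap ξ ε lam t (Y₁ t)) t)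
    (hY₂ : ∀ t, HasDerivAt Y₂ (W.sysMap ξ ε lam t (Y₂ t)) t) (h : Y₁ 0 = Y₂ 0) : Y₁ = Y₂ := by
  obtain ⟨C, hC⟩ := W.exists_norm_sysMap_le ξ h0 h1 ε lam
  have hC0 : 0 ≤ C := (norm_nonneg _).trans (hC 0)
  refine ODE_solution_unique_univ (v := fun t Y => W.sysMap ξ ε lam t Y) (s := fun _ => univ)
    (K := ⟨C, hC0⟩) (t₀ := 0) (fun t => ?_) (fun t => ⟨hY₁ t, trivial⟩) (fun t => ⟨hY₂ t, trivial⟩) h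
  exact ((W.sysMap ξ ε lam t).lipschitz.weaken (hC t)).lipschitzOnWith

/-- The evolution operator of the first-order system depends holomorphically on `(ε, λ)`. -/
theorem exists_evolution (h0 : L.H0) (h1 : L.H1) (R : ℝ) (hR : 0 < R) :
    ∃ Ψ : ℂ → ℂ → ℝ → (EigState n →L[ℂ] EigState n),
      (∀ ε lam, ‖ε‖ < R → ‖lam‖ < R → ∀ Y₀, Ψ ε lam 0 Y₀ = Y₀ ∧
        ∀ t, HasDerivAt (fun t => Ψ ε lam t Y₀) (W.sysMap ξ ε lam t (Ψ ε lam t Y₀)) t) ∧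
      ∀ t, DifferentiableOn ℂ (fun p : ℂ × ℂ => Ψ p.1 p.2 t)
        (Metric.ball 0 R ×ˢ Metric.ball 0 R) := by
  have hex : ∀ ε lam, ∃ A : BoundedContinuousFunction ℝ (EigState n →L[ℂ] EigState n),
      ∀ x, A x = W.sysMap ξ ε lam x := fun ε lam => by
    obtain ⟨C, hC⟩ := W.exists_norm_sysMap_le ξ h0 h1 ε lam
    exact ⟨.ofNormedAddCommGroup _ (W.continuous_sysMap ξ h0 h1 ε lam) C hC, fun x => rfl⟩
  obtain ⟨A₀, hA₀⟩ := hex 0 0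
  obtain ⟨A₁, hA₁⟩ := hex 1 0
  obtain ⟨A₂, hA₂⟩ := hex 0 1
  obtain ⟨Ψ, hΨ, hΨd⟩ := exists_evolution_affine hR A₀ (A₁ - A₀) (A₂ - A₀)
  refine ⟨Ψ, fun ε lam hε hlam Y₀ => ⟨(hΨ ε lam hε hlam Y₀).1, fun t => ?_⟩, hΨd⟩
  have := (hΨ ε lam hε hlam Y₀).2 t
  rw [sysMap_affine, ← hA₀, ← hA₁, ← hA₂]
  exact this

end PeriodicWave

end

/-! ### From the regularized system to zeros of the Evans function. -/

section

open Set Filter Topology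

namespace PeriodicWave

variable {n m : ℕ} {L : ConsLaw n m} (W : PeriodicWave L) (ξ : Fin (m + 1) → ℝ)

/-- The pair `(v, y)` solves the regularized first-order system with the constants `(c, q)`. -/
def IsEigPair (ε lam c : ℂ) (q : Fin n → ℂ) (v y : ℝ → Fin n → ℂ) : Prop :=
  ∀ t, HasDerivAt v (W.vField ξ ε lam t c q (v t) (y t)) t ∧
    HasDerivAt y (W.yField ξ ε lam t c q (v t) (y t)) t

variable {W ξ}

lemma IsEigPair.hasDerivAt {ε lam c : ℂ} {q : Fin n → ℂ} {v y : ℝ → Fin n → ℂ}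
    (h : W.IsEigPair ξ ε lam c q v y) (t : ℝ) :
    HasDerivAt (fun t => ((c, q, v t, y t) : EigState n))
      (W.sysMap ξ ε lam t (c, q, v t, y t)) t :=
  (hasDerivAt_const t c).prodMk ((hasDerivAt_const t q).prodMk ((h t).1.prodMk (h t).2))

lemma isEigPair_of_hasDerivAt {ε lam : ℂ} {Y : ℝ → EigState n}
    (h : ∀ t, HasDerivAt Y (W.sysMap ξ ε lam t (Y t)) t) :
    W.IsEigPair ξ ε lam (Y 0).1 (Y 0).2.1 (fun t => (Y t).2.2.1) (fun t => (Y t).2.2.2) := by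
  have hc : ∀ t, (Y t).1 = (Y 0).1 := fun t =>
    is_const_of_deriv_eq_zero (𝕜 := ℝ) (f := fun t => (Y t).1)
      (fun t => (h t).prod_fst.differentiableAt) (fun t => (h t).prod_fst.deriv) t 0
  have hq : ∀ t, (Y t).2.1 = (Y 0).2.1 := fun t =>
    is_const_of_deriv_eq_zero (𝕜 := ℝ) (f := fun t => (Y t).2.1)
      (fun t => (h t).prod_snd.prod_fst.differentiableAt)
      (fun t => (h t).prod_snd.prod_fst.deriv) t 0
  intro t
  have h1 := (h t).prod_snd.prod_snd.prod_fst
  have h2 := (h t).prod_snd.prod_snd.prod_snd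
  rw [← hc t, ← hq t]
  exact ⟨h1, h2⟩

variable (W ξ)

/-- The flux `B¹¹ w' - A¹ w + i ∑ₖ ξₖ B¹ᵏ w`. -/
noncomputable def kerFlux (w : ℝ → Fin n → ℂ) (t : ℝ) : Fin n → ℂ :=
  W.Bc 0 0 t *ᵥ deriv w t - W.Ac 0 t *ᵥ w t + Complex.I • (W.rowB ξ t *ᵥ w t)

variable {W ξ}

/-- The second-order equation in divergence form: collect the terms under the derivative into the
flux and move the rest to the right. -/
lemma hasDerivAt_kerFlux_iff (h0 : L.H0) (h1 : L.H1) {lam : ℂ} {w : ℝ → Fin n → ℂ}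
    (hw : Differentiable ℝ w) (hdw : Differentiable ℝ (deriv w)) :
    W.IsKernelSol ξ lam w ↔ ∀ x, HasDerivAt (W.kerFlux ξ w)
      (W.transB ξ x *ᵥ w x + Complex.I • (W.transA ξ x *ᵥ w x)
        - Complex.I • (W.colB ξ x *ᵥ deriv w x) + lam • w x) x := by
  have e1 := differentiable_mulVec (W.differentiable_Bc h0 h1 0 0) hdw
  have e2 := differentiable_mulVec (W.differentiable_Ac h0 h1 0) hw
  have e3 := differentiable_mulVec (W.differentiable_rowB ξ h0 h1) hw
  have key : ∀ x, HasDerivAt (W.kerFlux ξ w) (deriv (fun t => W.Bc 0 0 t *ᵥ deriv w t) x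
      - deriv (fun t => W.Ac 0 t *ᵥ w t) x
      + Complex.I • deriv (fun t => W.rowB ξ t *ᵥ w t) x) x := fun x =>
    ((e1 x).hasDerivAt.sub (e2 x).hasDerivAt).add ((e3 x).hasDerivAt.const_smul Complex.I)
  have h3 : ∀ x, ∀ D : Fin n → ℂ, HasDerivAt (W.kerFlux ξ w) D x ↔
      deriv (fun t => W.Bc 0 0 t *ᵥ deriv w t) x - deriv (fun t => W.Ac 0 t *ᵥ w t) x
      + Complex.I • deriv (fun t => W.rowB ξ t *ᵥ w t) x = D := fun x D =>
    ⟨fun h => (key x).unique h, fun h => h ▸ key x⟩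
  simp only [h3]
  have hr : (fun t => ∑ k : Fin m, (ξ k.succ : ℂ) • (W.Bc 0 k.succ t *ᵥ w t))
      = fun t => W.rowB ξ t *ᵥ w t := by
    ext1 t; simp only [rowB, Matrix.sum_mulVec, Matrix.smul_mulVec]
  simp only [IsKernelSol, hw, hdw, true_and, hr]
  refine forall_congr' fun x => ?_
  simp only [transA, transB, colB, Matrix.sum_mulVec, Matrix.smul_mulVec]
  rw [← sub_eq_zero (b := _ + lam • w x)]
  refine Eq.congr ?_ rfl
  module

lemma deriv_eq_of_kerFlux (h1 : L.H1) (w : ℝ → Fin n → ℂ) (t : ℝ) :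
    deriv w t = (W.Bc 0 0 t)⁻¹ *ᵥ
      (W.kerFlux ξ w t + W.Ac 0 t *ᵥ w t - Complex.I • (W.rowB ξ t *ᵥ w t)) := by
  have : W.kerFlux ξ w t + W.Ac 0 t *ᵥ w t - Complex.I • (W.rowB ξ t *ᵥ w t)
      = W.Bc 0 0 t *ᵥ deriv w t := by rw [kerFlux]; abel
  rw [this, Matrix.mulVec_mulVec, (W.Bc_inv_mul h1 t).1, Matrix.one_mulVec]

/-- The unscaled equation is the regularized system with `ε = 1` and `c = 0`, so uniqueness for the
system transfers to the eigenvalue equation. -/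
lemma IsKernelSol.isEigPair (h0 : L.H0) (h1 : L.H1) {lam : ℂ} {w : ℝ → Fin n → ℂ}
    (hw : W.IsKernelSol ξ lam w) : W.IsEigPair ξ 1 lam 0 (-W.kerFlux ξ w 0) w
      (fun t => W.kerFlux ξ w t - W.kerFlux ξ w 0) := by
  have hv : ∀ t, W.vField ξ 1 lam t 0 (-W.kerFlux ξ w 0) (w t)
      (W.kerFlux ξ w t - W.kerFlux ξ w 0) = deriv w t := fun t => by
    rw [deriv_eq_of_kerFlux (ξ := ξ) h1 w t, vField]
    congr 1
    module
  intro t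
  refine ⟨by rw [hv]; exact (hw.1 t).hasDerivAt, ?_⟩
  rw [yField, hv]
  refine (((hasDerivAt_kerFlux_iff h0 h1 hw.1 hw.2.1).1 hw t).sub_const _).congr_deriv ?_
  module

lemma rowB_smul (e x : ℝ) : W.rowB (e • ξ) x = (e : ℂ) • W.rowB ξ x := by
  simp only [rowB, Finset.smul_sum, smul_smul, Pi.smul_apply, smul_eq_mul, Complex.ofReal_mul]

lemma colB_smul (e x : ℝ) : W.colB (e • ξ) x = (e : ℂ) • W.colB ξ x := by
  simp only [colB, Finset.smul_sum, smul_smul, Pi.smul_apply, smul_eq_mul, Complex.ofReal_mul]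

lemma transA_smul (e x : ℝ) : W.transA (e • ξ) x = (e : ℂ) • W.transA ξ x := by
  simp only [transA, Finset.smul_sum, smul_smul, Pi.smul_apply, smul_eq_mul, Complex.ofReal_mul]

lemma transB_smul (e x : ℝ) : W.transB (e • ξ) x = ((e : ℂ) * e) • W.transB ξ x := by
  simp only [transB, Finset.smul_sum, smul_smul, Pi.smul_apply, smul_eq_mul, Complex.ofReal_mul]
  refine Finset.sum_congr rfl fun j _ => Finset.sum_congr rfl fun k _ => ?_
  congr 1
  ring

lemma mulVec_vField (h1 : L.H1) (ε lam c : ℂ) (q v y : Fin n → ℂ) (x : ℝ) :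
    W.Bc 0 0 x *ᵥ W.vField ξ ε lam x c q v y = W.Ac 0 x *ᵥ v +
      c • (Complex.I • W.transFlux ξ x + lam • cplx n (W.u x)
        - Complex.I • (W.rowB ξ x *ᵥ cplx n (deriv W.u x))) - q
      + ε • (y - Complex.I • (W.rowB ξ x *ᵥ v)) := by
  rw [vField, Matrix.mulVec_mulVec, (W.Bc_inv_mul h1 x).2.1, Matrix.one_mulVec]

lemma Ac_mulVec_deriv_u (h0 : L.H0) (h1 : L.H1) (x : ℝ) :
    W.Ac 0 x *ᵥ cplx n (deriv W.u x) = W.Bc 0 0 x *ᵥ cplx n (deriv (deriv W.u) x) := by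
  rw [Ac, Bc, map_mulVec_cplx, map_mulVec_cplx, W.A_zero_mulVec_deriv_u h0 h1]

/-- The part `(c / e) ū'` contributes nothing of order `1 / e` to the flux because `A¹ū' = B¹¹ū''`.
Its contribution of order one to the derivative of the flux is that of `c (i ∑ⱼ ξⱼ gʲ + λ ū)`, by
`hasDerivAt_transFlux`. Everything else carries a factor `e` and is accounted for by `y`. -/
lemma IsEigPair.isKernelSol (h0 : L.H0) (h1 : L.H1) {e : ℝ} (he : e ≠ 0) {lam c : ℂ}
    {q : Fin n → ℂ} {v y : ℝ → Fin n → ℂ} (h : W.IsEigPair ξ e lam c q v y) :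
    W.IsKernelSol (e • ξ) (e * lam) (fun t => (c / e) • cplx n (deriv W.u t) + v t) ∧
    ∀ t, W.kerFlux (e • ξ) (fun t => (c / e) • cplx n (deriv W.u t) + v t) t =
      c • (Complex.I • W.transFlux ξ t + lam • cplx n (W.u t)) - q + (e : ℂ) • y t := by
  have he' : (e : ℂ) ≠ 0 := by exact_mod_cast he
  set w : ℝ → Fin n → ℂ := fun t => (c / e) • cplx n (deriv W.u t) + v t with hw
  have hwd : ∀ t, HasDerivAt w ((c / e) • cplx n (deriv (deriv W.u) t)
      + W.vField ξ e lam t c q (v t) (y t)) t := fun t =>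
    ((W.hasDerivAt_cplx_deriv_u h0 h1 t).const_smul (c / e : ℂ)).add (h t).1
  have hdw : deriv w = fun t => (c / e) • cplx n (deriv (deriv W.u) t)
      + W.vField ξ e lam t c q (v t) (y t) := funext fun t => (hwd t).deriv
  have hc : c = (c / e) * e := by field_simp
  have hflux : ∀ t, W.kerFlux (e • ξ) w t =
      c • (Complex.I • W.transFlux ξ t + lam • cplx n (W.u t)) - q + (e : ℂ) • y t := by
    intro t
    rw [kerFlux, hdw]
    simp only [hw, Matrix.mulVec_add, Matrix.mulVec_smul, mulVec_vField h1, rowB_smul,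
      Ac_mulVec_deriv_u h0 h1, Matrix.smul_mulVec]
    generalize (c / e : ℂ) = d at hc
    subst hc
    module
  refine ⟨?_, hflux⟩
  have hvd : Differentiable ℝ v := fun t => (h t).1.differentiableAt
  have hyd : Differentiable ℝ y := fun t => (h t).2.differentiableAt
  have hu3 : Differentiable ℝ fun t => cplx n (deriv (deriv W.u) t) := fun t =>
    (((W.contDiff_deriv_u h0 h1).differentiable_deriv_two t).hasDerivAt.cplx).differentiableAt
  have hdw2 : Differentiable ℝ (deriv w) := by
    rw [hdw]
    exact (hu3.const_smul (c / e : ℂ)).add (W.differentiable_vField ξ h0 h1 _ _ _ _ hvd hyd)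
  refine (hasDerivAt_kerFlux_iff h0 h1 (fun t => (hwd t).differentiableAt) hdw2).2 fun x => ?_
  rw [funext hflux]
  have e1 := (W.hasDerivAt_transFlux ξ h0 h1 x).const_smul Complex.I
  have e2 := (W.hasDerivAt_cplx_u x).const_smul lam
  have e3 := (h x).2.const_smul (e : ℂ)
  have h4 := (((e1.fun_add e2).fun_const_smul c).sub_const q).fun_add e3
  refine h4.congr_deriv ?_
  rw [hdw]
  simp only [hw, yField, Matrix.mulVec_add, Matrix.mulVec_smul, colB_smul, transA_smul,
    transB_smul, Matrix.smul_mulVec]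
  generalize (c / e : ℂ) = d at hc
  subst hc
  module

lemma IsKernelSol.ext (h0 : L.H0) (h1 : L.H1) {lam : ℂ} {w₁ w₂ : ℝ → Fin n → ℂ}
    (hw₁ : W.IsKernelSol ξ lam w₁) (hw₂ : W.IsKernelSol ξ lam w₂) (h : w₁ 0 = w₂ 0)
    (h' : deriv w₁ 0 = deriv w₂ 0) : w₁ = w₂ := by
  have hz : W.kerFlux ξ w₁ 0 = W.kerFlux ξ w₂ 0 := by simp only [kerFlux, h, h']
  have := W.sys_unique ξ h0 h1 1 lam (hw₁.isEigPair h0 h1).hasDerivAt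
    (hw₂.isEigPair h0 h1).hasDerivAt (by simp [h, hz])
  funext t
  exact congrArg (fun Y : EigState n => Y.2.2.1) (congrFun this t)

lemma IsKernelSol.sum_smul (h0 : L.H0) (h1 : L.H1) {lam : ℂ} {ι : Type*} [Fintype ι]
    {w : ι → ℝ → Fin n → ℂ} (hw : ∀ i, W.IsKernelSol ξ lam (w i)) (c : ι → ℂ) :
    W.IsKernelSol ξ lam (fun t => ∑ i, c i • w i t) ∧
      ∀ t, deriv (fun t => ∑ i, c i • w i t) t = ∑ i, c i • deriv (w i) t := by
  have h2 : ∀ t, HasDerivAt (fun t => ∑ i, c i • w i t) (∑ i, c i • deriv (w i) t) t := fun t =>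
    HasDerivAt.fun_sum fun i _ => ((hw i).1 t).hasDerivAt.const_smul (c i)
  have h3 : deriv (fun t => ∑ i, c i • w i t) = fun t => ∑ i, c i • deriv (w i) t :=
    funext fun t => (h2 t).deriv
  have h4 : ∀ t, HasDerivAt (fun t => ∑ i, c i • deriv (w i) t)
      (∑ i, c i • deriv (deriv (w i)) t) t := fun t =>
    HasDerivAt.fun_sum fun i _ => ((hw i).2.1 t).hasDerivAt.const_smul (c i)
  refine ⟨?_, fun t => (h2 t).deriv⟩
  refine (hasDerivAt_kerFlux_iff h0 h1 (fun t => (h2 t).differentiableAt)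
    (by rw [h3]; exact fun t => (h4 t).differentiableAt)).2 fun x => ?_
  have h5 : W.kerFlux ξ (fun t => ∑ i, c i • w i t) = fun t => ∑ i, c i • W.kerFlux ξ (w i) t := by
    funext t
    simp only [kerFlux, h3, Matrix.mulVec_sum, Matrix.mulVec_smul, smul_add, smul_sub,
      Finset.sum_add_distrib, Finset.sum_sub_distrib, Finset.smul_sum, smul_comm Complex.I]
  rw [h5, h3]
  refine (HasDerivAt.fun_sum fun i _ =>
    ((hasDerivAt_kerFlux_iff h0 h1 (hw i).1 (hw i).2.1).1 (hw i) x).const_smul (c i)).congr_deriv ?_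
  simp only [Matrix.mulVec_sum, Matrix.mulVec_smul, smul_add, smul_sub,
      Finset.sum_add_distrib, Finset.sum_sub_distrib, Finset.smul_sum, smul_comm Complex.I,
      smul_comm lam]

lemma exists_isEigPair (h0 : L.H0) (h1 : L.H1) (ξ : Fin (m + 1) → ℝ) (ε lam c : ℂ)
    (q a b : Fin n → ℂ) : ∃ v y, W.IsEigPair ξ ε lam c q v y ∧ v 0 = a ∧ y 0 = b := by
  obtain ⟨Ψ, hΨ, -⟩ := W.exists_evolution ξ h0 h1 (‖ε‖ + ‖lam‖ + 1) (by positivity)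
  obtain ⟨h2, h3⟩ := hΨ ε lam (by linarith [norm_nonneg lam]) (by linarith [norm_nonneg ε])
    (c, q, a, b)
  have h4 := isEigPair_of_hasDerivAt h3
  rw [h2] at h4
  exact ⟨_, _, h4, by simp [h2], by simp [h2]⟩

lemma exists_isKernelSol (h0 : L.H0) (h1 : L.H1) (ξ : Fin (m + 1) → ℝ) (lam : ℂ)
    (α β : Fin n → ℂ) : ∃ w, W.IsKernelSol ξ lam w ∧ w 0 = α ∧ deriv w 0 = β := by
  -- With `c = 0` and `y(0) = 0` the constant `q` is minus the initial flux, so it is chosen to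
  -- produce `v'(0) = β`.
  obtain ⟨v, y, h, hv, hy⟩ := exists_isEigPair (W := W) h0 h1 ξ 1 lam 0
    (-(W.Bc 0 0 0 *ᵥ β - W.Ac 0 0 *ᵥ α + Complex.I • (W.rowB ξ 0 *ᵥ α))) α 0
  have h2 := (IsEigPair.isKernelSol (e := 1) h0 h1 one_ne_zero (by simpa using h)).1
  simp only [one_smul, Complex.ofReal_one, one_mul, zero_div, zero_smul, zero_add] at h2
  refine ⟨v, h2, hv, ?_⟩
  rw [(h 0).1.deriv, vField, hv, hy]
  trans (W.Bc 0 0 0)⁻¹ *ᵥ (W.Bc 0 0 0 *ᵥ β)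
  · congr 1
    module
  · rw [Matrix.mulVec_mulVec, (W.Bc_inv_mul h1 0).1, Matrix.one_mulVec]

lemma kernelSol_spec (h0 : L.H0) (h1 : L.H1) (ξ : Fin (m + 1) → ℝ) (lam : ℂ)
    (α β : Fin n → ℂ) : W.IsKernelSol ξ lam (W.kernelSol ξ lam α β) ∧
      W.kernelSol ξ lam α β 0 = α ∧ deriv (W.kernelSol ξ lam α β) 0 = β := by
  have h := exists_isKernelSol (W := W) h0 h1 ξ lam α β
  rw [kernelSol, dif_pos h]
  exact h.choose_spec

/-- A nonzero Floquet solution of the eigenvalue equation yields a zero of the Evans function. -/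
theorem evans_eq_zero (h0 : L.H0) (h1 : L.H1) {lam : ℂ} {w : ℝ → Fin n → ℂ}
    (hw : W.IsKernelSol ξ lam w) (hne : w ≠ 0)
    (hX : w W.X = Complex.exp (Complex.I * W.X * ξ 0) • w 0)
    (hX' : deriv w W.X = Complex.exp (Complex.I * W.X * ξ 0) • deriv w 0) :
    W.evans ξ lam = 0 := by
  -- Coordinates of `w` in the normalized basis, which is adapted to the initial value and to the
  -- quantity `A¹w - B¹¹w'`.
  set cf : Fin n ⊕ Fin n → ℂ := Sum.elim (w 0) (W.Ac 0 0 *ᵥ w 0 - W.Bc 0 0 0 *ᵥ deriv w 0)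
    with hcf
  have hbasis : ∀ l, W.IsKernelSol ξ lam (W.kernelBasis ξ lam l) := by
    rintro (l | l) <;> exact (kernelSol_spec h0 h1 ξ lam _ _).1
  have hsingle : ∀ z : Fin n → ℂ, ∑ j, z j • (Pi.single j 1 : Fin n → ℂ) = z := fun z => by
    ext i; simp [Finset.sum_apply, Pi.single_apply]
  obtain ⟨hs, hs'⟩ := IsKernelSol.sum_smul h0 h1 hbasis cf
  have hsum : w = fun t => ∑ l, cf l • W.kernelBasis ξ lam l t := by
    refine hw.ext h0 h1 hs ?_ ?_
    · simp only [Fintype.sum_sum_type, kernelBasis, (kernelSol_spec h0 h1 ξ lam _ _).2.1, hcf,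
        Sum.elim_inl, Sum.elim_inr, smul_zero, Finset.sum_const_zero, add_zero, hsingle]
    · rw [hs']
      simp only [Fintype.sum_sum_type, kernelBasis, (kernelSol_spec h0 h1 ξ lam _ _).2.2, hcf,
        Sum.elim_inl, Sum.elim_inr, smul_neg, ← Matrix.mulVec_smul, ← Matrix.mulVec_sum,
        Finset.sum_neg_distrib, hsingle]
      rw [← sub_eq_add_neg, ← Matrix.mulVec_sub, sub_sub_cancel, Matrix.mulVec_mulVec,
        (W.Bc_inv_mul h1 0).1, Matrix.one_mulVec]
  refine Matrix.exists_mulVec_eq_zero_iff.1 ⟨cf, fun hz => hne ?_, ?_⟩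
  · rw [hsum, hz]
    ext t; simp
  · have e1 : ∀ t, w t = ∑ l, cf l • W.kernelBasis ξ lam l t := fun t => congrFun hsum t
    have e2 : ∀ t, deriv w t = ∑ l, cf l • deriv (W.kernelBasis ξ lam l) t := fun t => by
      rw [← hs', ← hsum]
    ext (r | r)
    · have := congrFun hX r
      rw [e1, e1] at this
      simp only [Finset.sum_apply, Pi.smul_apply, smul_eq_mul] at this
      simp only [Matrix.mulVec, dotProduct, Matrix.of_apply, Sum.elim_inl, Pi.sub_apply,
        Pi.smul_apply, smul_eq_mul, sub_mul, Finset.sum_sub_distrib, Pi.zero_apply]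
      rw [sub_eq_zero]
      simpa only [Finset.mul_sum, mul_comm, mul_left_comm, mul_assoc] using this
    · have := congrFun hX' r
      rw [e2, e2] at this
      simp only [Finset.sum_apply, Pi.smul_apply, smul_eq_mul] at this
      simp only [Matrix.mulVec, dotProduct, Matrix.of_apply, Sum.elim_inr, Pi.sub_apply,
        Pi.smul_apply, smul_eq_mul, sub_mul, Finset.sum_sub_distrib, Pi.zero_apply]
      rw [sub_eq_zero]
      simpa only [Finset.mul_sum, mul_comm, mul_left_comm, mul_assoc] using this

/-- The two jump conditions are the Floquet conditions for `w` and for its flux, the latter divided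
by `e`; periodicity of `ū'` produces the quotient `(1 - e^{iXeξ₁}) / e`. As the coefficients are
periodic, the condition on the flux carries over to `w'`. -/
theorem IsEigPair.evans_eq_zero (h0 : L.H0) (h1 : L.H1) {e : ℝ} (he : e ≠ 0) {lam c : ℂ}
    {q : Fin n → ℂ} {v y : ℝ → Fin n → ℂ} (h : W.IsEigPair ξ e lam c q v y) (hy : y 0 = 0)
    (hdot : v 0 ⬝ᵥ cplx n (deriv W.u 0) = 0) (hne : ¬ (c = 0 ∧ v 0 = 0 ∧ q = 0))
    (hv : ((1 - Complex.exp (Complex.I * W.X * (e * ξ 0))) / e) • c • cplx n (deriv W.u 0)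
      + v W.X - Complex.exp (Complex.I * W.X * (e * ξ 0)) • v 0 = 0)
    (hyX : y W.X + ((1 - Complex.exp (Complex.I * W.X * (e * ξ 0))) / e) •
      (c • (Complex.I • W.transFlux ξ 0 + lam • cplx n (W.u 0)) - q) = 0) :
    W.evans (e • ξ) (e * lam) = 0 := by
  have he' : (e : ℂ) ≠ 0 := by exact_mod_cast he
  obtain ⟨hw, hflux⟩ := h.isKernelSol h0 h1 he
  set w : ℝ → Fin n → ℂ := fun t => (c / e) • cplx n (deriv W.u t) + v t with hwdef
  have hper : ∀ {E : Type} {f : ℝ → E}, Function.Periodic f W.X → f W.X = f 0 := fun hf => by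
    simpa using hf 0
  have hw0 : w 0 = (c / e) • cplx n (deriv W.u 0) + v 0 := rfl
  have hwX : w W.X = (c / e) • cplx n (deriv W.u 0) + v W.X := by
    rw [hwdef]; simp only [hper W.periodic_deriv_u]
  have hee : Complex.exp (Complex.I * W.X * ((e • ξ) 0 : ℝ)) =
      Complex.exp (Complex.I * W.X * (e * ξ 0)) := by simp
  have hX : w W.X = Complex.exp (Complex.I * W.X * ((e • ξ) 0 : ℝ)) • w 0 := by
    rw [hee, hwX, hw0, ← sub_eq_zero, ← hv]
    match_scalars <;> field_simp
  have hfX : W.kerFlux (e • ξ) w W.X =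
      Complex.exp (Complex.I * W.X * ((e • ξ) 0 : ℝ)) • W.kerFlux (e • ξ) w 0 := by
    rw [hee, hflux, hflux, hper (W.periodic_transFlux ξ), hper W.periodic, hy, ← sub_eq_zero]
    have := congrArg (fun z => (e : ℂ) • z) hyX
    simp only [smul_zero] at this
    refine Eq.trans ?_ this
    match_scalars <;> field_simp
    ring
  refine PeriodicWave.evans_eq_zero h0 h1 hw (fun hz => hne ?_) hX ?_
  · have hz0 : (c / e) • cplx n (deriv W.u 0) + v 0 = 0 := by rw [← hw0, hz]; rfl
    -- The product is bilinear, not Hermitian, but it is positive here because `ū'(0)` is real and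
    -- nonzero. Pairing `w(0) = 0` with `ū'(0)` then isolates `c`; the flux at `0` gives `q`.
    have hself : cplx n (deriv W.u 0) ⬝ᵥ cplx n (deriv W.u 0) ≠ 0 := by
      have : cplx n (deriv W.u 0) ⬝ᵥ cplx n (deriv W.u 0)
          = ((deriv W.u 0 ⬝ᵥ deriv W.u 0 : ℝ) : ℂ) := by simp [dotProduct]
      rw [this]
      exact_mod_cast fun h => W.deriv_u_zero_ne_zero h0 h1 (dotProduct_self_eq_zero.1 h)
    have hc : c = 0 := by
      have := congrArg (fun z => z ⬝ᵥ cplx n (deriv W.u 0)) hz0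
      simp only [add_dotProduct, smul_dotProduct, hdot, add_zero, zero_dotProduct, smul_eq_mul,
        mul_eq_zero, hself, or_false, div_eq_zero_iff, he'] at this
      exact this
    have hv0 : v 0 = 0 := by simpa [hc] using hz0
    refine ⟨hc, hv0, ?_⟩
    have h5 := hflux 0
    rw [hz, hy, hc] at h5
    have h6 : W.kerFlux (e • ξ) 0 0 = 0 := by
      have : deriv (0 : ℝ → Fin n → ℂ) 0 = 0 := by
        simp
      simp [kerFlux, this]
    rw [h6] at h5
    simpa using h5.symm
  · rw [deriv_eq_of_kerFlux (ξ := e • ξ) h1 w W.X, deriv_eq_of_kerFlux (ξ := e • ξ) h1 w 0, hfX, hX,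
      hper (W.periodic_Bc 0 0), hper (W.periodic_Ac 0), hper (W.periodic_rowB (e • ξ))]
    simp only [Matrix.mulVec_add, Matrix.mulVec_sub, Matrix.mulVec_smul]
    module

end PeriodicWave

end

/-! ### Determinants, spectra, and the regularized system at `ε = 0`. -/

section

open Set Filter Topology

lemma differentiableOn_linearMap_det {E F : Type*} [NormedAddCommGroup E] [NormedSpace ℂ E]
    [FiniteDimensional ℂ E] [NormedAddCommGroup F] [NormedSpace ℂ F] {s : Set F}
    {G : F → E →ₗ[ℂ] E} (h : ∀ Z, DifferentiableOn ℂ (fun p => G p Z) s) :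
    DifferentiableOn ℂ (fun p => LinearMap.det (G p)) s := by
  let b := Module.finBasis ℂ E
  have h2 : ∀ p, LinearMap.det (G p) = (LinearMap.toMatrix b b (G p)).det := fun p =>
    (LinearMap.det_toMatrix b _).symm
  simp only [h2, Matrix.det_apply]
  have h3 : ∀ i j, DifferentiableOn ℂ (fun p => LinearMap.toMatrix b b (G p) i j) s :=
    fun i j => by
    simp only [LinearMap.toMatrix_apply]
    exact (LinearMap.toContinuousLinearMap (b.coord i)).differentiable.comp_differentiableOn
      (h (b j))
  refine DifferentiableOn.fun_sum fun σ _ => DifferentiableOn.fun_const_smul ?_ _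
  have : ∀ t : Finset (Fin (Module.finrank ℂ E)), DifferentiableOn ℂ
      (fun p => ∏ i ∈ t, LinearMap.toMatrix b b (G p) (σ i) i) s := by
    classical
    intro t
    induction t using Finset.induction_on with
    | empty => simp
    | insert i t hi ih =>
      simp only [Finset.prod_insert hi]
      exact (h3 _ _).fun_mul ih
  exact this _

lemma mem_spectrum_iff_exists_mulVec {ι : Type*} [Fintype ι] [DecidableEq ι] (N : Matrix ι ι ℂ)
    (μ : ℂ) : μ ∈ spectrum ℂ N ↔ ∃ D ≠ 0, N *ᵥ D = μ • D := by
  rw [spectrum.mem_iff, Matrix.isUnit_iff_isUnit_det, isUnit_iff_ne_zero, not_not,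
    ← Matrix.exists_mulVec_eq_zero_iff]
  refine exists_congr fun D => and_congr_right fun _ => ?_
  rw [Matrix.sub_mulVec, sub_eq_zero, Algebra.algebraMap_eq_smul_one, Matrix.smul_mulVec,
    Matrix.one_mulVec, eq_comm]

lemma map_mulVec_add_I {ι : Type*} [Fintype ι] (N : Matrix ι ι ℝ) (x y : ι → ℝ) :
    (N.map fun r : ℝ => (r : ℂ)) *ᵥ (fun i => (x i : ℂ) + Complex.I * y i) =
      fun i => ((N *ᵥ x) i : ℂ) + Complex.I * (N *ᵥ y) i := by
  ext i
  simp [Matrix.mulVec, dotProduct, Finset.sum_add_distrib, mul_add, Finset.mul_sum, mul_left_comm]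

/-- The quotient `(1 - e^{κ ε}) / ε`, extended to `ε = 0`. -/
lemma exists_one_sub_exp_div (κ : ℂ) : ∃ φ : ℂ → ℂ, Differentiable ℂ φ ∧ φ 0 = -κ ∧
    ∀ ε ≠ 0, φ ε = (1 - Complex.exp (κ * ε)) / ε := by
  have hd : ∀ ε, HasDerivAt (fun ε => 1 - Complex.exp (κ * ε)) (-(Complex.exp (κ * ε) * κ)) ε :=
    fun ε => by
    simpa using (((hasDerivAt_id ε).const_mul κ).cexp).const_sub 1
  refine ⟨dslope (fun ε => 1 - Complex.exp (κ * ε)) 0, ?_, ?_, fun ε hε => ?_⟩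
  · rw [← differentiableOn_univ, Complex.differentiableOn_dslope univ_mem]
    exact fun ε _ => (hd ε).differentiableAt.differentiableWithinAt
  · rw [dslope_same, (hd 0).deriv]; simp
  · rw [dslope_of_ne _ hε, slope_def_field]; simp

namespace PeriodicWave

variable {n m : ℕ} {L : ConsLaw n m} {W : PeriodicWave L} {ξ : Fin (m + 1) → ℝ}

/-! ### Complex tangent vectors -/

/-- In the longitudinal direction the linearized profile equation removes `v` from the integrand,
leaving an explicit integral over the period. This is why `y` needs to record only the transverse
fluxes. -/
lemma IsVariation.F_zero_eq (h0 : L.H0) (h1 : L.H1) {h : WaveParam n m} {v vd Mh : ℝ → Fin n → ℝ}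
    {Fh : Fin (m + 1) → ℝ → Fin n → ℝ} (hV : W.IsVariation h v vd Mh Fh) :
    Fh 0 W.X = W.X • (-∑ j : Fin m, h.2.2.2.1 j • W.meanFlux j.succ + h.speed • W.meanU
      + h.const) := by
  have hd : ∀ x ∈ Icc 0 W.X, HasDerivWithinAt (Fh 0) (-∑ j : Fin m, h.2.2.2.1 j • W.flux j.succ x
      + h.speed • W.u x + h.const) (Icc 0 W.X) x := fun x hx => by
    refine (hV.hasDeriv_F 0 x hx).congr_deriv ?_
    rw [hV.profile x hx, varRhs]
    abel
  have hcF : ∀ j, Continuous (W.flux j) := W.continuous_flux h0 h1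
  have hcu : Continuous W.u := W.differentiable.continuous
  have hint : ∀ {g : ℝ → Fin n → ℝ}, Continuous g →
      IntervalIntegrable g MeasureTheory.volume 0 W.X := fun hg => hg.intervalIntegrable _ _
  have h2 := intervalIntegral.integral_eq_sub_of_hasDeriv_right_of_le W.X_pos.le
    (fun x hx => (hd x hx).continuousWithinAt)
    (fun x hx => (hd x (Ioo_subset_Icc_self hx)).mono_of_mem_nhdsWithin
      (Icc_mem_nhdsGT_of_mem (Ioo_subset_Ico_self hx)))
    (hint (by fun_prop))
  rw [hV.F_zero, sub_zero] at h2
  rw [← h2, intervalIntegral.integral_add (hint (by fun_prop)) (hint (by fun_prop)),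
    intervalIntegral.integral_add (hint (by fun_prop)) (hint (by fun_prop)),
    intervalIntegral.integral_neg, intervalIntegral.integral_finsetSum
      (fun j _ => hint (by fun_prop)), intervalIntegral.integral_smul,
    intervalIntegral.integral_const]
  simp only [intervalIntegral.integral_smul, meanU, meanFlux, sub_zero]
  have hX := W.X_pos.ne'
  simp only [smul_add, smul_neg, Finset.smul_sum, smul_smul, smul_comm _ W.X⁻¹]
  simp [hX]

lemma sum_smul_add_I_smul {δ₁ δ₂ : Fin m → ℝ} {c : ℂ}
    (hδ : ∀ j, (δ₁ j : ℂ) + Complex.I * δ₂ j = Complex.I * c * ξ j.succ) (x : Fin m → Fin n → ℂ) :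
    ∑ j, (δ₁ j : ℂ) • x j + Complex.I • ∑ j, (δ₂ j : ℂ) • x j
      = (Complex.I * c) • ∑ j, (ξ j.succ : ℂ) • x j := by
  simp only [Finset.smul_sum, ← Finset.sum_add_distrib, smul_smul, ← add_smul, hδ]

/-- At `ε = 0` the equation for `v` is the linearized profile equation with complex parameters, and
that for `y` is the matching combination of the linearized integrands. The tangent space is real, so
the complex variation appears as `p₁ + i p₂`; uniqueness over one period identifies both sides. -/
theorem IsEigPair.eq_variation (h0 : L.H0) (h1 : L.H1) {p₁ p₂ : WaveParam n m}
    {v₁ v₂ vd₁ vd₂ M₁ M₂ : ℝ → Fin n → ℝ} {F₁ F₂ : Fin (m + 1) → ℝ → Fin n → ℝ}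
    (V₁ : W.IsVariation p₁ v₁ vd₁ M₁ F₁) (V₂ : W.IsVariation p₂ v₂ vd₂ M₂ F₂)
    {lam c : ℂ} {q : Fin n → ℂ} {v y : ℝ → Fin n → ℂ} (hp : W.IsEigPair ξ 0 lam c q v y)
    (hδ : ∀ j, (p₁.2.2.2.1 j : ℂ) + Complex.I * p₂.2.2.2.1 j = Complex.I * c * ξ j.succ)
    (hs : (p₁.speed : ℂ) + Complex.I * p₂.speed = -(lam * c))
    (hq : cplx n p₁.const + Complex.I • cplx n p₂.const = q)
    (hv : cplx n p₁.init + Complex.I • cplx n p₂.init = v 0) (hy : y 0 = 0) :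
    v W.X = cplx n (v₁ W.X) + Complex.I • cplx n (v₂ W.X) ∧
    y W.X = lam • (cplx n (M₁ W.X) + Complex.I • cplx n (M₂ W.X)) + Complex.I • ∑ j : Fin m,
      (ξ j.succ : ℂ) • (cplx n (F₁ j.succ W.X) + Complex.I • cplx n (F₂ j.succ W.X)) := by
  set vc : ℝ → Fin n → ℂ := fun x => cplx n (v₁ x) + Complex.I • cplx n (v₂ x) with hvc
  set vdc : ℝ → Fin n → ℂ := fun x => cplx n (vd₁ x) + Complex.I • cplx n (vd₂ x) with hvdc
  set yc : ℝ → Fin n → ℂ := fun x => lam • (cplx n (M₁ x) + Complex.I • cplx n (M₂ x))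
    + Complex.I • ∑ j : Fin m,
      (ξ j.succ : ℂ) • (cplx n (F₁ j.succ x) + Complex.I • cplx n (F₂ j.succ x)) with hyc
  have hvar : ∀ (p : WaveParam n m) (x : ℝ) (w : Fin n → ℝ), cplx n (W.varRhs p x w) =
      W.Ac 0 x *ᵥ cplx n w
      - ∑ k : Fin m, (p.2.2.2.1 k : ℂ) • (W.Bc 0 k.succ x *ᵥ cplx n (deriv W.u x))
      + ∑ j : Fin m, (p.2.2.2.1 j : ℂ) • cplx n (W.flux j.succ x)
      - (p.speed : ℂ) • cplx n (W.u x) - cplx n p.const := fun p x w => by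
    simp only [varRhs, map_sub, map_add, map_sum, cplx_smul, Ac, Bc, map_mulVec_cplx]
  have hvd : ∀ x ∈ Icc 0 W.X, vdc x = W.vField ξ 0 lam x c q (vc x) (yc x) := fun x hx => by
    have h2 : W.Bc 0 0 x *ᵥ vdc x =
        W.Ac 0 x *ᵥ vc x + c • (Complex.I • W.transFlux ξ x + lam • cplx n (W.u x)
        - Complex.I • (W.rowB ξ x *ᵥ cplx n (deriv W.u x))) - q
        + (0 : ℂ) • (yc x - Complex.I • (W.rowB ξ x *ᵥ vc x)) := by
      have e1 := V₁.profile x hx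
      have e2 := V₂.profile x hx
      have e3 := sum_smul_add_I_smul hδ fun k => W.Bc 0 k.succ x *ᵥ cplx n (deriv W.u x)
      have e4 := sum_smul_add_I_smul hδ fun k => cplx n (W.flux k.succ x)
      have e5 : W.rowB ξ x *ᵥ cplx n (deriv W.u x) =
          ∑ k : Fin m, (ξ k.succ : ℂ) • (W.Bc 0 k.succ x *ᵥ cplx n (deriv W.u x)) := by
        simp only [rowB, Matrix.sum_mulVec, Matrix.smul_mulVec]
      have e6 : W.Bc 0 0 x *ᵥ vdc x = cplx n (W.varRhs p₁ x (v₁ x))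
          + Complex.I • cplx n (W.varRhs p₂ x (v₂ x)) := by
        rw [← e1, ← e2, hvdc, Matrix.mulVec_add, Matrix.mulVec_smul, Bc, map_mulVec_cplx,
          map_mulVec_cplx]
      rw [e6, hvar, hvar, e5, transFlux, ← hq, hvc, Matrix.mulVec_add, Matrix.mulVec_smul]
      linear_combination (norm := module) -e3 + e4 - hs • cplx n (W.u x)
    rw [vField, ← h2, Matrix.mulVec_mulVec, (W.Bc_inv_mul h1 x).1, Matrix.one_mulVec]
  have hvder : ∀ x ∈ Icc 0 W.X, HasDerivWithinAt vc (W.vField ξ 0 lam x c q (vc x) (yc x))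
      (Icc 0 W.X) x := fun x hx => by
    rw [← hvd x hx]
    exact (V₁.hasDeriv x hx).cplx.add ((V₂.hasDeriv x hx).cplx.const_smul Complex.I)
  have hyder : ∀ x ∈ Icc 0 W.X, HasDerivWithinAt yc (W.yField ξ 0 lam x c q (vc x) (yc x))
      (Icc 0 W.X) x := fun x hx => by
    have e1 := ((V₁.hasDeriv_M x hx).cplx.fun_add
      ((V₂.hasDeriv_M x hx).cplx.fun_const_smul Complex.I)).fun_const_smul lam
    have e2 : ∀ j : Fin m, HasDerivWithinAt
        (fun x => cplx n (F₁ j.succ x) + Complex.I • cplx n (F₂ j.succ x))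
        (W.Ac j.succ x *ᵥ vc x - W.Bc j.succ 0 x *ᵥ vdc x - (Complex.I * c) •
          ∑ k : Fin m, (ξ k.succ : ℂ) • (W.Bc j.succ k.succ x *ᵥ cplx n (deriv W.u x)))
        (Icc 0 W.X) x := fun j => by
      refine ((V₁.hasDeriv_F j.succ x hx).cplx.fun_add
        ((V₂.hasDeriv_F j.succ x hx).cplx.fun_const_smul Complex.I)).congr_deriv ?_
      rw [← sum_smul_add_I_smul hδ]
      simp only [hvc, hvdc, map_sub, map_sum, cplx_smul, Ac, Bc, ← map_mulVec_cplx,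
        Matrix.mulVec_add, Matrix.mulVec_smul]
      module
    have e3 := (HasDerivWithinAt.fun_sum (u := Finset.univ) fun j _ =>
      (e2 j).fun_const_smul (ξ j.succ : ℂ)).fun_const_smul Complex.I
    refine (e1.fun_add e3).congr_deriv ?_
    rw [yField, ← hvd x hx]
    simp only [transA, colB, transB, Matrix.sum_mulVec, Matrix.smul_mulVec, smul_sub,
      Finset.sum_sub_distrib, zero_smul, add_zero]
    have e4 : ∑ j : Fin m, (ξ j.succ : ℂ) • (Complex.I * c) • ∑ k : Fin m, (ξ k.succ : ℂ) •
        (W.Bc j.succ k.succ x *ᵥ cplx n (deriv W.u x)) = (Complex.I * c) • ∑ j : Fin m,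
        ∑ k : Fin m, ((ξ k.succ : ℂ) * ξ j.succ) •
        (W.Bc j.succ k.succ x *ᵥ cplx n (deriv W.u x)) := by
      simp only [Finset.smul_sum, smul_smul]
      exact Finset.sum_congr rfl fun j _ => Finset.sum_congr rfl fun k _ => by
        congr 1; ring
    rw [e4, smul_smul, ← mul_assoc, Complex.I_mul_I]
    module
  obtain ⟨C, hC⟩ := W.exists_norm_sysMap_le ξ h0 h1 0 lam
  have hC0 : 0 ≤ C := (norm_nonneg _).trans (hC 0)
  have huniq := ODE_solution_unique_of_mem_Icc_right (a := 0) (b := W.X)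
    (v := fun t Y => W.sysMap ξ 0 lam t Y) (s := fun _ => univ) (K := ⟨C, hC0⟩)
    (f := fun t => ((c, q, v t, y t) : EigState n))
    (g := fun t => ((c, q, vc t, yc t) : EigState n))
    (fun t _ => ((W.sysMap ξ 0 lam t).lipschitz.weaken (hC t)).lipschitzOnWith)
    (fun t _ => (hp.hasDerivAt t).continuousAt.continuousWithinAt)
    (fun t _ => (hp.hasDerivAt t).hasDerivWithinAt) (fun _ _ => trivial)
    (fun t ht => (continuousWithinAt_const.prodMk (continuousWithinAt_const.prodMk
      ((hvder t ht).continuousWithinAt.prodMk (hyder t ht).continuousWithinAt))))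
    (fun t ht => ((hasDerivWithinAt_const t _ c).prodMk ((hasDerivWithinAt_const t _ q).prodMk
      ((hvder t (Ico_subset_Icc_self ht)).prodMk
        (hyder t (Ico_subset_Icc_self ht))))).mono_of_mem_nhdsWithin
        (Icc_mem_nhdsGE_of_mem ht))
    (fun _ _ => trivial)
    (by simp [hvc, hyc, V₁.init, V₂.init, hv, hy, V₁.M_zero, V₂.M_zero, V₁.F_zero, V₂.F_zero])
    (right_mem_Icc.2 W.X_pos.le)
  simp only [Prod.mk.injEq, true_and] at huniq
  exact huniq

end PeriodicWave

end

/-! ### The jump conditions at `ε = 0` and the averaged system. -/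

section

open Set Filter Topology

namespace PeriodicWave

variable {n m : ℕ} {L : ConsLaw n m} {W : PeriodicWave L} {ξ : Fin (m + 1) → ℝ}

variable (W ξ) in
/-- The derivative at the wave of the averaged flux in the direction `ξ`. -/
noncomputable def fluxDeriv (p : WaveParam n m) : Fin n ⊕ Fin (m + 1) → ℝ :=
  ∑ j, ξ j • fderiv ℝ (L.avgFlux j) W.base p

/-- The derivatives of `H` and of the averaged system along a complex tangent vector. -/
theorem exists_variation_pair (h0 : L.H0) (h1 : L.H1) {p₁ p₂ : WaveParam n m}
    {lam c : ℂ} {q : Fin n → ℂ} {v y : ℝ → Fin n → ℂ} (hp : W.IsEigPair ξ 0 lam c q v y)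
    (hX : (p₁.period : ℂ) + Complex.I * p₂.period = -(Complex.I * W.X * ξ 0) * c)
    (hδ : ∀ j, (p₁.2.2.2.1 j : ℂ) + Complex.I * p₂.2.2.2.1 j = Complex.I * c * ξ j.succ)
    (hs : (p₁.speed : ℂ) + Complex.I * p₂.speed = -(lam * c))
    (hq : cplx n p₁.const + Complex.I • cplx n p₂.const = q)
    (hv : cplx n p₁.init + Complex.I • cplx n p₂.init = v 0) (hy : y 0 = 0) :
    cplx n (fderiv ℝ L.H W.base p₁) + Complex.I • cplx n (fderiv ℝ L.H W.base p₂) =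
      (-(Complex.I * W.X * ξ 0)) • c • cplx n (deriv W.u 0) + v W.X - v 0 ∧
    (∀ a, lam * ((fderiv ℝ L.density W.base p₁ (Sum.inl a) : ℂ)
        + Complex.I * fderiv ℝ L.density W.base p₂ (Sum.inl a))
      + Complex.I * ((W.fluxDeriv ξ p₁ (Sum.inl a) : ℂ)
        + Complex.I * W.fluxDeriv ξ p₂ (Sum.inl a)) =
      (W.X : ℂ)⁻¹ * (y W.X + (-(Complex.I * W.X * ξ 0)) •
        (c • (Complex.I • W.transFlux ξ 0 + lam • cplx n (W.u 0)) - q)) a) := by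
  obtain ⟨v₁, vd₁, M₁, F₁, V₁, H₁, D₁, A₁⟩ := W.exists_isVariation h0 h1 p₁
  obtain ⟨v₂, vd₂, M₂, F₂, V₂, H₂, D₂, A₂⟩ := W.exists_isVariation h0 h1 p₂
  obtain ⟨hvX, hyX⟩ := hp.eq_variation h0 h1 V₁ V₂ hδ hs hq hv hy
  have hX0 : (W.X : ℂ) ≠ 0 := by exact_mod_cast W.X_pos.ne'
  constructor
  · rw [H₁, H₂, hvX, ← hv]
    simp only [map_sub, map_add, cplx_smul]
    linear_combination (norm := module) hX • cplx n (deriv W.u 0)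
  have hD : ∀ {p : WaveParam n m} {v vd M : ℝ → Fin n → ℝ} {F : Fin (m + 1) → ℝ → Fin n → ℝ},
      W.IsVariation p v vd M F → fderiv ℝ L.density W.base p = Sum.elim
        (W.X⁻¹ • (M W.X + p.period • (W.u 0 - W.meanU)))
        (W.X⁻¹ • (Fin.cons 0 p.2.2.2.1 : Fin (m + 1) → ℝ)
          - (p.period / W.X ^ 2) • (Pi.single 0 1 : Fin (m + 1) → ℝ)) → ∀ a,
      (fderiv ℝ L.density W.base p (Sum.inl a) : ℂ) = ((W.X : ℂ)⁻¹ • cplx n (M W.X)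
        + ((W.X : ℂ)⁻¹ * p.period) • (cplx n (W.u 0) - cplx n W.meanU)) a := by
    intro p v vd M F _ h a
    rw [h]
    simp
    ring
  have hF : ∀ {p : WaveParam n m} {v vd M : ℝ → Fin n → ℝ} {F : Fin (m + 1) → ℝ → Fin n → ℝ},
      W.IsVariation p v vd M F → (∀ j, fderiv ℝ (L.avgFlux j) W.base p = Sum.elim
        (W.X⁻¹ • (F j W.X + p.period • (W.flux j 0 - W.meanFlux j)))
        (Pi.single j (p.speed * W.X⁻¹))) → ∀ a,
      (W.fluxDeriv ξ p (Sum.inl a) : ℂ) = ((ξ 0 : ℂ) • (-∑ j : Fin m, (p.2.2.2.1 j : ℂ) •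
          cplx n (W.meanFlux j.succ) + (p.speed : ℂ) • cplx n W.meanU + cplx n p.const)
        + (W.X : ℂ)⁻¹ • ∑ j : Fin m, (ξ j.succ : ℂ) • cplx n (F j.succ W.X)
        + ((W.X : ℂ)⁻¹ * p.period) • (W.transFlux ξ 0
          - ∑ j : Fin m, (ξ j.succ : ℂ) • cplx n (W.meanFlux j.succ))) a := by
    intro p v vd M F hV h a
    have hm0 : W.meanFlux 0 = W.q := by
      simp [meanFlux, W.flux_zero, W.X_pos.ne']
    have e1 : (W.fluxDeriv ξ p (Sum.inl a) : ℝ) = (ξ 0 • (-∑ j : Fin m, p.2.2.2.1 j •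
          W.meanFlux j.succ + p.speed • W.meanU + p.const)
        + W.X⁻¹ • ∑ j : Fin m, ξ j.succ • F j.succ W.X
        + (W.X⁻¹ * p.period) • (∑ j : Fin m, ξ j.succ • W.flux j.succ 0
          - ∑ j : Fin m, ξ j.succ • W.meanFlux j.succ)) a := by
      simp only [fluxDeriv, h, Fin.sum_univ_succ, hm0, W.flux_zero, sub_self,
        hV.F_zero_eq h0 h1, Pi.add_apply, Pi.smul_apply, Sum.elim_inl,
        Finset.sum_apply, Pi.sub_apply, smul_eq_mul, ← Finset.sum_sub_distrib, Finset.mul_sum,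
        add_assoc, ← Finset.sum_add_distrib]
      refine congrArg₂ (· + ·) ?_ (Finset.sum_congr rfl fun j _ => by ring)
      rw [mul_zero, add_zero, inv_mul_cancel_left₀ W.X_pos.ne']
    rw [e1]
    simp [transFlux]
  intro a
  rw [hD V₁ D₁, hD V₂ D₂, hF V₁ A₁, hF V₂ A₂, ← smul_eq_mul (W.X : ℂ)⁻¹,
    ← Pi.smul_apply (W.X : ℂ)⁻¹]
  have hX' : (W.X : ℂ)⁻¹ * p₁.period + Complex.I * ((W.X : ℂ)⁻¹ * p₂.period)
      = -(Complex.I * ξ 0) * c := by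
    have : (W.X : ℂ)⁻¹ * p₁.period + Complex.I * ((W.X : ℂ)⁻¹ * p₂.period)
      = (W.X : ℂ)⁻¹ * (p₁.period + Complex.I * p₂.period) := by ring
    rw [this, hX]
    field_simp
  -- The mean values, which enter through the variations of the period, the direction and the speed,
  -- cancel by `hX'`, `hδ` and `hs`; only the boundary values at `0` survive.
  have hvec : lam • (((W.X : ℂ)⁻¹ • cplx n (M₁ W.X)
        + ((W.X : ℂ)⁻¹ * p₁.period) • (cplx n (W.u 0) - cplx n W.meanU)) +
        Complex.I • ((W.X : ℂ)⁻¹ • cplx n (M₂ W.X)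
        + ((W.X : ℂ)⁻¹ * p₂.period) • (cplx n (W.u 0) - cplx n W.meanU)))
      + Complex.I • (((ξ 0 : ℂ) • (-∑ j : Fin m, (p₁.2.2.2.1 j : ℂ) •
          cplx n (W.meanFlux j.succ) + (p₁.speed : ℂ) • cplx n W.meanU + cplx n p₁.const)
        + (W.X : ℂ)⁻¹ • ∑ j : Fin m, (ξ j.succ : ℂ) • cplx n (F₁ j.succ W.X)
        + ((W.X : ℂ)⁻¹ * p₁.period) • (W.transFlux ξ 0
          - ∑ j : Fin m, (ξ j.succ : ℂ) • cplx n (W.meanFlux j.succ))) +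
        Complex.I • ((ξ 0 : ℂ) • (-∑ j : Fin m, (p₂.2.2.2.1 j : ℂ) •
          cplx n (W.meanFlux j.succ) + (p₂.speed : ℂ) • cplx n W.meanU + cplx n p₂.const)
        + (W.X : ℂ)⁻¹ • ∑ j : Fin m, (ξ j.succ : ℂ) • cplx n (F₂ j.succ W.X)
        + ((W.X : ℂ)⁻¹ * p₂.period) • (W.transFlux ξ 0
          - ∑ j : Fin m, (ξ j.succ : ℂ) • cplx n (W.meanFlux j.succ)))) =
      (W.X : ℂ)⁻¹ • (y W.X + (-(Complex.I * W.X * ξ 0)) •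
        (c • (Complex.I • W.transFlux ξ 0 + lam • cplx n (W.u 0)) - q)) := by
    have e1 := sum_smul_add_I_smul hδ fun j => cplx n (W.meanFlux j.succ)
    have e2 : (W.X : ℂ)⁻¹ * (-(Complex.I * W.X * ξ 0)) = -(Complex.I * ξ 0) := by field_simp
    rw [smul_add (W.X : ℂ)⁻¹, smul_smul (W.X : ℂ)⁻¹ (-_), e2, hyX, ← hq]
    simp only [smul_add (ξ (Fin.succ _) : ℂ), Finset.sum_add_distrib,
      smul_comm (ξ (Fin.succ _) : ℂ) Complex.I, ← Finset.smul_sum]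
    linear_combination (norm := module) hX' • (lam • (cplx n (W.u 0) - cplx n W.meanU)
      + Complex.I • (W.transFlux ξ 0
          - ∑ j : Fin m, (ξ j.succ : ℂ) • cplx n (W.meanFlux j.succ)))
      - (Complex.I * ξ 0) • e1 + (Complex.I * ξ 0) • hs • cplx n W.meanU
  exact congrFun hvec a

lemma fluxDeriv_inr (h0 : L.H0) (h1 : L.H1) (p : WaveParam n m) (j : Fin (m + 1)) :
    W.fluxDeriv ξ p (Sum.inr j) = ξ j * (p.speed * W.X⁻¹) := by
  obtain ⟨v, vd, M, F, V, H, D, A⟩ := W.exists_isVariation h0 h1 p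
  simp [fluxDeriv, A, Pi.single_apply]

lemma density_inr_zero (h0 : L.H0) (h1 : L.H1) (p : WaveParam n m) :
    fderiv ℝ L.density W.base p (Sum.inr 0) = -(p.period / W.X ^ 2) := by
  obtain ⟨v, vd, M, F, V, H, D, A⟩ := W.exists_isVariation h0 h1 p
  simp [D]

lemma density_inr_succ (h0 : L.H0) (h1 : L.H1) (p : WaveParam n m) (j : Fin m) :
    fderiv ℝ L.density W.base p (Sum.inr j.succ) = W.X⁻¹ * p.2.2.2.1 j := by
  obtain ⟨v, vd, M, F, V, H, D, A⟩ := W.exists_isVariation h0 h1 p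
  simp [D]

/-! ### Eigenvalues of the averaged system -/

lemma calA_mulVec (hnd : W.Nondegenerate) (t : W.tangent) :
    W.calA hnd ξ *ᵥ W.dDensity t = W.fluxDeriv ξ t := by
  have h2 : (LinearEquiv.ofBijective W.dDensity hnd).symm (W.dDensity t) = t :=
    (LinearEquiv.symm_apply_eq _).2 rfl
  rw [calA, LinearMap.toMatrix'_mulVec, LinearMap.comp_apply, LinearEquiv.coe_coe, h2]
  simp [fluxDeriv, dFlux]

lemma calA_map_mulVec (hnd : W.Nondegenerate) (t₁ t₂ : W.tangent) :
    ((W.calA hnd ξ).map fun r : ℝ => (r : ℂ)) *ᵥ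
      (fun i => (W.dDensity t₁ i : ℂ) + Complex.I * W.dDensity t₂ i) =
      fun i => (W.fluxDeriv ξ t₁ i : ℂ) + Complex.I * W.fluxDeriv ξ t₂ i := by
  rw [map_mulVec_add_I, calA_mulVec, calA_mulVec]

lemma add_I_mul_eq_zero {a b : ℝ} (h : (a : ℂ) + Complex.I * b = 0) : a = 0 ∧ b = 0 := by
  have h1 := congrArg Complex.re h
  have h2 := congrArg Complex.im h
  simp at h1 h2
  exact ⟨h1, h2⟩

lemma cplx_add_I_smul_eq_zero {a b : Fin n → ℝ} (h : cplx n a + Complex.I • cplx n b = 0) :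
    a = 0 ∧ b = 0 := by
  have := fun i => add_I_mul_eq_zero (congrFun h i)
  exact ⟨funext fun i => (this i).1, funext fun i => (this i).2⟩

lemma cplx_re_add_I_smul_im (z : Fin n → ℂ) :
    cplx n (fun i => (z i).re) + Complex.I • cplx n (fun i => (z i).im) = z := by
  ext i
  simp [mul_comm Complex.I]

lemma dotProduct_cplx (a b d : Fin n → ℝ) : (cplx n a + Complex.I • cplx n b) ⬝ᵥ cplx n d =
    ((a ⬝ᵥ d : ℝ) : ℂ) + Complex.I * ((b ⬝ᵥ d : ℝ) : ℂ) := by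
  simp [dotProduct, add_mul, Finset.sum_add_distrib, Finset.mul_sum, mul_assoc]

/-- The jump conditions make real and imaginary parts of the variation tangent vectors, and their
image under `dDensity` is an eigenvector. It is nonzero by nondegeneracy; `λ ≠ 0` is used to recover
`c` from the speed `-λ c`. -/
theorem mem_spectrum_of_isEigPair (h0 : L.H0) (h1 : L.H1) (hnd : W.Nondegenerate)
    {lam c : ℂ} (hlam : lam ≠ 0) {q : Fin n → ℂ} {v y : ℝ → Fin n → ℂ}
    (hp : W.IsEigPair ξ 0 lam c q v y) (hy : y 0 = 0)
    (hdot : v 0 ⬝ᵥ cplx n (deriv W.u 0) = 0) (hne : ¬ (c = 0 ∧ v 0 = 0 ∧ q = 0))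
    (hvX : (-(Complex.I * W.X * ξ 0)) • c • cplx n (deriv W.u 0) + v W.X - v 0 = 0)
    (hyX : y W.X + (-(Complex.I * W.X * ξ 0)) •
      (c • (Complex.I • W.transFlux ξ 0 + lam • cplx n (W.u 0)) - q) = 0) :
    Complex.I * lam ∈ spectrum ℂ ((W.calA hnd ξ).map fun r : ℝ => (r : ℂ)) := by
  have hri : ∀ z : ℂ, (z.re : ℂ) + Complex.I * z.im = z := fun z => by
    rw [mul_comm]; exact Complex.re_add_im z
  let p (π : ℂ → ℝ) : WaveParam n m := (π (-(Complex.I * W.X * ξ 0) * c), fun i => π (v 0 i),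
    π (-(lam * c)), fun j => π (Complex.I * c * ξ j.succ), fun i => π (q i))
  have hX : ((p Complex.re).period : ℂ) + Complex.I * (p Complex.im).period
    = -(Complex.I * W.X * ξ 0) * c := hri _
  have hδ : ∀ j, ((p Complex.re).2.2.2.1 j : ℂ) + Complex.I * (p Complex.im).2.2.2.1 j
    = Complex.I * c * ξ j.succ := fun j => hri _
  have hs : ((p Complex.re).speed : ℂ) + Complex.I * (p Complex.im).speed = -(lam * c) :=
    hri (-(lam * c))
  have hq : cplx n (p Complex.re).const + Complex.I • cplx n (p Complex.im).const = q :=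
    cplx_re_add_I_smul_im q
  have hv : cplx n (p Complex.re).init + Complex.I • cplx n (p Complex.im).init = v 0 :=
    cplx_re_add_I_smul_im (v 0)
  obtain ⟨hH, hM⟩ := exists_variation_pair h0 h1 hp hX hδ hs hq hv hy
  rw [hvX] at hH
  have hH' := cplx_add_I_smul_eq_zero hH
  rw [← hv, dotProduct_cplx] at hdot
  have hdot' := add_I_mul_eq_zero hdot
  let t₁ : W.tangent := ⟨p Complex.re, hH'.1, hdot'.1⟩
  let t₂ : W.tangent := ⟨p Complex.im, hH'.2, hdot'.2⟩
  have hX0 : (W.X : ℂ) ≠ 0 := by exact_mod_cast W.X_pos.ne'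
  have key : ∀ i, lam * ((W.dDensity t₁ i : ℂ) + Complex.I * W.dDensity t₂ i)
      + Complex.I * ((W.fluxDeriv ξ t₁ i : ℂ) + Complex.I * W.fluxDeriv ξ t₂ i) = 0 := by
    rintro (a | j)
    · refine (hM a).trans ?_
      rw [hyX]; simp
    · have e1 : ∀ t : W.tangent, W.dDensity t = fderiv ℝ L.density W.base t := fun t => rfl
      rw [e1, e1, fluxDeriv_inr h0 h1, fluxDeriv_inr h0 h1]
      refine Fin.cases ?_ (fun j => ?_) j
      · rw [density_inr_zero h0 h1, density_inr_zero h0 h1]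
        push_cast
        have hXX : (W.X : ℂ) / W.X ^ 2 = 1 / W.X := by field_simp
        linear_combination (-(lam / W.X ^ 2)) * hX + (Complex.I * ξ 0 / W.X) * hs
          + (lam * Complex.I * c * ξ 0) * hXX
      · rw [density_inr_succ h0 h1, density_inr_succ h0 h1]
        push_cast
        linear_combination (lam / W.X) * hδ j + (Complex.I * ξ j.succ / W.X) * hs
  rw [mem_spectrum_iff_exists_mulVec]
  refine ⟨fun i => (W.dDensity t₁ i : ℂ) + Complex.I * W.dDensity t₂ i, fun hz => hne ?_, ?_⟩
  · have e1 : W.dDensity t₁ = 0 := funext fun i => (add_I_mul_eq_zero (congrFun hz i)).1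
    have e2 : W.dDensity t₂ = 0 := funext fun i => (add_I_mul_eq_zero (congrFun hz i)).2
    have e3 : p Complex.re = 0 :=
      congrArg Subtype.val (hnd.1 (e1.trans (map_zero _).symm) : t₁ = 0)
    have e4 : p Complex.im = 0 :=
      congrArg Subtype.val (hnd.1 (e2.trans (map_zero _).symm) : t₂ = 0)
    rw [e3, e4] at hs hq hv
    refine ⟨?_, ?_, ?_⟩
    · have : lam * c = 0 := by
        rw [← neg_eq_zero, ← hs]; simp [WaveParam.speed]
      exact (mul_eq_zero.1 this).resolve_left hlam
    · rw [← hv]; simp [WaveParam.init]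
    · rw [← hq]; simp [WaveParam.const]
  · rw [calA_map_mulVec]
    ext i
    simp only [Pi.smul_apply, smul_eq_mul]
    linear_combination (-Complex.I) * key i
      + ((W.fluxDeriv ξ t₁ i : ℂ) + Complex.I * W.fluxDeriv ξ t₂ i) * Complex.I_mul_I

/-- Nondegeneracy lifts an eigenvector to tangent vectors. Dividing their speed by `-λ` defines `c`,
and the rows of the eigenvalue equation belonging to `Ω N` then force the period and the direction
to have the form required by the ansatz. -/
theorem exists_isEigPair_of_mem_spectrum (h0 : L.H0) (h1 : L.H1) (hnd : W.Nondegenerate)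
    {lam : ℂ} (hlam : lam ≠ 0)
    (hspec : Complex.I * lam ∈ spectrum ℂ ((W.calA hnd ξ).map fun r : ℝ => (r : ℂ))) :
    ∃ (c : ℂ) (a q : Fin n → ℂ), ¬ (c = 0 ∧ a = 0 ∧ q = 0) ∧ a ⬝ᵥ cplx n (deriv W.u 0) = 0 ∧
      ∀ v y, W.IsEigPair ξ 0 lam c q v y → v 0 = a → y 0 = 0 →
        (-(Complex.I * W.X * ξ 0)) • c • cplx n (deriv W.u 0) + v W.X - v 0 = 0 ∧
        y W.X + (-(Complex.I * W.X * ξ 0)) •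
          (c • (Complex.I • W.transFlux ξ 0 + lam • cplx n (W.u 0)) - q) = 0 := by
  obtain ⟨D, hD, hDeq⟩ := (mem_spectrum_iff_exists_mulVec _ _).1 hspec
  obtain ⟨t₁, ht₁⟩ := hnd.2 fun i => (D i).re
  obtain ⟨t₂, ht₂⟩ := hnd.2 fun i => (D i).im
  have hX0 : (W.X : ℂ) ≠ 0 := by exact_mod_cast W.X_pos.ne'
  have hDt : D = fun i => (W.dDensity t₁ i : ℂ) + Complex.I * W.dDensity t₂ i := by
    ext i
    rw [ht₁, ht₂, mul_comm]
    exact (Complex.re_add_im _).symm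
  rw [hDt, calA_map_mulVec] at hDeq
  have key : ∀ i, lam * ((W.dDensity t₁ i : ℂ) + Complex.I * W.dDensity t₂ i)
      + Complex.I * ((W.fluxDeriv ξ t₁ i : ℂ) + Complex.I * W.fluxDeriv ξ t₂ i) = 0 := fun i => by
    have := congrFun hDeq i
    simp only [Pi.smul_apply, smul_eq_mul] at this
    linear_combination Complex.I * this
      + lam * ((W.dDensity t₁ i : ℂ) + Complex.I * W.dDensity t₂ i) * Complex.I_mul_I
  have e1 : ∀ t : W.tangent, W.dDensity t = fderiv ℝ L.density W.base t := fun t => rfl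
  set p₁ : WaveParam n m := t₁.1 with hp₁
  set p₂ : WaveParam n m := t₂.1 with hp₂
  set c : ℂ := -(((p₁.speed : ℂ) + Complex.I * p₂.speed) / lam) with hc
  have hs : (p₁.speed : ℂ) + Complex.I * p₂.speed = -(lam * c) := by rw [hc]; field_simp
  have hX : (p₁.period : ℂ) + Complex.I * p₂.period = -(Complex.I * W.X * ξ 0) * c := by
    have h2 := key (Sum.inr 0)
    rw [e1, e1, fluxDeriv_inr h0 h1, fluxDeriv_inr h0 h1, density_inr_zero h0 h1,
      density_inr_zero h0 h1] at h2
    push_cast at h2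
    have h3 : lam * ((p₁.period : ℂ) + Complex.I * p₂.period) =
        lam * (-(Complex.I * W.X * ξ 0) * c) := by
      field_simp at h2
      linear_combination -h2 + (Complex.I * W.X * ξ 0) * hs
    exact mul_left_cancel₀ hlam h3
  have hδ : ∀ j, (p₁.2.2.2.1 j : ℂ) + Complex.I * p₂.2.2.2.1 j = Complex.I * c * ξ j.succ := by
    intro j
    have h2 := key (Sum.inr j.succ)
    rw [e1, e1, fluxDeriv_inr h0 h1, fluxDeriv_inr h0 h1, density_inr_succ h0 h1,
      density_inr_succ h0 h1] at h2
    push_cast at h2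
    have h3 : lam * ((p₁.2.2.2.1 j : ℂ) + Complex.I * p₂.2.2.2.1 j) =
        lam * (Complex.I * c * ξ j.succ) := by
      field_simp at h2
      linear_combination h2 - (Complex.I * ξ j.succ) * hs
    exact mul_left_cancel₀ hlam h3
  refine ⟨c, cplx n p₁.init + Complex.I • cplx n p₂.init,
    cplx n p₁.const + Complex.I • cplx n p₂.const, ?_, ?_, ?_⟩
  · rintro ⟨hc0, ha0, hq0⟩
    refine hD ?_
    obtain ⟨ha1, ha2⟩ := cplx_add_I_smul_eq_zero ha0
    obtain ⟨hq1, hq2⟩ := cplx_add_I_smul_eq_zero hq0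
    rw [hc0, mul_zero, neg_zero] at hs
    obtain ⟨hs1, hs2⟩ := add_I_mul_eq_zero hs
    rw [hc0, mul_zero] at hX
    obtain ⟨hX1, hX2⟩ := add_I_mul_eq_zero hX
    simp only [hc0, mul_zero, zero_mul] at hδ
    have hδ1 : p₁.2.2.2.1 = 0 := funext fun j => (add_I_mul_eq_zero (hδ j)).1
    have hδ2 : p₂.2.2.2.1 = 0 := funext fun j => (add_I_mul_eq_zero (hδ j)).2
    have z1 : t₁ = 0 := Subtype.ext
      (Prod.ext hX1 (Prod.ext ha1 (Prod.ext hs1 (Prod.ext hδ1 hq1))))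
    have z2 : t₂ = 0 := Subtype.ext
      (Prod.ext hX2 (Prod.ext ha2 (Prod.ext hs2 (Prod.ext hδ2 hq2))))
    rw [hDt, z1, z2]
    ext i
    simp
  · rw [dotProduct_cplx, t₁.2.2, t₂.2.2]
    simp
  · intro v y hp hv hy
    obtain ⟨hH, hM⟩ := exists_variation_pair h0 h1 hp hX hδ hs rfl hv.symm hy
    constructor
    · rw [← hH, t₁.2.1, t₂.2.1]
      simp
    · ext a
      have h3 := hM a
      have h4 := key (Sum.inl a)
      rw [e1, e1] at h4
      rw [h4] at h3
      exact (mul_eq_zero.1 h3.symm).resolve_left (inv_ne_zero hX0)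

end PeriodicWave

end

/-! ### The jump determinant and the conclusion. -/

section

open Set Filter Topology

namespace PeriodicWave

variable {n m : ℕ} {L : ConsLaw n m} {W : PeriodicWave L} {ξ : Fin (m + 1) → ℝ}

variable (W ξ) in
/-- The map that sends the data `(c, a, q)` of a solution of the first-order system with evolution
`T` over a period to its jump; solutions without jump are Floquet solutions. -/
noncomputable def jumpMap (φ e lam : ℂ) (T : EigState n →L[ℂ] EigState n) :
    (ℂ × (Fin n → ℂ) × (Fin n → ℂ)) →ₗ[ℂ] (ℂ × (Fin n → ℂ) × (Fin n → ℂ)) where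
  -- The first component fixes the splitting of `w` into a multiple of `ū'` and `v`; it balances the
  -- extra unknown `c`, so that the map is an endomorphism and has a determinant.
  toFun Z := (Z.2.1 ⬝ᵥ cplx n (deriv W.u 0),
    φ • Z.1 • cplx n (deriv W.u 0) + (T (Z.1, Z.2.2, Z.2.1, 0)).2.2.1 - e • Z.2.1,
    (T (Z.1, Z.2.2, Z.2.1, 0)).2.2.2 +
      φ • (Z.1 • (Complex.I • W.transFlux ξ 0 + lam • cplx n (W.u 0)) - Z.2.2))
  map_add' := by
    rintro ⟨c, a, q⟩ ⟨c', a', q'⟩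
    have hT : T (c + c', q + q', a + a', 0) = T (c, q, a, 0) + T (c', q', a', 0) := by
      rw [← map_add]; simp
    simp only [Prod.mk_add_mk, hT, Prod.fst_add, Prod.snd_add, add_dotProduct,
      Prod.mk.injEq, true_and]
    constructor <;> module
  map_smul' := by
    rintro r ⟨c, a, q⟩
    have hT : T (r * c, r • q, r • a, 0) = r • T (c, q, a, 0) := by
      rw [← map_smul]; simp
    simp only [Prod.smul_mk, smul_eq_mul, hT, Prod.smul_fst, Prod.smul_snd, smul_dotProduct,
      Prod.mk.injEq, true_and, RingHom.id_apply]
    constructor <;> module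

lemma exists_jumpMap_eq_zero {φ e lam : ℂ} {T : EigState n →L[ℂ] EigState n}
    (h : LinearMap.det (W.jumpMap ξ φ e lam T) = 0) :
    ∃ (c : ℂ) (a q : Fin n → ℂ), ¬ (c = 0 ∧ a = 0 ∧ q = 0) ∧ a ⬝ᵥ cplx n (deriv W.u 0) = 0 ∧
      φ • c • cplx n (deriv W.u 0) + (T (c, q, a, 0)).2.2.1 - e • a = 0 ∧
      (T (c, q, a, 0)).2.2.2 +
        φ • (c • (Complex.I • W.transFlux ξ 0 + lam • cplx n (W.u 0)) - q) = 0 := by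
  obtain ⟨⟨c, a, q⟩, hZ, hZ0⟩ := Submodule.exists_mem_ne_zero_of_ne_bot
    (LinearMap.det_eq_zero_iff_ker_ne_bot.1 h)
  rw [LinearMap.mem_ker] at hZ
  refine ⟨c, a, q, ?_, congrArg Prod.fst hZ, congrArg (fun Z => Z.2.1) hZ,
    congrArg (fun Z => Z.2.2) hZ⟩
  rintro ⟨rfl, rfl, rfl⟩
  exact hZ0 rfl

lemma det_jumpMap_eq_zero {φ e lam : ℂ} {T : EigState n →L[ℂ] EigState n} {c : ℂ}
    {a q : Fin n → ℂ} (hne : ¬ (c = 0 ∧ a = 0 ∧ q = 0)) (hdot : a ⬝ᵥ cplx n (deriv W.u 0) = 0)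
    (hv : φ • c • cplx n (deriv W.u 0) + (T (c, q, a, 0)).2.2.1 - e • a = 0)
    (hy : (T (c, q, a, 0)).2.2.2 +
        φ • (c • (Complex.I • W.transFlux ξ 0 + lam • cplx n (W.u 0)) - q) = 0) :
    LinearMap.det (W.jumpMap ξ φ e lam T) = 0 := by
  rw [LinearMap.det_eq_zero_iff_ker_ne_bot, Submodule.ne_bot_iff]
  refine ⟨(c, a, q), ?_, fun h => hne ?_⟩
  · rw [LinearMap.mem_ker]
    exact Prod.ext hdot (Prod.ext hv hy)
  · simpa using h

/-- An eigenvalue in the upper half plane is a zero `z₀ = -i μ` of the jump determinant at `ε = 0`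
with `Re z₀ = Im μ > 0`. The disc of radius `Im μ` about `z₀` lies in the right half plane, and the
zero persists there for small `ε`, which contradicts stability. -/
theorem im_nonpos_of_mem_spectrum (h0 : L.H0) (h1 : L.H1) (hnd : W.Nondegenerate)
    (hstab : W.LowFreqStable) (ξ : Fin (m + 1) → ℝ) (μ : ℂ)
    (hμ : μ ∈ spectrum ℂ ((W.calA hnd ξ).map fun r : ℝ => (r : ℂ))) : μ.im ≤ 0 := by
  by_contra! him
  set z₀ : ℂ := -(Complex.I * μ) with hz₀
  have hre : z₀.re = μ.im := by simp [hz₀]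
  have hz₀μ : Complex.I * z₀ = μ := by
    rw [hz₀]; linear_combination (-μ) * Complex.I_mul_I
  set R : ℝ := ‖z₀‖ + μ.im + 1 with hR
  have hR1 : 1 ≤ R := by have := norm_nonneg z₀; linarith
  obtain ⟨Ψ, hΨ, hΨd⟩ := W.exists_evolution ξ h0 h1 R (by linarith)
  obtain ⟨φ, hφd, hφ0, hφ⟩ := exists_one_sub_exp_div (Complex.I * W.X * ξ 0)
  set G : ℂ → ℂ → (ℂ × (Fin n → ℂ) × (Fin n → ℂ)) →ₗ[ℂ] (ℂ × (Fin n → ℂ) × (Fin n → ℂ)) :=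
    fun ε lam => W.jumpMap ξ (φ ε) (Complex.exp (Complex.I * W.X * ξ 0 * ε)) lam (Ψ ε lam W.X)
    with hG
  have hpair : ∀ ε lam, ‖ε‖ < R → ‖lam‖ < R → ∀ c (a q : Fin n → ℂ),
      W.IsEigPair ξ ε lam c q (fun t => (Ψ ε lam t (c, q, a, 0)).2.2.1)
        (fun t => (Ψ ε lam t (c, q, a, 0)).2.2.2) ∧ (Ψ ε lam 0 (c, q, a, 0)).2.2.1 = a ∧
        (Ψ ε lam 0 (c, q, a, 0)).2.2.2 = 0 := by
    intro ε lam hε hlam c a q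
    obtain ⟨h2, h3⟩ := hΨ ε lam hε hlam (c, q, a, 0)
    have h4 := isEigPair_of_hasDerivAt h3
    rw [h2] at h4
    exact ⟨h4, by rw [h2], by rw [h2]⟩
  have hball : ∀ lam ∈ Metric.ball z₀ μ.im, ‖lam‖ < R ∧ 0 < lam.re := by
    intro lam hlam
    rw [mem_ball_iff_norm] at hlam
    constructor
    · have := norm_le_norm_add_norm_sub' lam z₀
      linarith
    · have := (Complex.abs_re_le_norm (lam - z₀)).trans_lt hlam
      rw [abs_lt, Complex.sub_re, hre] at this
      linarith [this.1]
  have hGd : DifferentiableOn ℂ (fun p : ℂ × ℂ => LinearMap.det (G p.1 p.2))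
      (Metric.ball 0 1 ×ˢ Metric.ball z₀ μ.im) := by
    refine differentiableOn_linearMap_det fun Z => ?_
    have hΨZ : ∀ Y : EigState n, DifferentiableOn ℂ (fun p : ℂ × ℂ => Ψ p.1 p.2 W.X Y)
        (Metric.ball 0 1 ×ˢ Metric.ball z₀ μ.im) := fun Y =>
      ((hΨd W.X).mono (prod_mono (Metric.ball_subset_ball hR1) fun lam hlam => by
        simpa using (hball lam hlam).1)).clm_apply (differentiableOn_const Y)
    have e1 := (hΨZ (Z.1, Z.2.2, Z.2.1, 0)).snd.snd.fst
    have e2 := (hΨZ (Z.1, Z.2.2, Z.2.1, 0)).snd.snd.snd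
    have e3 : Differentiable ℂ fun p : ℂ × ℂ => φ p.1 := hφd.comp differentiable_fst
    have e4 : Differentiable ℂ fun p : ℂ × ℂ => φ p.1 • Z.1 • cplx n (deriv W.u 0) :=
      e3.smul_const _
    have e5 : Differentiable ℂ fun p : ℂ × ℂ =>
        Complex.exp (Complex.I * W.X * ξ 0 * p.1) • Z.2.1 := by fun_prop
    have e6 : Differentiable ℂ fun p : ℂ × ℂ => φ p.1 •
        (Z.1 • (Complex.I • W.transFlux ξ 0 + p.2 • cplx n (W.u 0)) - Z.2.2) := by fun_prop
    exact (differentiableOn_const _).prodMk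
      (((e4.differentiableOn.fun_add e1).fun_sub e5.differentiableOn).prodMk
        (e2.fun_add e6.differentiableOn))
  have hz₀0 : z₀ ≠ 0 := fun h => by rw [h] at hre; simp at hre; linarith
  have hzero : LinearMap.det (G 0 z₀) = 0 := by
    obtain ⟨c, a, q, hne, hdot, hsol⟩ :=
      exists_isEigPair_of_mem_spectrum h0 h1 hnd (lam := z₀) hz₀0 (by rwa [hz₀μ])
    obtain ⟨h2, h3, h4⟩ := hpair 0 z₀ (by simpa using by linarith)
      (hball z₀ (Metric.mem_ball_self him)).1 c a q
    obtain ⟨h5, h6⟩ := hsol _ _ h2 h3 h4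
    simp only [h3] at h5
    refine det_jumpMap_eq_zero hne hdot ?_ ?_
    · simpa [hφ0] using h5
    · simpa only [hφ0] using h6
  have hfin := (Matrix.finite_spectrum ((W.calA hnd ξ).map fun r : ℝ => (r : ℂ))).image
    fun μ' => dist (-(Complex.I * μ')) z₀
  -- Zeros of the limiting determinant in the disc come from the finitely many eigenvalues of
  -- `𝒜(ξ)`, so some circle about `z₀` avoids them all. No statement on multiplicities is needed.
  obtain ⟨ρ, ⟨hρ0, hρ1⟩, hρ⟩ := ((Ioo_infinite him).sdiff hfin).nonempty
  have hsphere : ∀ z ∈ Metric.sphere z₀ ρ, LinearMap.det (G 0 z) ≠ 0 := by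
    intro z hz hdet
    have hzb : z ∈ Metric.ball z₀ μ.im := by
      rw [Metric.mem_sphere] at hz; rw [Metric.mem_ball]; linarith
    have hz0 : z ≠ 0 := fun h => by
      have := (hball z hzb).2
      rw [h] at this; simp at this
    obtain ⟨c, a, q, hne, hdot, hv, hy⟩ := exists_jumpMap_eq_zero hdet
    obtain ⟨h2, h3, h4⟩ := hpair 0 z (by simpa using by linarith) (hball z hzb).1 c a q
    refine hρ ⟨Complex.I * z, mem_spectrum_of_isEigPair h0 h1 hnd hz0 h2 h4 (by rw [h3]; exact hdot)
      (by rw [h3]; exact hne) ?_ ?_, ?_⟩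
    · simp only [h3]
      simpa [hφ0] using hv
    · simpa only [hφ0] using hy
    · have : -(Complex.I * (Complex.I * z)) = z := by linear_combination (-z) * Complex.I_mul_I
      simp only [this]
      exact hz
  have hev := eventually_exists_zero_of_differentiableOn
    (f := fun ε lam => LinearMap.det (G ε lam)) one_pos hρ0 hρ1 hGd hzero hsphere
  obtain ⟨r, hr, hstab⟩ := hstab
  have hcoe : Tendsto (fun e : ℝ => (e : ℂ)) (𝓝[>] 0) (𝓝 0) :=
    (Complex.continuous_ofReal.tendsto' 0 0 Complex.ofReal_zero).mono_left nhdsWithin_le_nhds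
  have hsmall : ∀ C : ℝ, ∀ᶠ e : ℝ in 𝓝[>] 0, e * C < r := fun C => by
    have : Tendsto (fun e : ℝ => e * C) (𝓝[>] 0) (𝓝 0) :=
      ((continuous_id.mul continuous_const).tendsto' 0 0 (zero_mul C)).mono_left nhdsWithin_le_nhds
    exact this.eventually_lt_const hr
  have hlt1 : ∀ᶠ e : ℝ in 𝓝[>] 0, e < 1 :=
    mem_of_superset (Ioo_mem_nhdsGT one_pos) fun _ h => h.2
  -- Undo the scaling: `z` stays bounded by `R`, so `e ξ` and `e z` fall below the threshold `r` for
  -- small `e > 0`.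
  obtain ⟨e, ⟨z, hz, hdet⟩, he1, he2, he3, he0⟩ := ((hcoe.eventually hev).and
    ((hsmall ‖ξ‖).and ((hsmall R).and (hlt1.and self_mem_nhdsWithin)))).exists
  have he0 : 0 < e := he0
  have hzb : z ∈ Metric.ball z₀ μ.im := by
    rw [Metric.mem_closedBall] at hz; rw [Metric.mem_ball]; linarith
  obtain ⟨hzR, hzre⟩ := hball z hzb
  obtain ⟨c, a, q, hne, hdot, hv, hy⟩ := exists_jumpMap_eq_zero hdet
  obtain ⟨h2, h3, h4⟩ := hpair e z (by rw [Complex.norm_real, Real.norm_of_nonneg he0.le]; linarith)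
    hzR c a q
  have he' : (e : ℂ) ≠ 0 := by exact_mod_cast he0.ne'
  have hexp : Complex.I * W.X * ξ 0 * e = Complex.I * W.X * (e * ξ 0) := by ring
  rw [hφ _ he', hexp] at hv hy
  have hE := h2.evans_eq_zero h0 h1 he0.ne' h4 (by rw [h3]; exact hdot) (by rw [h3]; exact hne)
    (by simp only [h3]; exact hv) hy
  have := hstab (e • ξ) (e * z)
    (by rw [norm_smul, Real.norm_of_nonneg he0.le]; exact he1)
    (by rw [norm_mul, Complex.norm_real, Real.norm_of_nonneg he0.le]; nlinarith) hE
  rw [Complex.re_ofReal_mul] at this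
  nlinarith

lemma calA_neg (hnd : W.Nondegenerate) (ξ : Fin (m + 1) → ℝ) :
    W.calA hnd (-ξ) = -W.calA hnd ξ := by
  have : (∑ j, (-ξ) j • W.dFlux j) ∘ₗ
      (LinearEquiv.ofBijective W.dDensity hnd).symm.toLinearMap =
      -((∑ j, ξ j • W.dFlux j) ∘ₗ
        (LinearEquiv.ofBijective W.dDensity hnd).symm.toLinearMap) :=
    LinearMap.ext fun D => by simp
  rw [calA, calA, this, map_neg]

end PeriodicWave

end

/-- Low-frequency spectral stability of a periodic wave of a system of viscous conservation laws in
`d = m + 1 ≥ 2` space dimensions forces the averaged system to be weakly hyperbolic. -/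
theorem corollary2 {n m : ℕ} (hm : 1 ≤ m) (L : ConsLaw n m) (W : PeriodicWave L)
    (h0 : L.H0) (h1 : L.H1) (h2 : W.H2) (hnd : W.Nondegenerate)
    (hstab : W.LowFreqStable) : W.WeaklyHyperbolic hnd := by
  intro ξ μ hμ
  refine le_antisymm (W.im_nonpos_of_mem_spectrum h0 h1 hnd hstab ξ μ hμ) ?_
  -- The opposite inequality is the first one for `-ξ` and `-μ`, because `𝒜` is odd in `ξ`.
  have hneg : -μ ∈ spectrum ℂ ((W.calA hnd (-ξ)).map fun r : ℝ => (r : ℂ)) := by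
    obtain ⟨D, hD, h⟩ := (mem_spectrum_iff_exists_mulVec _ _).1 hμ
    refine (mem_spectrum_iff_exists_mulVec _ _).2 ⟨D, hD, ?_⟩
    have hmap : (W.calA hnd (-ξ)).map (fun r : ℝ => (r : ℂ)) =
        -(W.calA hnd ξ).map fun r : ℝ => (r : ℂ) := by
      rw [PeriodicWave.calA_neg]; ext i j; simp
    rw [hmap, Matrix.neg_mulVec, h, neg_smul]
  have := W.im_nonpos_of_mem_spectrum h0 h1 hnd hstab (-ξ) (-μ) hneg
  simpa using this
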